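/- **Notation.** Let $0<|q|<1$, $0<|p|<1$, and $(x;q)=\prod_{k\ge0}(1-xq^k)$, $\theta(x;p)=(x;p)(p/x;p)$, $\theta(x;q;p)_m=\prod_{k=0}^{m-1}\theta(xq^k;p)$, $\Gamma(x;p,q)=\prod_{i,j\ge0}\frac{1-p^{i+1}q^{j+1}/x}{1-p^iq^jx}$. Several arguments, and $\pm$ in exponents, denote products. A function $f$ meromorphic on $\mathbb C^*$ belongs to $A(u;p,q)$ with pole order $m$ if $f(z)=f(1/z)=f(pz)$ and $\theta(pqz^{\pm1}/u;q;p)_m f(z)$ is holomorphic on $\mathbb C^*$. For $t_0\cdots t_5=pq$, $f\in A(t_4;p,q)$, $g\in A(t_5;p,q)$ of pole orders $m_f,m_g$, put $\tilde t_r=t_r$ $(r\le3)$, $\tilde t_4=t_4q^{-m_f}$, $\tilde t_5=t_5q^{-m_g}$ and $$\langle f,g\rangle_{t}=\frac{(q;q)(p;p)}{2\prod_{0\le r<s\le5}\Gamma(t_rt_s;p,q)}\int_C f(z)g(z)\frac{\prod_{r=0}^5\Gamma(t_rz^{\pm1};p,q)}{\Gamma(z^{\pm2};p,q)}\frac{dz}{2\pi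 iz},$$ where $C$ is a chain of closed curves in $\mathbb C^*$ with winding number $1$ around all points $p^iq^j\tilde t_r$ and $0$ around their reciprocals ($i,j\ge0$, $0\le r\le5$). Such a $C$ can exist only if no point $p^iq^j\tilde t_r$ is the reciprocal of another such point or of itself; call $p$ *nonresonant* if this is so. Powers of $p$ are taken as $p^a=e^{a\log p}$ with any choice of $\log p$; functions of $p$ may depend on that choice, and $p\to0$ means $\mathrm{Re}\log p\to-\infty$. A family $h(z)=h(z;p)$ *has an expansion* if $h=\sum_s a_s(z)p^s$ with $a_s\in\mathbb C(z)$, only finitely many $a_s\ne0$ with $s\le N$ for each $N$, where outside the zero set of some nonzero polynomial the $a_s$ have no poles on $\mathbb C^*$ and $p^{-val(h)}h$ is the locally uniform sum of the series for small $p$ (on each compact set of such $z\in\mathbb C^*$, uniformly for $0<|p|\le\varepsilon$, for some $\varepsilon>0$ depending on the compact set). Here $val(h)=\min\{s:a_s\ne0\}$ and $lc(h)=a_{val(h)}$ (for $h=0$ put $val=0$, $lc=0$). **Proposition.** Let $0<|q|<1$, let $t_0,\dots,t_5\in\mathbb C$ satisfy $\prod_rt_r=q$ and be generic: $t_rt_s\notin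 q^{\mathbb Z}$ for all $0\le r,s\le5$. Let $-\tfrac12\le\zeta<0$, let $a\ne b$ be in $\{0,\dots,5\}$, and let $\alpha\in\mathbb R^6$ satisfy $\sum_r\alpha_r=1$, $\alpha_a=\alpha_b=\zeta$ and $-\zeta\le\alpha_r\le1+\zeta$ for $r\ne a,b$. Let $f=f(z;p)$, $g=g(z;p)$ be families such that, for all small $p$, $f\in A(t_4p^{\alpha_4};p,q)$ and $g\in A(t_5p^{\alpha_5};p,q)$ with pole orders $m_f,m_g$ independent of $p$, and such that $f(p^\zeta z;p)$ and $g(p^\zeta z;p)$ have expansions; write $val(f),lc(f)$ and $val(g),lc(g)$ for the valuations and leading coefficients of these. Then: 1. There are nonresonant $p$ (for the parameters $t_rp^{\alpha_r}$) arbitrarily close to $0$, and for all nonresonant $p$ close enough to $0$ a contour as in the definition of $\langle f,g\rangle_{t_rp^{\alpha_r}}$ exists. 2. With $\tilde t_r$ as above (formed from the $t_r$), there exists a chain $D$ of closed curves in $\mathbb C^*$ with winding number $1$ around the points $\tilde t_aq^k,\tilde t_bq^k$ and $0$ around the points $q^{-k}/\tilde t_r$ for all $k\ge0$ and all $r$ with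 $\alpha_r=-\zeta$, and, if $\zeta=-\tfrac12$, also for $r=a,b$. 3. For every $w\in\mathbb C^*$ with $\theta(t_aw,t_bw;q)\ne0$, and every choice of such contours, $$\lim_{p\to0}p^{-val(f)-val(g)}\langle f,g\rangle_{t_rp^{\alpha_r}}=\frac{(q;q)\,(t_at_b;q)^{1_{\zeta=-1/2}}\prod_{r:\alpha_r=-\zeta}(t_rt_a,t_rt_b;q)}{\prod_{0\le r<s\le5:\ \alpha_r+\alpha_s=1}(qt_r^{-1}t_s^{-1};q)}$$ $$\times\int_D lc(f)(z)\,lc(g)(z)\,\frac{\prod_{r:\alpha_r=1+\zeta}(qz/t_r;q)}{(t_a/z,t_b/z;q)\prod_{r:\alpha_r=-\zeta}(t_rz;q)}\left(\frac{1-z^2}{(t_az,t_bz;q)}\right)^{1_{\zeta=-1/2}}\frac{\theta(wz,\frac{qz}{t_at_bw};q)}{\theta(t_aw,t_bw;q)}\frac{dz}{2\pi iz},$$ where $p$ runs through the nonresonant values. In particular the right-hand side does not depend on $w$. -/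

import Mathlib

open Complex Filter Topology

noncomputable section

namespace EllipticLimit

/-! ### q-symbols, theta functions and the elliptic gamma function -/

/-- `(x;q) = ∏_{k ≥ 0} (1 - x q^k)`. -/
def qPoch (x q : ℂ) : ℂ := ∏' k : ℕ, (1 - x * q ^ k)

/-- `(x;p,q) = ∏_{i,j ≥ 0} (1 - x p^i q^j)`. -/
def pqPoch (x p q : ℂ) : ℂ := ∏' k : ℕ × ℕ, (1 - x * p ^ k.1 * q ^ k.2)

/-- `θ(x;p) = (x;p) (p/x;p)`. -/
def theta (x p : ℂ) : ℂ := qPoch x p * qPoch (p / x) p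

/-- `θ(x;q;p)_n = ∏_{k < n} θ(x q^k;p)`. -/
def thetaFin (x q p : ℂ) (n : ℕ) : ℂ := ∏ k ∈ Finset.range n, theta (x * q ^ k) p

/-- `Γ(x;p,q) = ∏_{i,j ≥ 0} (1 - p^{i+1} q^{j+1} / x) / (1 - p^i q^j x)`. -/
def ellGamma (x p q : ℂ) : ℂ := pqPoch (p * q / x) p q / pqPoch x p q

/-! ### Contours: chains of closed curves -/

/-- A finite integral combination of closed `C¹` curves in the plane, each one
parametrised by `[0,1]`. -/
structure Chain where
  n : ℕ
  mult : Fin n → ℤ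
  loop : Fin n → ℝ → ℂ
  smooth : ∀ i, ContDiff ℝ 1 (loop i)
  closed : ∀ i, loop i 0 = loop i 1

/-- The integral of `F(z) dz` over a chain. -/
def Chain.integral (C : Chain) (F : ℂ → ℂ) : ℂ :=
  ∑ i, (C.mult i : ℂ) * ∫ t in (0 : ℝ)..1, F (C.loop i t) * deriv (C.loop i) t

/-- The points that lie on one of the curves of a chain. -/
def Chain.support (C : Chain) : Set ℂ := ⋃ i, C.loop i '' Set.Icc 0 1

/-- The winding number of a chain around `x` (for `x` off the support). -/
def Chain.winding (C : Chain) (x : ℂ) : ℂ :=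
  (2 * Real.pi * I)⁻¹ * C.integral (fun z => (z - x)⁻¹)

/-- The chain lies in the punctured plane, contains the points of `inner` and excludes those
of `outer`. (The sets `inner` used below accumulate at `0`, so that the chain then winds once
around `0`.) -/
structure Chain.Separates (C : Chain) (inner outer : Set ℂ) : Prop where
  zero_notMem : (0 : ℂ) ∉ C.support
  disjoint_inner : Disjoint C.support inner
  disjoint_outer : Disjoint C.support outer
  winding_inner : ∀ x ∈ inner, C.winding x = 1
  winding_outer : ∀ x ∈ outer, C.winding x = 0

/-! ### The elliptic level -/

/-- `f ∈ A(u;p,q)`, with `m_f = m`: `f` is a meromorphic function on the punctured plane,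
`f(1/z) = f(z)`, `f(pz) = f(z)`, and `θ(pq z^{±1}/u;q;p)_m f(z)` is holomorphic there (after
removal of the singularities at zeros of the theta factor). -/
structure InA (u p q : ℂ) (m : ℕ) (f : ℂ → ℂ) : Prop where
  meromorphic : ∀ z, z ≠ 0 → MeromorphicAt f z
  symmetric : ∀ z, z ≠ 0 → f z⁻¹ = f z
  abelian : ∀ z, z ≠ 0 → f (p * z) = f z
  holomorphic : ∃ h : ℂ → ℂ, DifferentiableOn ℂ h {0}ᶜ ∧
    ∀ z, z ≠ 0 → thetaFin (p * q * z / u) q p m * thetaFin (p * q * z⁻¹ / u) q p m ≠ 0 →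
      h z = thetaFin (p * q * z / u) q p m * thetaFin (p * q * z⁻¹ / u) q p m * f z

/-- The parameters shifted by the pole orders: `t_4 q^{-m_f}` and `t_5 q^{-m_g}` replace `t_4`
and `t_5`. -/
def shifted (q : ℂ) (mf mg : ℕ) (t : Fin 6 → ℂ) (r : Fin 6) : ℂ :=
  if r = 4 then t 4 / q ^ mf else if r = 5 then t 5 / q ^ mg else t r

/-- The points `p^i q^j τ_r` with `i, j ≥ 0`. -/
def ellInner (τ : Fin 6 → ℂ) (p q : ℂ) : Set ℂ :=
  {z | ∃ (r : Fin 6) (i j : ℕ), z = p ^ i * q ^ j * τ r}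

/-- The reciprocals of the points `p^i q^j τ_r` with `i, j ≥ 0`. -/
def ellOuter (τ : Fin 6 → ℂ) (p q : ℂ) : Set ℂ :=
  {z | ∃ (r : Fin 6) (i j : ℕ), z = (p ^ i * q ^ j * τ r)⁻¹}

/-- The bilinear form `⟨f,g⟩_{t_0,…,t_5;q;p}`, computed with the contour `C`. -/
def ellForm (t : Fin 6 → ℂ) (p q : ℂ) (f g : ℂ → ℂ) (C : Chain) : ℂ :=
  qPoch q q * qPoch p p / (2 * ∏ r, ∏ s ∈ Finset.Ioi r, ellGamma (t r * t s) p q) *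
    C.integral (fun z =>
      f z * g z *
        ((∏ r, ellGamma (t r * z) p q * ellGamma (t r * z⁻¹) p q) /
          (ellGamma (z ^ 2) p q * ellGamma ((z ^ 2)⁻¹) p q)) / (2 * Real.pi * I * z))

/-! ### Power series in `p` with real exponents

The functions involved are multivalued in `p`; a value of `p` together with a branch of its
powers is given by `l = log p`, that is `p = exp l` and `p^a = exp (a l)`. -/

/-- `p^a` for `p = exp l`. -/
def nomePow (a : ℝ) (l : ℂ) : ℂ := exp (a * l)

/-- `p → 0`, with arbitrary argument and branch: `Re (log p) → -∞`. -/
def nomeToZero : Filter ℂ := comap re atBot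

/-- Formal series `∑_s a_s(z) p^s`, with rational coefficients and a set of exponents that is
discrete and bounded from below (finitely many exponents below any bound). -/
structure NomeSeries where
  coeff : ℝ → RatFunc ℂ
  finite_le : ∀ N : ℝ, {s | s ≤ N ∧ coeff s ≠ 0}.Finite

/-- The smallest exponent (and `0` for the zero series). -/
def NomeSeries.val (F : NomeSeries) : ℝ := sInf {s | F.coeff s ≠ 0}

/-- The leading coefficient, as a function of `z`. -/
def NomeSeries.lc (F : NomeSeries) (z : ℂ) : ℂ := (F.coeff F.val).eval (RingHom.id ℂ) z

/-- The sum of the terms with exponent at most `N`, at the point `z` and at `p = exp l`. -/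
def NomeSeries.partialSum (F : NomeSeries) (N : ℝ) (l z : ℂ) : ℂ :=
  ∑ s ∈ (F.finite_le N).toFinset, (F.coeff s).eval (RingHom.id ℂ) z * nomePow s l

/-- `f(l,z)` is the sum of the series `F`: for `z` outside the zero set of some nonzero
polynomial the coefficients have no poles, and on every compact set `K` of such (nonzero) `z`
the series `p^{-val} F` converges uniformly to `p^{-val} f`, for `z ∈ K` and `0 < |p| ≤ ε`. -/
def NomeSeries.ConvergesTo (F : NomeSeries) (f : ℂ → ℂ → ℂ) : Prop :=
  ∃ P : Polynomial ℂ, P ≠ 0 ∧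
    (∀ s z, z ≠ 0 → P.eval z ≠ 0 → (F.coeff s).denom.eval z ≠ 0) ∧
    ∀ K : Set ℂ, IsCompact K → (∀ z ∈ K, z ≠ 0 ∧ P.eval z ≠ 0) →
      ∃ M : ℝ, TendstoUniformlyOn
        (fun (N : ℝ) (x : ℂ × ℂ) => nomePow (-F.val) x.1 * F.partialSum N x.1 x.2)
        (fun x : ℂ × ℂ => nomePow (-F.val) x.1 * f x.1 x.2)
        atTop ({l : ℂ | l.re ≤ M} ×ˢ K)

/-! ### The limiting bilinear form -/

/-- Points to be contained in the contour of the limiting form: the zeros `τ_a q^k`, `τ_b q^k`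
of `(τ_a/z, τ_b/z;q)`. -/
def limInner (q : ℂ) (τ : Fin 6 → ℂ) (a b : Fin 6) : Set ℂ :=
  {z | ∃ k : ℕ, z = τ a * q ^ k ∨ z = τ b * q ^ k}

/-- Points to be excluded: the zeros `q^{-k}/τ_r` of `(τ_r z;q)`, for every `r` for which
`(t_r z;q)` occurs in the denominator of the limiting weight. -/
def limOuter (q : ℂ) (τ : Fin 6 → ℂ) (α : Fin 6 → ℝ) (ζ : ℝ) (a b : Fin 6) : Set ℂ :=
  {z | ∃ (r : Fin 6) (k : ℕ), (α r = -ζ ∨ (ζ = -1 / 2 ∧ (r = a ∨ r = b))) ∧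
    z = (τ r * q ^ k)⁻¹}

/-- The constant in front of the limiting integral. -/
def limPrefactor (q : ℂ) (t : Fin 6 → ℂ) (α : Fin 6 → ℝ) (ζ : ℝ) (a b : Fin 6) : ℂ :=
  qPoch q q * (if ζ = -1 / 2 then qPoch (t a * t b) q else 1) *
    (∏ r with α r = -ζ, qPoch (t r * t a) q * qPoch (t r * t b) q) /
    ∏ r, ∏ s ∈ Finset.Ioi r with α r + α s = 1, qPoch (q * (t r)⁻¹ * (t s)⁻¹) q

/-- The weight of the limiting integral, with the auxiliary parameter `w`. -/
def limWeight (q : ℂ) (t : Fin 6 → ℂ) (α : Fin 6 → ℝ) (ζ : ℝ) (a b : Fin 6) (w z : ℂ) : ℂ :=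
  (∏ r with α r = 1 + ζ, qPoch (q * z / t r) q) /
      (qPoch (t a / z) q * qPoch (t b / z) q * ∏ r with α r = -ζ, qPoch (t r * z) q) *
    (if ζ = -1 / 2 then (1 - z ^ 2) / (qPoch (t a * z) q * qPoch (t b * z) q) else 1) *
    (theta (w * z) q * theta (q * z / (t a * t b * w)) q /
      (theta (t a * w) q * theta (t b * w) q))

/-- The limiting bilinear form, computed with the contour `C`. -/
def limForm (q : ℂ) (t : Fin 6 → ℂ) (α : Fin 6 → ℝ) (ζ : ℝ) (a b : Fin 6) (w : ℂ)
    (f g : ℂ → ℂ) (C : Chain) : ℂ :=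
  limPrefactor q t α ζ a b *
    C.integral (fun z => f z * g z * limWeight q t α ζ a b w z / (2 * Real.pi * I * z))

/-- The parameters `t_r p^{α_r}` for `p = exp l`. -/
def scaled (t : Fin 6 → ℂ) (α : Fin 6 → ℝ) (l : ℂ) (r : Fin 6) : ℂ := t r * nomePow (α r) l

/-- The points that the contour of `⟨f,g⟩_{t_r p^{α_r}}` has to contain. -/
def scaledInner (q : ℂ) (mf mg : ℕ) (t : Fin 6 → ℂ) (α : Fin 6 → ℝ) (l : ℂ) : Set ℂ :=
  ellInner (shifted q mf mg (scaled t α l)) (exp l) q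

/-- The points that the contour of `⟨f,g⟩_{t_r p^{α_r}}` has to exclude. -/
def scaledOuter (q : ℂ) (mf mg : ℕ) (t : Fin 6 → ℂ) (α : Fin 6 → ℝ) (l : ℂ) : Set ℂ :=
  ellOuter (shifted q mf mg (scaled t α l)) (exp l) q

/-- The values of `l = log p` for which `⟨f,g⟩_{t_r p^{α_r}}` is given by a contour integral:
no point has to be both contained in and excluded by the contour. -/
def nonresonant (q : ℂ) (mf mg : ℕ) (t : Fin 6 → ℂ) (α : Fin 6 → ℝ) : Set ℂ :=
  {l | Disjoint (scaledInner q mf mg t α l) (scaledOuter q mf mg t α l)}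

end EllipticLimit

end

noncomputable section

namespace EllipticLimit

open MeasureTheory Set

section

/-! ### Integration along chains -/

namespace Chain

/-! Write T_r = t_r p^{α_r}. The gamma factor Γ(y p^s;p,q) has an evident limit as p → 0 when 0 ≤ s
≤ 1 (`tendsto_ellGamma`), but after z ↦ p^ζ z the factors Γ(T_a z) and Γ(T_b z) carry the negative
exponent 2ζ. The cure is to break the symmetry z ↦ 1/z of the integrand. By reflection, 1/Γ(z^{±2})
= θ(z²;q) θ(z⁻²;p). The three-term relation (`theta_three_term`) with A = T_a, B = T_b, W = w p^{-ζ}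
writes θ(z²;q), up to the constant θ(T_aT_b, T_aW, T_bW;q), as N(z) − z² N(1/z), where N contains
θ(T_a z, T_b z;q). Since θ(Tz;q) Γ(Tz) = Γ(pTz), the factor N(z) raises the two bad exponents by 1.
Inversion exchanges the two terms and maps the contour to one with the same winding numbers, so the
integral is twice that of one broken term (`integral_eq_broken`).

In the broken weight, rescaled by p^ζ, all exponents lie in [0,1], and it converges to the limiting
weight (`tendsto_brokenWeight`). Its rescaled singularities either are singularities of the limiting
integrand, or tend to 0 or to infinity. Hence a fixed contour D, dilated by p^ζ, may replace the
elliptic contour for small p (`eventually_dilate_winding_eq`); this rests on the homology form of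
Cauchy's theorem (`Chain.integral_eq_zero_of_winding`). The constant converges because θ(T_aT_b;q)
likewise turns Γ(T_aT_b) into Γ(pT_aT_b) (`tendsto_prefactor`).

For the passage to the limit under the integral, f and g are controlled only off the zeros of a
polynomial, which may lie on D. The integrand is however holomorphic near D, so the maximum
principle on circles avoiding these zeros bounds it, and dominated convergence applies
(`Chain.tendsto_integral`). As f, g and quotients may take arbitrary values at removable
singularities, a holomorphic representative of the integrand is used (`exists_regular`), which
agrees with it off a countable set; such sets do not affect chain integrals. Independence of w
follows because the elliptic side does not contain w. -/

theorem mem_support (C : Chain) (i : Fin C.n) {s : ℝ} (hs : s ∈ Icc (0 : ℝ) 1) :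
    C.loop i s ∈ C.support :=
  mem_iUnion.2 ⟨i, mem_image_of_mem _ hs⟩

theorem isCompact_support (C : Chain) : IsCompact C.support :=
  isCompact_iUnion fun i => isCompact_Icc.image (C.smooth i).continuous

theorem continuous_deriv_loop (C : Chain) (i : Fin C.n) : Continuous (deriv (C.loop i)) :=
  (C.smooth i).continuous_deriv le_rfl

theorem hasDerivAt_loop (C : Chain) (i : Fin C.n) (s : ℝ) :
    HasDerivAt (C.loop i) (deriv (C.loop i) s) s :=
  ((C.smooth i).differentiable one_ne_zero s).hasDerivAt

theorem continuousOn_comp_loop {C : Chain} {F : ℂ → ℂ} (hF : ContinuousOn F C.support)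
    (i : Fin C.n) : ContinuousOn (fun s => F (C.loop i s)) (Icc 0 1) :=
  hF.comp (C.smooth i).continuous.continuousOn fun _ hs => C.mem_support i hs

theorem continuousOn_integrand {C : Chain} {F : ℂ → ℂ} (hF : ContinuousOn F C.support)
    (i : Fin C.n) :
    ContinuousOn (fun s => F (C.loop i s) * deriv (C.loop i) s) (Icc 0 1) :=
  (continuousOn_comp_loop hF i).mul (C.continuous_deriv_loop i).continuousOn

theorem intervalIntegrable {C : Chain} {F : ℂ → ℂ} (hF : ContinuousOn F C.support)
    (i : Fin C.n) :
    IntervalIntegrable (fun s => F (C.loop i s) * deriv (C.loop i) s) volume 0 1 :=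
  ContinuousOn.intervalIntegrable (by
    rw [uIcc_of_le zero_le_one]; exact continuousOn_integrand hF i)

/-- A point of a fibre where the derivative is nonzero is isolated in the set of such points, and a
discrete subset of the line is countable. Parameters with zero derivative contribute nothing to an
integral, so countable exceptional sets can be ignored even if a curve rests at one of their points.
-/
theorem countable_setOf_mem_of_deriv_ne_zero {γ : ℝ → ℂ} (hγ : Differentiable ℝ γ)
    {E : Set ℂ} (hE : E.Countable) : {s | γ s ∈ E ∧ deriv γ s ≠ 0}.Countable := by
  have : {s | γ s ∈ E ∧ deriv γ s ≠ 0} ⊆ ⋃ c ∈ E, {s | γ s = c ∧ deriv γ s ≠ 0} := by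
    intro s hs
    exact mem_biUnion hs.1 ⟨rfl, hs.2⟩
  refine (hE.biUnion fun c _ => ?_).mono this
  have : DiscreteTopology {s | γ s = c ∧ deriv γ s ≠ 0} := by
    rw [discreteTopology_subtype_iff]
    rintro s ⟨_, hs⟩
    rw [inf_principal_eq_bot]
    filter_upwards [(hγ s).hasDerivAt.eventually_ne (c := c) hs] with x hx h
    exact hx h.1
  exact (countable_coe_iff).1 (countable_of_Lindelof_of_discrete (X := {s | γ s = c ∧ deriv γ s ≠ 0}))

theorem integral_congr_of_countable {C : Chain} {F G : ℂ → ℂ} {E : Set ℂ} (hE : E.Countable)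
    (h : ∀ z ∈ C.support, z ∉ E → F z = G z) : C.integral F = C.integral G := by
  refine Finset.sum_congr rfl fun i _ => ?_
  congr 1
  refine intervalIntegral.integral_congr_ae ?_
  have := (countable_setOf_mem_of_deriv_ne_zero
    ((C.smooth i).differentiable one_ne_zero) hE).ae_notMem volume
  filter_upwards [this] with s hs hs'
  rw [uIoc_of_le zero_le_one] at hs'
  by_cases h0 : deriv (C.loop i) s = 0
  · simp [h0]
  · rw [h _ (C.mem_support i (Ioc_subset_Icc_self hs')) fun hE' => hs ⟨hE', h0⟩]

theorem integral_congr {C : Chain} {F G : ℂ → ℂ}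
    (h : ∀ z ∈ C.support, F z = G z) : C.integral F = C.integral G :=
  integral_congr_of_countable countable_empty fun z hz _ => h z hz

theorem integral_add {C : Chain} {F G : ℂ → ℂ} (hF : ContinuousOn F C.support)
    (hG : ContinuousOn G C.support) :
    C.integral (fun z => F z + G z) = C.integral F + C.integral G := by
  simp only [integral, ← Finset.sum_add_distrib, ← mul_add]
  refine Finset.sum_congr rfl fun i _ => ?_
  rw [← intervalIntegral.integral_add (intervalIntegrable hF i) (intervalIntegrable hG i)]
  simp only [add_mul]

theorem integral_const_mul (C : Chain) (c : ℂ) (F : ℂ → ℂ) :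
    C.integral (fun z => c * F z) = c * C.integral F := by
  simp only [integral, Finset.mul_sum]
  refine Finset.sum_congr rfl fun i _ => ?_
  simp only [mul_assoc, intervalIntegral.integral_const_mul]
  ring

theorem integral_sub {C : Chain} {F G : ℂ → ℂ} (hF : ContinuousOn F C.support)
    (hG : ContinuousOn G C.support) :
    C.integral (fun z => F z - G z) = C.integral F - C.integral G := by
  have h := integral_add hF (G := fun z => -1 * G z) (continuousOn_const.mul hG)
  rw [integral_const_mul] at h
  simpa [sub_eq_add_neg] using h

theorem integral_eq_zero_of_hasDerivAt {C : Chain} {P F : ℂ → ℂ} (hF : ContinuousOn F C.support)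
    (hP : ∀ z ∈ C.support, HasDerivAt P (F z) z) : C.integral F = 0 := by
  refine Finset.sum_eq_zero fun i _ => ?_
  rw [intervalIntegral.integral_eq_sub_of_hasDerivAt (f := fun s => P (C.loop i s))
    (fun s hs => ?_) (intervalIntegrable hF i), ← C.closed i]
  · simp
  · rw [uIcc_of_le zero_le_one] at hs
    exact (hP _ (C.mem_support i hs)).comp_of_eq s (C.hasDerivAt_loop i s) rfl

theorem norm_integral_le (C : Chain) : ∃ B : ℝ, 0 ≤ B ∧ ∀ (F : ℂ → ℂ) (M : ℝ), 0 ≤ M →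
    (∀ z ∈ C.support, ‖F z‖ ≤ M) → ‖C.integral F‖ ≤ B * M := by
  have h : ∀ i, ∃ b : ℝ, ∀ s ∈ Icc (0 : ℝ) 1, ‖deriv (C.loop i) s‖ ≤ b := fun i =>
    isCompact_Icc.exists_bound_of_continuousOn (C.continuous_deriv_loop i).continuousOn
  choose b hb using h
  have hb0 : ∀ i, 0 ≤ b i := fun i => (norm_nonneg _).trans (hb i 0 (by simp))
  refine ⟨∑ i, ‖(C.mult i : ℂ)‖ * b i, Finset.sum_nonneg fun i _ =>
    mul_nonneg (norm_nonneg _) (hb0 i), fun F M hM hF => ?_⟩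
  rw [Finset.sum_mul]
  refine (norm_sum_le _ _).trans (Finset.sum_le_sum fun i _ => ?_)
  rw [norm_mul, mul_assoc]
  refine mul_le_mul_of_nonneg_left ?_ (norm_nonneg _)
  have := intervalIntegral.norm_integral_le_of_norm_le_const (a := 0) (b := 1)
    (f := fun s => F (C.loop i s) * deriv (C.loop i) s) (C := b i * M) (fun s hs => ?_)
  · simpa using this
  · rw [uIoc_of_le zero_le_one] at hs
    have hs := Ioc_subset_Icc_self hs
    rw [norm_mul, mul_comm]
    exact mul_le_mul (hb i s hs) (hF _ (C.mem_support i hs)) (norm_nonneg _) (hb0 i)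

theorem isOpen_compl_support (C : Chain) : IsOpen C.supportᶜ :=
  C.isCompact_support.isClosed.isOpen_compl

theorem continuousOn_inv_sub {C : Chain} {x : ℂ} (hx : x ∉ C.support) :
    ContinuousOn (fun z => (z - x)⁻¹) C.support :=
  (continuousOn_id.sub continuousOn_const).inv₀ fun z hz h => hx (by
    rwa [← show z = x from sub_eq_zero.1 h])

/-- The difference of the two kernels has the primitive log((z − x)/(z − y)), which is single-valued
off the segment: the quotient is a nonpositive real only on it. -/
theorem winding_eq_of_segment {C : Chain} {x y : ℂ} (h : Disjoint (segment ℝ x y) C.support) :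
    C.winding x = C.winding y := by
  have hx : x ∉ C.support := disjoint_left.1 h (left_mem_segment ℝ x y)
  have hy : y ∉ C.support := disjoint_left.1 h (right_mem_segment ℝ x y)
  unfold winding
  congr 1
  rw [← sub_eq_zero, ← integral_sub (continuousOn_inv_sub hx) (continuousOn_inv_sub hy)]
  refine integral_eq_zero_of_hasDerivAt (P := fun z => log ((z - x) / (z - y)))
    ((continuousOn_inv_sub hx).sub (continuousOn_inv_sub hy)) fun z hz => ?_
  have hzx : z - x ≠ 0 := fun h => hx (sub_eq_zero.1 h ▸ hz)
  have hzy : z - y ≠ 0 := fun h => hy (sub_eq_zero.1 h ▸ hz)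
  have hs : (z - x) / (z - y) ∈ slitPlane := by
    by_contra hns
    rw [mem_slitPlane_iff_not_le_zero, not_not, Complex.le_def] at hns
    simp only [zero_re, zero_im] at hns
    set a : ℝ := -((z - x) / (z - y)).re with ha
    have ha0 : 0 ≤ a := by linarith [hns.1]
    have hae : (z - x) / (z - y) = -(a : ℂ) := by
      apply Complex.ext <;> simp [ha, hns.2]
    rw [div_eq_iff hzy] at hae
    refine disjoint_left.1 h ?_ hz
    -- Solving z − x = −a (z − y) gives z = (x + a y)/(1 + a).
    refine ⟨1 / (1 + a), a / (1 + a), by positivity, by positivity, by field_simp, ?_⟩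
    have h1 : (1 + a : ℂ) ≠ 0 := by
      have : (1 + a : ℝ) ≠ 0 := by positivity
      exact_mod_cast this
    simp only [real_smul, ofReal_div, ofReal_one, ofReal_add]
    field_simp
    linear_combination -hae
  have h1 : HasDerivAt (fun z => (z - x) / (z - y)) ((1 * (z - y) - (z - x) * 1) / (z - y) ^ 2) z :=
    ((hasDerivAt_id z).sub_const x).div ((hasDerivAt_id z).sub_const y) hzy
  convert h1.clog hs using 1
  field_simp

theorem exists_ball_winding_eq {C : Chain} {x : ℂ} (hx : x ∉ C.support) :
    ∃ δ > 0, ∀ y ∈ Metric.ball x δ, y ∉ C.support ∧ C.winding y = C.winding x := by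
  obtain ⟨δ, hδ, h⟩ := Metric.isOpen_iff.1 C.isOpen_compl_support x hx
  refine ⟨δ, hδ, fun y hy => ⟨h hy, winding_eq_of_segment ?_⟩⟩
  exact (disjoint_left.2 fun z hz hz' => h ((convex_ball x δ).segment_subset hy
    (Metric.mem_ball_self hδ) hz) hz')

/-- For x farther out than all curves, log(1 − z/x) is a primitive of 1/(z − x) along the support.
-/
theorem exists_winding_eq_zero (C : Chain) :
    ∃ R > 0, (∀ z ∈ C.support, ‖z‖ < R) ∧ ∀ x, R ≤ ‖x‖ → C.winding x = 0 := by
  obtain ⟨R, hR⟩ := C.isCompact_support.isBounded.exists_norm_le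
  refine ⟨max R 0 + 1, by positivity, fun z hz => ?_, fun x hx => ?_⟩
  · linarith [hR z hz, le_max_left R 0]
  have hlt : ∀ z ∈ C.support, ‖z‖ < ‖x‖ := fun z hz => by
    linarith [hR z hz, le_max_left R 0]
  have hx0 : x ≠ 0 := by
    rintro rfl
    simp only [norm_zero] at hx
    linarith [le_max_right R 0]
  have hxs : x ∉ C.support := fun h => lt_irrefl _ (hlt x h)
  unfold winding
  rw [integral_eq_zero_of_hasDerivAt (P := fun z => log (1 - z / x)) (continuousOn_inv_sub hxs),
    mul_zero]
  intro z hz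
  have hs : 1 - z / x ∈ slitPlane := by
    refine Or.inl ?_
    have h1 : ‖z / x‖ < 1 := by
      rw [norm_div, div_lt_one (norm_pos_iff.2 hx0)]; exact hlt z hz
    have := (Complex.re_le_norm (z / x))
    simp only [sub_re, one_re]
    linarith
  have h1 : HasDerivAt (fun z => 1 - z / x) (-(1 / x)) z :=
    ((hasDerivAt_id z).div_const x).const_sub 1
  have hzx : z - x ≠ 0 := sub_ne_zero.2 fun h => hxs (h ▸ hz)
  convert h1.clog hs using 1
  have : x - z ≠ 0 := sub_ne_zero.2 fun h => hxs (h ▸ hz)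
  have h2 : 1 - z / x = (x - z) / x := by field_simp
  rw [h2]
  field_simp
  ring

/-! ### Operations on chains -/

/-- The formal difference of two chains. -/
def sub (C D : Chain) : Chain where
  n := C.n + D.n
  mult := Fin.append C.mult fun j => -D.mult j
  loop := Fin.append C.loop D.loop
  smooth := Fin.addCases (fun i => by simpa using C.smooth i) fun i => by simpa using D.smooth i
  closed := Fin.addCases (fun i => by simpa using C.closed i) fun i => by simpa using D.closed i

theorem integral_chain_sub (C D : Chain) (F : ℂ → ℂ) :
    (C.sub D).integral F = C.integral F - D.integral F := by
  have := Fin.sum_univ_add (fun i : Fin (C.n + D.n) =>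
    ((Fin.append C.mult (fun j => -D.mult j) i : ℤ) : ℂ) *
      ∫ s in (0 : ℝ)..1, F (Fin.append C.loop D.loop i s) * deriv (Fin.append C.loop D.loop i) s)
  refine this.trans ?_
  simp [integral, sub_eq_add_neg]

theorem support_sub_subset (C D : Chain) : (C.sub D).support ⊆ C.support ∪ D.support := by
  refine iUnion_subset ?_
  refine Fin.addCases (fun i => ?_) fun i => ?_
  · simp only [sub, Fin.append_left]
    exact (subset_iUnion (fun i => C.loop i '' Icc 0 1) i).trans subset_union_left
  · simp only [sub, Fin.append_right]
    exact (subset_iUnion (fun i => D.loop i '' Icc 0 1) i).trans subset_union_right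

/-- The dilation of a chain by a factor `c`. -/
def dilate (c : ℂ) (C : Chain) : Chain where
  n := C.n
  mult := C.mult
  loop i s := c * C.loop i s
  smooth i := contDiff_const.mul (C.smooth i)
  closed i := by rw [C.closed i]

theorem integral_dilate (c : ℂ) (C : Chain) (F : ℂ → ℂ) :
    (C.dilate c).integral F = C.integral fun z => c * F (c * z) := by
  refine Finset.sum_congr rfl fun i _ => ?_
  congr 1
  refine intervalIntegral.integral_congr fun s _ => ?_
  simp only [dilate]
  rw [((C.hasDerivAt_loop i s).const_mul c).deriv]
  ring

theorem support_dilate (c : ℂ) (C : Chain) : (C.dilate c).support = (fun z => c * z) '' C.support := by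
  simp only [support, image_iUnion, image_image]
  rfl

theorem winding_dilate {c : ℂ} (hc : c ≠ 0) (C : Chain) (x : ℂ) :
    (C.dilate c).winding (c * x) = C.winding x := by
  simp only [winding, integral_dilate]
  congr 2
  funext z
  rw [← mul_sub, mul_inv, mul_inv_cancel_left₀ hc]

/-- The image of a chain under `z ↦ 1/z`, with the opposite orientation. -/
def inversion (C : Chain) (h : ∀ i s, C.loop i s ≠ 0) : Chain where
  n := C.n
  mult i := -C.mult i
  loop i s := (C.loop i s)⁻¹
  smooth i := (C.smooth i).inv (h i)
  closed i := by rw [C.closed i]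

theorem integral_inversion (C : Chain) (h : ∀ i s, C.loop i s ≠ 0) (F : ℂ → ℂ) :
    (C.inversion h).integral F = C.integral fun z => F z⁻¹ / z ^ 2 := by
  refine Finset.sum_congr rfl fun i _ => ?_
  simp only [inversion, Int.cast_neg, neg_mul, ← mul_neg]
  rw [← intervalIntegral.integral_neg]
  congr 1
  refine intervalIntegral.integral_congr fun s _ => ?_
  have := ((C.hasDerivAt_loop i s).inv (h i s)).deriv
  simp only [Pi.inv_def] at this
  simp only [this]
  ring

theorem support_inversion (C : Chain) (h : ∀ i s, C.loop i s ≠ 0) :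
    (C.inversion h).support = (fun z => z⁻¹) '' C.support := by
  simp only [support, image_iUnion, image_image]
  rfl

/-- Partial fractions: the kernel with pole x is pulled back to 1/z − 1/(z − 1/x), the sign of
d(1/z) being absorbed by the reversed orientation. -/
theorem winding_inversion (C : Chain) (h : ∀ i s, C.loop i s ≠ 0) (h0 : (0 : ℂ) ∉ C.support)
    {x : ℂ} (hx : x ≠ 0) (hxs : x⁻¹ ∉ C.support) :
    (C.inversion h).winding x = C.winding 0 - C.winding x⁻¹ := by
  simp only [winding, integral_inversion]
  rw [← mul_sub, ← integral_sub (continuousOn_inv_sub h0) (continuousOn_inv_sub hxs)]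
  congr 1
  refine integral_congr fun z hz => ?_
  have hz0 : z ≠ 0 := fun h => h0 (h ▸ hz)
  have hzx : z - x⁻¹ ≠ 0 := sub_ne_zero.2 fun h => hxs (h ▸ hz)
  have h1 : z⁻¹ - x ≠ 0 := by
    intro h'
    apply hzx
    rw [← sub_eq_zero.1 h', inv_inv, sub_self]
  have h2 : z * x - 1 ≠ 0 := by
    intro h'
    apply hzx
    field_simp
    linear_combination h'
  have h3 : 1 - z * x ≠ 0 := by
    intro h'
    exact h2 (by linear_combination -h')
  have e1 : z⁻¹ - x = (1 - z * x) / z := by field_simp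
  have e2 : z - x⁻¹ = (z * x - 1) / x := by field_simp
  rw [e1, e2, sub_zero]
  field_simp
  ring

end Chain

end

section

/-! ### The homology form of Cauchy's theorem -/

namespace Chain

/-- Differentiation under the integral sign. Cauchy's estimate dominates the z-derivative, so a
bound on K itself suffices and no joint regularity is required. -/
theorem differentiableAt_integral {C : Chain} {K : ℂ → ℂ → ℂ} {z₀ : ℂ} {r B : ℝ} (hr : 0 < r)
    (hc : ∀ z ∈ Metric.ball z₀ r, ContinuousOn (K z) C.support)
    (hd : ∀ w ∈ C.support, DifferentiableOn ℂ (fun z => K z w) (Metric.ball z₀ r))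
    (hB : ∀ z ∈ Metric.ball z₀ r, ∀ w ∈ C.support, ‖K z w‖ ≤ B) :
    DifferentiableAt ℂ (fun z => C.integral (K z)) z₀ := by
  have hr2 : 0 < r / 2 := half_pos hr
  have hsub : Metric.ball z₀ (r / 2) ⊆ Metric.ball z₀ r := Metric.ball_subset_ball (by linarith)
  have hz₀ : z₀ ∈ Metric.ball z₀ r := Metric.mem_ball_self hr
  unfold integral
  refine DifferentiableAt.fun_sum fun i _ => DifferentiableAt.const_mul ?_ _
  have hdiff : ∀ s ∈ Icc (0 : ℝ) 1, ∀ z ∈ Metric.ball z₀ r,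
      DifferentiableAt ℂ (fun z => K z (C.loop i s)) z := fun s hs z hz =>
    (hd _ (C.mem_support i hs)).differentiableAt (Metric.isOpen_ball.mem_nhds hz)
  obtain ⟨b, hb⟩ := isCompact_Icc.exists_bound_of_continuousOn (s := Icc (0 : ℝ) 1)
    (C.continuous_deriv_loop i).continuousOn
  have hmeas : ∀ z ∈ Metric.ball z₀ r, AEStronglyMeasurable
      (fun s => K z (C.loop i s) * deriv (C.loop i) s) (volume.restrict (uIoc 0 1)) :=
    fun z hz => by
      rw [uIoc_of_le zero_le_one]; exact (intervalIntegrable (hc z hz) i).1.aestronglyMeasurable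
  refine (intervalIntegral.hasDerivAt_integral_of_dominated_loc_of_deriv_le
    (F := fun z s => K z (C.loop i s) * deriv (C.loop i) s)
    (F' := fun z s => deriv (fun z => K z (C.loop i s)) z * deriv (C.loop i) s)
    (bound := fun _ => B / (r / 2) * b)
    (Metric.ball_mem_nhds z₀ hr2) ?_ (intervalIntegrable (hc _ hz₀) i) ?_ ?_
    intervalIntegrable_const ?_).2.differentiableAt
  · filter_upwards [Metric.ball_mem_nhds z₀ hr] with z hz using hmeas z hz
  -- The derivative at z₀ is measurable in s as a pointwise limit of difference quotients along this
  -- sequence.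
  · have hseq : Tendsto (fun n : ℕ => (z₀ + ((r / 2 / (n + 1) : ℝ) : ℂ))) atTop (𝓝[≠] z₀) := by
      refine tendsto_nhdsWithin_iff.2 ⟨?_, Eventually.of_forall fun n => ?_⟩
      · have h1 : Tendsto (fun n : ℕ => r / 2 / ((n : ℝ) + 1)) atTop (𝓝 0) := by
          have := (tendsto_one_div_add_atTop_nhds_zero_nat (𝕜 := ℝ)).const_mul (r / 2)
          simpa [div_eq_mul_inv] using this
        have h2 := (continuous_ofReal.tendsto 0).comp h1
        simpa using tendsto_const_nhds (x := z₀).add h2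
      · have : (r / 2 / (n + 1) : ℝ) ≠ 0 := by positivity
        simp only [mem_compl_iff, mem_singleton_iff, add_eq_left]
        exact_mod_cast this
    refine aestronglyMeasurable_of_tendsto_ae atTop (f := fun (n : ℕ) s =>
      slope (fun z => K z (C.loop i s) * deriv (C.loop i) s) z₀ (z₀ + ((r / 2 / (n + 1) : ℝ) : ℂ)))
      (fun n => ?_) ?_
    · have hmem : z₀ + ((r / 2 / (n + 1) : ℝ) : ℂ) ∈ Metric.ball z₀ r := by
        rw [Metric.mem_ball, dist_eq_norm, add_sub_cancel_left, norm_real, Real.norm_eq_abs,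
          abs_of_nonneg (by positivity)]
        have : r / 2 / (n + 1) ≤ r / 2 := div_le_self hr2.le (by linarith [n.cast_nonneg (α := ℝ)])
        linarith
      simp only [slope, vsub_eq_sub, smul_eq_mul]
      exact ((hmeas _ hmem).sub (hmeas _ hz₀)).const_mul _
    · refine (ae_restrict_mem measurableSet_uIoc).mono fun s hs => ?_
      rw [uIoc_of_le zero_le_one] at hs
      have := ((hdiff s (Ioc_subset_Icc_self hs) z₀ hz₀).hasDerivAt.mul_const (deriv (C.loop i) s))
      exact (hasDerivAt_iff_tendsto_slope.1 this).comp hseq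
  · refine Eventually.of_forall fun s hs z hz => ?_
    rw [uIoc_of_le zero_le_one] at hs
    have hs := Ioc_subset_Icc_self hs
    rw [norm_mul]
    have hcb : Metric.closedBall z (r / 2 / 2) ⊆ Metric.ball z₀ r := fun y hy => by
      rw [Metric.mem_ball] at hz ⊢
      rw [Metric.mem_closedBall] at hy
      linarith [dist_triangle y z z₀]
    have hB0 : 0 ≤ B := (norm_nonneg _).trans (hB z₀ hz₀ _ (C.mem_support i hs))
    refine mul_le_mul ?_ (hb s hs) (norm_nonneg _) (by positivity)
    have hball : ∀ y ∈ Metric.ball z (r / 2), y ∈ Metric.ball z₀ r := fun y hy => by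
      rw [Metric.mem_ball] at *
      linarith [dist_triangle y z z₀]
    by_contra! hlt
    have key : ∀ ρ, 0 < ρ → ρ < r / 2 → ‖deriv (fun z => K z (C.loop i s)) z‖ ≤ B / ρ := by
      intro ρ h0 h1
      refine norm_deriv_le_of_forall_mem_sphere_norm_le h0 ?_ fun y hy => ?_
      · refine DifferentiableOn.diffContOnCl ?_
        rw [closure_ball _ h0.ne']
        exact (hd _ (C.mem_support i hs)).mono fun y hy => hball y
          (Metric.closedBall_subset_ball h1 hy)
      · exact hB y (hball y (Metric.closedBall_subset_ball h1 (Metric.sphere_subset_closedBall hy)))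
          _ (C.mem_support i hs)
    have ht : Tendsto (fun ρ => B / ρ) (𝓝[<] (r / 2)) (𝓝 (B / (r / 2))) :=
      (tendsto_const_nhds.div tendsto_id hr2.ne').mono_left nhdsWithin_le_nhds
    refine absurd (ge_of_tendsto ht ?_) (not_le.2 hlt)
    filter_upwards [Ioo_mem_nhdsLT hr2] with ρ hρ using key ρ hρ.1 hρ.2
  · refine Eventually.of_forall fun s hs z hz => ?_
    rw [uIoc_of_le zero_le_one] at hs
    exact (hdiff s (Ioc_subset_Icc_self hs) z (hsub hz)).hasDerivAt.mul_const _

theorem differentiableAt_integral_div_sub {C : Chain} {F : ℂ → ℂ} (hF : ContinuousOn F C.support)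
    {z₀ : ℂ} (hz₀ : z₀ ∉ C.support) :
    DifferentiableAt ℂ (fun z => C.integral fun w => F w * (w - z)⁻¹) z₀ := by
  obtain ⟨δ, hδ, h⟩ := Metric.isOpen_iff.1 C.isOpen_compl_support z₀ hz₀
  obtain ⟨M, hM⟩ := C.isCompact_support.exists_bound_of_continuousOn hF
  have hsub : Metric.ball z₀ (δ / 2) ⊆ Metric.ball z₀ δ := Metric.ball_subset_ball (by linarith)
  refine differentiableAt_integral (r := δ / 2) (B := M * (δ / 2)⁻¹) (half_pos hδ)
    (fun z hz => hF.mul (continuousOn_inv_sub (h (hsub hz)))) (fun w hw => ?_) fun z hz w hw => ?_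
  · refine DifferentiableOn.const_mul (DifferentiableOn.inv ?_ fun z hz h0 => ?_) _
    · exact (differentiable_const w).differentiableOn.sub differentiableOn_id
    · exact h (hsub hz) (by rwa [← show w = z from sub_eq_zero.1 h0])
  · rw [norm_mul, norm_inv]
    have hd : δ / 2 ≤ ‖w - z‖ := by
      have h1 : δ ≤ dist w z₀ := by
        by_contra! hlt
        exact h hlt hw
      rw [Metric.mem_ball] at hz
      rw [← dist_eq_norm]
      linarith [dist_triangle w z z₀]
    exact mul_le_mul (hM w hw) (inv_anti₀ (half_pos hδ) hd) (by positivity)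
      ((norm_nonneg _).trans (hM w hw))

/-- Near the diagonal the mean value inequality bounds the difference quotient by the supremum of
F'; away from it the denominator is at least ε/2. -/
theorem exists_bound_dslope {U : Set ℂ} (hU : IsOpen U) {F : ℂ → ℂ} (hF : DifferentiableOn ℂ F U)
    {K : Set ℂ} (hK : IsCompact K) (hKU : K ⊆ U) {z₀ : ℂ} (hz₀ : z₀ ∈ U) :
    ∃ r > 0, Metric.ball z₀ r ⊆ U ∧ ∃ B, ∀ z ∈ Metric.ball z₀ r, ∀ w ∈ K, ‖dslope F z w‖ ≤ B := by
  obtain ⟨ε, hε, hεU⟩ := Metric.nhds_basis_closedBall.mem_iff.1 (hU.mem_nhds hz₀)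
  obtain ⟨M, hM⟩ := hK.exists_bound_of_continuousOn (hF.continuousOn.mono hKU)
  have hcb := isCompact_closedBall z₀ ε
  obtain ⟨M', hM'⟩ := hcb.exists_bound_of_continuousOn (hF.continuousOn.mono hεU)
  obtain ⟨M'', hM''⟩ := hcb.exists_bound_of_continuousOn
    ((hF.deriv hU).continuousOn.mono hεU)
  have hsub : Metric.ball z₀ (ε / 2) ⊆ Metric.closedBall z₀ ε :=
    (Metric.ball_subset_ball (by linarith)).trans Metric.ball_subset_closedBall
  refine ⟨ε / 2, half_pos hε, hsub.trans hεU, max M'' ((ε / 2)⁻¹ * (M + M')), fun z hz w hw => ?_⟩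
  rcases eq_or_ne w z with rfl | hne
  · rw [dslope_same]
    exact (hM'' _ (hsub hz)).trans (le_max_left _ _)
  rw [dslope_of_ne _ hne, slope, vsub_eq_sub, norm_smul, norm_inv]
  have hne' : 0 < ‖w - z‖ := norm_pos_iff.2 (sub_ne_zero.2 hne)
  by_cases hwε : w ∈ Metric.closedBall z₀ ε
  · refine le_trans ?_ (le_max_left _ _)
    rw [inv_mul_le_iff₀ hne', mul_comm]
    exact (convex_closedBall z₀ ε).norm_image_sub_le_of_norm_deriv_le
      (fun y hy => hF.differentiableAt (hU.mem_nhds (hεU hy))) hM'' (hsub hz) hwε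
  · refine le_trans ?_ (le_max_right _ _)
    have hd : ε / 2 ≤ ‖w - z‖ := by
      rw [Metric.mem_closedBall, not_le] at hwε
      rw [Metric.mem_ball] at hz
      rw [← dist_eq_norm]
      linarith [dist_triangle w z z₀]
    refine mul_le_mul (inv_anti₀ (half_pos hε) hd) ?_ (norm_nonneg _) (by positivity)
    exact (norm_sub_le _ _).trans (add_le_add (hM w hw) (hM' z (hsub hz)))

theorem dslope_comm (F : ℂ → ℂ) (z w : ℂ) : dslope F z w = dslope F w z := by
  rcases eq_or_ne w z with rfl | hne
  · rfl
  · rw [dslope_of_ne _ hne, dslope_of_ne _ hne.symm, slope_comm]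

/-- **Cauchy's theorem**, homology form. -/
theorem integral_eq_zero_of_winding {C : Chain} {U : Set ℂ} (hU : IsOpen U) (hC : C.support ⊆ U)
    {F : ℂ → ℂ} (hF : DifferentiableOn ℂ F U) (hw : ∀ x ∉ U, C.winding x = 0) :
    C.integral F = 0 := by
  classical
  have hFs : ContinuousOn F C.support := hF.continuousOn.mono hC
  have hds : ∀ z ∈ U, ContinuousOn (dslope F z) C.support := fun z hz =>
    ((continuousOn_dslope (hU.mem_nhds hz)).2
      ⟨hF.continuousOn, hF.differentiableAt (hU.mem_nhds hz)⟩).mono hC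
  set k : ℂ → ℂ := fun z => C.integral fun w => F w * (w - z)⁻¹ with hk
  -- In (F(w) − F(z))/(w − z) the second term integrates to a multiple of the winding number, hence
  -- to 0.
  have hint : ∀ z ∉ C.support, C.winding z = 0 → C.integral (dslope F z) = k z := by
    intro z hz hwz
    have h1 : C.integral (fun w => F z * (w - z)⁻¹) = 0 := by
      rw [integral_const_mul]
      have h2 : (2 * (Real.pi : ℂ) * I)⁻¹ ≠ 0 := by simp [Real.pi_ne_zero]
      rw [winding, mul_eq_zero, or_iff_right h2] at hwz
      rw [hwz, mul_zero]
    have h3 : C.integral (dslope F z) = k z - C.integral (fun w => F z * (w - z)⁻¹) := by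
      rw [hk, ← integral_sub (F := fun w => F w * (w - z)⁻¹) (G := fun w => F z * (w - z)⁻¹)
        (hFs.mul (continuousOn_inv_sub hz)) (continuousOn_const.mul (continuousOn_inv_sub hz))]
      refine integral_congr fun w hw => ?_
      have hne : w ≠ z := fun h => hz (h ▸ hw)
      rw [dslope_of_ne _ hne, slope, vsub_eq_sub, smul_eq_mul]
      ring
    rw [h3, h1, sub_zero]
  -- Dixon's argument: the two formulas agree where the winding number vanishes, so they glue to an
  -- entire function. It tends to 0 at infinity and is therefore 0.
  set h : ℂ → ℂ := fun z => if z ∈ U then C.integral (dslope F z) else k z with hh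
  have hdiff : Differentiable ℂ h := by
    intro z
    by_cases hz : z ∈ U
    · obtain ⟨r, hr, hrU, B, hB⟩ := exists_bound_dslope hU hF C.isCompact_support hC hz
      refine (differentiableAt_integral (C := C) (K := fun z w => dslope F z w) hr
        (fun z hz => hds z (hrU hz)) (fun w hw => ?_) hB).congr_of_eventuallyEq ?_
      · simp only [dslope_comm F _ w]
        exact ((differentiableOn_dslope (hU.mem_nhds (hC hw))).2 hF).mono hrU
      · filter_upwards [hU.mem_nhds hz] with y hy
        exact if_pos hy
    · have hzs : z ∉ C.support := fun h => hz (hC h)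
      refine (differentiableAt_integral_div_sub hFs hzs).congr_of_eventuallyEq ?_
      obtain ⟨δ, hδ, hb⟩ := exists_ball_winding_eq hzs
      filter_upwards [Metric.ball_mem_nhds z hδ] with y hy
      by_cases hyU : y ∈ U
      · rw [hh]
        simp only [if_pos hyU]
        exact hint y (hb y hy).1 ((hb y hy).2.trans (hw z hz))
      · exact if_neg hyU
  obtain ⟨R, hR, hRs, hR0⟩ := C.exists_winding_eq_zero
  obtain ⟨M, hM⟩ := C.isCompact_support.exists_bound_of_continuousOn hFs
  obtain ⟨B, hB0, hB⟩ := C.norm_integral_le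
  have hM0 : 0 ≤ max M 0 := le_max_right _ _
  have hfar : ∀ z, R ≤ ‖z‖ → z ∉ C.support := fun z hz h => absurd (hRs z h) (not_lt.2 hz)
  have hhk : ∀ z, R ≤ ‖z‖ → h z = k z := by
    intro z hz
    by_cases hzU : z ∈ U
    · simp only [hh, if_pos hzU]
      exact hint z (hfar z hz) (hR0 z hz)
    · exact if_neg hzU
  have hinv : ∀ z, R < ‖z‖ → ∀ w ∈ C.support, ‖(w - z)⁻¹‖ ≤ (‖z‖ - R)⁻¹ := by
    intro z hz w hw
    rw [norm_inv]
    refine inv_anti₀ (sub_pos.2 hz) ?_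
    have := norm_sub_norm_le z w
    rw [norm_sub_rev] at this
    linarith [hRs w hw]
  have hlim : Tendsto (fun z : ℂ => (‖z‖ - R)⁻¹) (cocompact ℂ) (𝓝 0) :=
    tendsto_inv_atTop_zero.comp
      (tendsto_atTop_add_const_right _ (-R) (tendsto_norm_cocompact_atTop (E := ℂ)))
  have hev : ∀ᶠ z in cocompact ℂ, R < ‖z‖ :=
    (tendsto_norm_cocompact_atTop (E := ℂ)).eventually_gt_atTop R
  have hh0 : Tendsto h (cocompact ℂ) (𝓝 0) := by
    have hlim' := hlim.const_mul (B * max M 0)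
    rw [mul_zero] at hlim'
    refine squeeze_zero_norm' ?_ hlim'
    filter_upwards [hev] with z hz
    rw [hhk z hz.le, mul_assoc]
    refine hB _ _ (mul_nonneg hM0 (inv_nonneg.2 (sub_pos.2 hz).le)) fun w hw => ?_
    rw [norm_mul]
    exact mul_le_mul ((hM w hw).trans (le_max_left _ _)) (hinv z hz w hw) (norm_nonneg _) hM0
  have hzero : ∀ z, h z = 0 := fun z => hdiff.apply_eq_of_tendsto_cocompact z hh0
  have hbound : ∀ᶠ z in cocompact ℂ, ‖C.integral F‖ ≤ B * (max M 0 * R) * (‖z‖ - R)⁻¹ := by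
    filter_upwards [hev] with z hz
    have hzs := hfar z hz.le
    -- Split F(w) = F(w) w/(w − z) − z F(w)/(w − z). The second part integrates to z k(z) = 0, and
    -- the first tends to 0 as z goes to infinity.
    have e1 : C.integral F = C.integral (fun w => F w * w * (w - z)⁻¹) := by
      have : C.integral F = C.integral (fun w => F w * w * (w - z)⁻¹) - z * k z := by
        rw [hk, ← integral_const_mul, ← integral_sub (F := fun w => F w * w * (w - z)⁻¹)
          (G := fun w => z * (F w * (w - z)⁻¹)) ((hFs.mul continuousOn_id).mul (continuousOn_inv_sub hzs))
          (continuousOn_const.mul (hFs.mul (continuousOn_inv_sub hzs)))]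
        refine integral_congr fun w hw => ?_
        have hne : w - z ≠ 0 := sub_ne_zero.2 fun h => hzs (h ▸ hw)
        field_simp
      rw [this, ← hhk z hz.le, hzero, mul_zero, sub_zero]
    rw [e1, mul_assoc]
    refine hB _ _ (mul_nonneg (mul_nonneg hM0 hR.le) (inv_nonneg.2 (sub_pos.2 hz).le)) fun w hw => ?_
    rw [norm_mul, norm_mul]
    exact mul_le_mul (mul_le_mul ((hM w hw).trans (le_max_left _ _)) (hRs w hw).le (norm_nonneg _)
      hM0) (hinv z hz w hw) (norm_nonneg _) (mul_nonneg hM0 hR.le)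
  have hlim' := hlim.const_mul (B * (max M 0 * R))
  rw [mul_zero] at hlim'
  exact norm_le_zero_iff.1 (ge_of_tendsto hlim' hbound)

theorem winding_sub {C D : Chain} (x : ℂ) : (C.sub D).winding x = C.winding x - D.winding x := by
  simp only [winding, integral_chain_sub, mul_sub]

theorem integral_eq_of_winding_eq {C D : Chain} {U : Set ℂ} (hU : IsOpen U) (hC : C.support ⊆ U)
    (hD : D.support ⊆ U) {F : ℂ → ℂ} (hF : DifferentiableOn ℂ F U)
    (hw : ∀ x ∉ U, C.winding x = D.winding x) : C.integral F = D.integral F := by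
  rw [← sub_eq_zero, ← integral_chain_sub]
  refine integral_eq_zero_of_winding hU ((support_sub_subset C D).trans (union_subset hC hD)) hF
    fun x hx => ?_
  rw [winding_sub, hw x hx, sub_self]

end Chain

end

section

/-! ### Existence of separating chains -/

namespace Chain

/-- The chain of the circles around the points `c ∈ A`, of radius `δ c` and multiplicity `m c`. -/
def circles (A : Finset ℂ) (δ : ℂ → ℝ) (m : ℂ → ℤ) : Chain where
  n := A.card
  mult i := m (A.equivFin.symm i)
  loop i s := circleMap (A.equivFin.symm i) (δ (A.equivFin.symm i)) (2 * Real.pi * s)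
  smooth i := (contDiff_circleMap _ _).comp (contDiff_const.mul contDiff_id)
  closed i := by
    have := periodic_circleMap (A.equivFin.symm i : ℂ) (δ (A.equivFin.symm i)) 0
    rw [mul_zero, mul_one, ← this, zero_add]

theorem integral_circles (A : Finset ℂ) (δ : ℂ → ℝ) (m : ℂ → ℤ) (F : ℂ → ℂ) :
    (circles A δ m).integral F = ∑ c ∈ A, (m c : ℂ) * ∮ z in C(c, δ c), F z := by
  rw [← Finset.sum_coe_sort, ← A.equivFin.symm.sum_comp]
  refine Finset.sum_congr rfl fun i _ => ?_
  simp only [circles]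
  congr 1
  set c : ℂ := ((A.equivFin.symm i : A) : ℂ)
  have h := intervalIntegral.smul_integral_comp_mul_left (a := 0) (b := 1)
    (fun θ => deriv (circleMap c (δ c)) θ • F (circleMap c (δ c) θ)) (2 * Real.pi)
  rw [mul_zero, mul_one] at h
  rw [circleIntegral, ← h, ← intervalIntegral.integral_smul]
  refine intervalIntegral.integral_congr fun s _ => ?_
  have hd : HasDerivAt (fun s : ℝ => circleMap c (δ c) (2 * Real.pi * s))
      ((2 * Real.pi) • deriv (circleMap c (δ c)) (2 * Real.pi * s)) s := by
    have h1 : HasDerivAt (fun s : ℝ => 2 * Real.pi * s) (2 * Real.pi) s := by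
      simpa using (hasDerivAt_id s).const_mul (2 * Real.pi)
    exact (differentiable_circleMap c (δ c) _).hasDerivAt.scomp s h1
  rw [hd.deriv]
  simp only [smul_eq_mul, real_smul]
  ring

theorem support_circles_subset (A : Finset ℂ) (δ : ℂ → ℝ) (m : ℂ → ℤ) {z : ℂ}
    (hz : z ∈ (circles A δ m).support) : ∃ c ∈ A, ‖z - c‖ = |δ c| := by
  obtain ⟨i, s, -, rfl⟩ := mem_iUnion.1 hz
  exact ⟨_, (A.equivFin.symm i).2, by simp [circles]⟩

theorem winding_circles (A : Finset ℂ) {δ : ℂ → ℝ} (m : ℂ → ℤ) {x : ℂ}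
    (hδ : ∀ c ∈ A, 0 < δ c) (hx : ∀ c ∈ A, ‖x - c‖ ≠ δ c) :
    (circles A δ m).winding x = ∑ c ∈ A, if ‖x - c‖ < δ c then (m c : ℂ) else 0 := by
  rw [winding, integral_circles, Finset.mul_sum]
  refine Finset.sum_congr rfl fun c hc => ?_
  split_ifs with h
  · rw [circleIntegral.integral_sub_inv_of_mem_ball (by rwa [Metric.mem_ball, dist_eq_norm])]
    field_simp [Real.pi_ne_zero]
  · have hlt : δ c < ‖x - c‖ := lt_of_le_of_ne (not_lt.1 h) (hx c hc).symm
    rw [DiffContOnCl.circleIntegral_eq_zero (hδ c hc).le, mul_zero, mul_zero]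
    refine DifferentiableOn.diffContOnCl fun z hz => ?_
    rw [closure_ball _ (hδ c hc).ne', Metric.mem_closedBall, dist_eq_norm] at hz
    have : z - x ≠ 0 := fun h0 => by
      rw [sub_eq_zero.1 h0] at hz
      exact absurd hz (not_le.2 hlt)
    exact ((differentiableAt_id.sub_const x).inv this).differentiableWithinAt

/-- Disjoint sets of points, of which the first accumulates only at `0` and the second only at
infinity, can be separated by a chain of circles. -/
theorem exists_separates {Inn Out : Set ℂ} (hdis : Disjoint Inn Out) (h0i : (0 : ℂ) ∉ Inn)
    (h0o : (0 : ℂ) ∉ Out) (hin : ∀ ε > 0, {x ∈ Inn | ε ≤ ‖x‖}.Finite)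
    (hout : ∀ R : ℝ, {x ∈ Out | ‖x‖ ≤ R}.Finite) :
    ∃ C : Chain, C.Separates Inn Out ∧ ∀ i s, C.loop i s ≠ 0 := by
  classical
  set S := Inn ∪ Out with hS
  have hann : ∀ ε > 0, ∀ R : ℝ, {x ∈ S | ε ≤ ‖x‖ ∧ ‖x‖ ≤ R}.Finite := fun ε hε R =>
    ((hin ε hε).union (hout R)).subset fun x hx =>
      hx.1.imp (fun h => ⟨h, hx.2.1⟩) fun h => ⟨h, hx.2.2⟩
  have hS0 : ∀ x ∈ S, x ≠ 0 := by
    rintro x (hx | hx) rfl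
    exacts [h0i hx, h0o hx]
  -- Only finitely many points have norm in [1,2], so some radius avoids them all.
  obtain ⟨ρ, hρ, hρS⟩ : ∃ ρ : ℝ, 0 < ρ ∧ ∀ x ∈ S, ‖x‖ ≠ ρ := by
    have hfin := ((hann 1 one_pos 2).image norm)
    obtain ⟨ρ, hρ, hρ'⟩ := (Icc_infinite (α := ℝ) one_lt_two).exists_notMem_finite hfin
    refine ⟨ρ, by linarith [hρ.1], fun x hx h => hρ' ⟨x, ⟨hx, ?_⟩, h⟩⟩
    rw [h]; exact hρ
  -- Radii so small that a circle around x encloses neither 0 nor any other point of S; only the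
  -- finitely many points in an annulus around x matter.
  have hδ : ∀ x, ∃ d : ℝ, x ∈ S → 0 < d ∧ d < ‖x‖ ∧ ∀ y ∈ S, y ≠ x → d < ‖y - x‖ := by
    intro x
    by_cases hx : x ∈ S
    swap
    · exact ⟨0, fun h => absurd h hx⟩
    have hxn : 0 < ‖x‖ := norm_pos_iff.2 (hS0 x hx)
    have hfin := (hann (‖x‖ / 2) (half_pos hxn) (2 * ‖x‖))
    have hopen : IsOpen ({y ∈ S | ‖x‖ / 2 ≤ ‖y‖ ∧ ‖y‖ ≤ 2 * ‖x‖} \ {x})ᶜ :=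
      (hfin.subset sdiff_subset).isClosed.isOpen_compl
    obtain ⟨ε, hε, hb⟩ := Metric.isOpen_iff.1 hopen x (by simp)
    refine ⟨min (ε / 2) (‖x‖ / 3), fun _ => ⟨by positivity, ?_, fun y hy hyx => ?_⟩⟩
    · exact (min_le_right _ _).trans_lt (by linarith)
    by_contra! hle
    have h1 : ‖y - x‖ ≤ ε / 2 := hle.trans (min_le_left _ _)
    have h2 : ‖y - x‖ ≤ ‖x‖ / 3 := hle.trans (min_le_right _ _)
    refine hb (a := y) (by rw [Metric.mem_ball, dist_eq_norm]; linarith) ⟨⟨hy, ?_, ?_⟩, hyx⟩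
    · have := norm_sub_norm_le x y
      rw [norm_sub_rev] at this
      linarith
    · linarith [norm_sub_norm_le y x]
  choose d hd using hδ
  have hAi := hin ρ hρ
  have hAo := hout ρ
  set Ai := hAi.toFinset with hAi'
  set Ao := hAo.toFinset with hAo'
  have memi : ∀ x, x ∈ Ai ↔ x ∈ Inn ∧ ρ ≤ ‖x‖ := fun x => by simp [hAi']
  have memo : ∀ x, x ∈ Ao ↔ x ∈ Out ∧ ‖x‖ ≤ ρ := fun x => by simp [hAo']
  have hAS : ∀ c ∈ Ai ∪ Ao, c ∈ S := by
    intro c hc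
    rcases Finset.mem_union.1 hc with h | h
    exacts [Or.inl ((memi c).1 h).1, Or.inr ((memo c).1 h).1]
  have h0A : (0 : ℂ) ∉ Ai ∪ Ao := fun h => hS0 0 (hAS 0 h) rfl
  -- The circle of radius ρ about 0 is right for all but finitely many points. Small circles correct
  -- the rest, with multiplicity 1 at inner points beyond ρ and −1 at outer points within ρ.
  set A := insert 0 (Ai ∪ Ao) with hA
  set δ : ℂ → ℝ := fun x => if x = 0 then ρ else d x with hδ
  set m : ℂ → ℤ := fun x => if x = 0 then 1 else if x ∈ Inn then 1 else -1 with hm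
  have hδ0 : δ 0 = ρ := if_pos rfl
  have hδA : ∀ c ∈ Ai ∪ Ao, δ c = d c := fun c hc => if_neg (hS0 c (hAS c hc))
  have hδpos : ∀ c ∈ A, 0 < δ c := by
    intro c hc
    rcases Finset.mem_insert.1 hc with rfl | hc
    · rwa [hδ0]
    · rw [hδA c hc]; exact (hd c (hAS c hc)).1
  have hne : ∀ x ∈ S, ∀ c ∈ A, ‖x - c‖ ≠ δ c := by
    intro x hx c hc
    rcases Finset.mem_insert.1 hc with rfl | hc
    · rw [sub_zero, hδ0]; exact hρS x hx
    · rw [hδA c hc]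
      rcases eq_or_ne x c with rfl | hxc
      · simpa using (hd x hx).1.ne
      · exact ((hd c (hAS c hc)).2.2 x hx hxc).ne'
  have hzero : ∀ c ∈ A, ‖(0 : ℂ) - c‖ ≠ δ c := by
    intro c hc
    rcases Finset.mem_insert.1 hc with rfl | hc
    · simpa [hδ0] using hρ.ne
    · rw [hδA c hc, zero_sub, norm_neg]; exact (hd c (hAS c hc)).2.1.ne'
  have hsupp : ∀ x, (∀ c ∈ A, ‖x - c‖ ≠ δ c) → x ∉ (circles A δ m).support := by
    intro x hx h
    obtain ⟨c, hc, h⟩ := support_circles_subset A δ m h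
    rw [abs_of_pos (hδpos c hc)] at h
    exact hx c hc h
  have hwind : ∀ x ∈ S, (circles A δ m).winding x =
      (if ‖x‖ < ρ then 1 else 0) + if x ∈ Ai ∪ Ao then (m x : ℂ) else 0 := by
    intro x hx
    rw [winding_circles A m hδpos (hne x hx), hA, Finset.sum_insert h0A, sub_zero, hδ0]
    congr 1
    · simp [hm]
    · rw [← Finset.sum_ite_eq (Ai ∪ Ao) x fun c => (m c : ℂ)]
      refine Finset.sum_congr rfl fun c hc => ?_
      rw [hδA c hc]
      refine if_congr ⟨fun h => ?_, ?_⟩ rfl rfl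
      · by_contra hxc
        exact lt_asymm h ((hd c (hAS c hc)).2.2 x hx hxc)
      · rintro rfl
        simpa using (hd x hx).1
  refine ⟨circles A δ m, ⟨hsupp 0 hzero, ?_, ?_, fun x hx => ?_, fun x hx => ?_⟩, fun i s h => ?_⟩
  · exact disjoint_right.2 fun x hx => hsupp x (hne x (Or.inl hx))
  · exact disjoint_right.2 fun x hx => hsupp x (hne x (Or.inr hx))
  · rw [hwind x (Or.inl hx)]
    have hxo : x ∉ Ao := fun h => disjoint_left.1 hdis hx ((memo x).1 h).1
    have hx0 := hS0 x (Or.inl hx)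
    rcases lt_or_ge ‖x‖ ρ with h | h
    · have : x ∉ Ai := fun h' => absurd h (not_lt.2 ((memi x).1 h').2)
      simp [h, this, hxo]
    · have : x ∈ Ai := (memi x).2 ⟨hx, h⟩
      simp [not_lt.2 h, this, hm, hx0, hx]
  · rw [hwind x (Or.inr hx)]
    have hxi : x ∉ Inn := fun h => disjoint_left.1 hdis h hx
    have hxi' : x ∉ Ai := fun h => hxi ((memi x).1 h).1
    have hx0 := hS0 x (Or.inr hx)
    rcases lt_or_ge ρ ‖x‖ with h | h
    · have : x ∉ Ao := fun h' => absurd h (not_lt.2 ((memo x).1 h').2)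
      simp [not_lt.2 h.le, this, hxi']
    · have : x ∈ Ao := (memo x).2 ⟨hx, h⟩
      simp [lt_of_le_of_ne h (hρS x (Or.inr hx)), this, hm, hx0, hxi]
  · have hc := (A.equivFin.symm i).2
    refine hzero _ hc ?_
    rw [← h]
    simp [circles, abs_of_pos (hδpos _ hc)]

end Chain

end

section

/-! ### Analytic properties of the `q`-symbols -/

theorem summable_geometric_prod {ρ σ : ℝ} (hρ0 : 0 ≤ ρ) (hρ : ρ < 1) (hσ0 : 0 ≤ σ) (hσ : σ < 1)
    (R : ℝ) : Summable fun k : ℕ × ℕ => R * (ρ ^ k.1 * σ ^ k.2) :=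
  ((summable_geometric_of_lt_one hρ0 hρ).mul_of_nonneg (summable_geometric_of_lt_one hσ0 hσ)
    (fun _ => pow_nonneg hρ0 _) fun _ => pow_nonneg hσ0 _).mul_left R

variable {p q x : ℂ}

theorem summable_pqPoch (hp : ‖p‖ < 1) (hq : ‖q‖ < 1) (x : ℂ) :
    Summable fun k : ℕ × ℕ => ‖-(x * p ^ k.1 * q ^ k.2)‖ := by
  simpa [mul_assoc] using
    summable_geometric_prod (norm_nonneg p) hp (norm_nonneg q) hq ‖x‖

theorem multipliable_pqPoch (hp : ‖p‖ < 1) (hq : ‖q‖ < 1) (x : ℂ) :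
    Multipliable fun k : ℕ × ℕ => 1 - x * p ^ k.1 * q ^ k.2 := by
  simpa only [sub_eq_add_neg] using multipliable_one_add_of_summable (summable_pqPoch hp hq x)

theorem pqPoch_eq_zero (hp : ‖p‖ < 1) (hq : ‖q‖ < 1) (h : pqPoch x p q = 0) :
    ∃ i j : ℕ, x * p ^ i * q ^ j = 1 := by
  by_contra! hne
  refine tprod_one_add_ne_zero_of_summable (f := fun k : ℕ × ℕ => -(x * p ^ k.1 * q ^ k.2))
    (fun k => ?_) (summable_pqPoch hp hq x) ?_
  · rw [← sub_eq_add_neg]; exact sub_ne_zero.2 (hne k.1 k.2).symm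
  · simpa only [← sub_eq_add_neg, pqPoch] using h

theorem pqPoch_comm (x p q : ℂ) : pqPoch x p q = pqPoch x q p := by
  unfold pqPoch
  rw [← (Equiv.prodComm ℕ ℕ).tprod_eq]
  refine tprod_congr fun k => ?_
  simp only [Equiv.prodComm_apply, Prod.fst_swap, Prod.snd_swap]
  ring

/-- As `0 ^ 0 = 1`, exactly the factors with j = 0 remain. Thus (x;p) inherits its analytic
properties from (x;p,q), and the same identity in the other nome identifies the limits p → 0. -/
theorem pqPoch_zero_right (x p : ℂ) : pqPoch x p 0 = qPoch x p := by
  have hinj : Function.Injective fun i : ℕ => ((i, 0) : ℕ × ℕ) := fun i j h => by simpa using h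
  unfold pqPoch qPoch
  rw [← hinj.tprod_eq]
  · simp
  · rintro ⟨i, j⟩ h
    rcases j with _ | j
    · exact ⟨i, rfl⟩
    · simp at h

theorem pqPoch_zero_middle (x q : ℂ) : pqPoch x 0 q = qPoch x q := by
  rw [pqPoch_comm, pqPoch_zero_right]

theorem pqPoch_eq_mul (hp : ‖p‖ < 1) (hq : ‖q‖ < 1) (x : ℂ) :
    pqPoch x p q = qPoch x q * pqPoch (p * x) p q := by
  have h1 : Function.Injective fun j : ℕ => ((0, j) : ℕ × ℕ) := fun i j h => by simpa using h
  have h2 : Function.Injective fun k : ℕ × ℕ => ((k.1 + 1, k.2) : ℕ × ℕ) := fun i j h => by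
    simp only [Prod.mk.injEq, add_left_inj] at h
    exact Prod.ext h.1 h.2
  have hc : IsCompl (range fun j : ℕ => ((0, j) : ℕ × ℕ))
      (range fun k : ℕ × ℕ => ((k.1 + 1, k.2) : ℕ × ℕ)) := by
    rw [isCompl_iff, disjoint_left, codisjoint_iff_le_sup]
    refine ⟨?_, ?_⟩
    · rintro _ ⟨j, rfl⟩ ⟨k, hk⟩
      simp at hk
    · rintro ⟨i, j⟩ -
      rcases i with _ | i
      · exact Or.inl ⟨j, rfl⟩
      · exact Or.inr ⟨(i, j), rfl⟩
  have e1 : HasProd ((fun k : ℕ × ℕ => 1 - x * p ^ k.1 * q ^ k.2) ∘ fun j : ℕ => ((0, j) : ℕ × ℕ))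
      (qPoch x q) := by
    have hs : Summable fun k : ℕ => ‖-(x * q ^ k)‖ := by
      simpa using (summable_geometric_of_lt_one (norm_nonneg q) hq).mul_left ‖x‖
    have := (multipliable_one_add_of_summable hs).hasProd
    simpa [Function.comp_def, qPoch, sub_eq_add_neg] using this
  have e2 : HasProd ((fun k : ℕ × ℕ => 1 - x * p ^ k.1 * q ^ k.2) ∘
      fun k : ℕ × ℕ => ((k.1 + 1, k.2) : ℕ × ℕ)) (pqPoch (p * x) p q) := by
    have : HasProd _ (pqPoch (p * x) p q) := (multipliable_pqPoch hp hq (p * x)).hasProd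
    convert this using 2 with k
    simp only [Function.comp_apply, pow_succ]
    ring
  have a1 := h1.hasProd_range_iff.2 e1
  have a2 := h2.hasProd_range_iff.2 e2
  have a3 := HasProd.mul_isCompl (f := fun k : ℕ × ℕ => 1 - x * p ^ k.1 * q ^ k.2) hc a1 a2
  rw [← a3.tprod_eq, pqPoch]

theorem pqPoch_eq_mul' (hp : ‖p‖ < 1) (hq : ‖q‖ < 1) (x : ℂ) :
    pqPoch x p q = qPoch x p * pqPoch (q * x) p q := by
  rw [pqPoch_comm, pqPoch_eq_mul hq hp, pqPoch_comm]

theorem qPoch_eq_mul (hp : ‖p‖ < 1) (x : ℂ) : qPoch x p = (1 - x) * qPoch (p * x) p := by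
  have h0 : ‖(0 : ℂ)‖ < 1 := by simp
  have h := pqPoch_eq_mul hp h0 x
  rw [pqPoch_zero_right, pqPoch_zero_right, ← pqPoch_zero_right x 0] at h
  rw [h]
  congr 1
  have h' := pqPoch_eq_mul h0 h0 x
  unfold pqPoch
  rw [tprod_eq_mulSingle (0, 0)]
  · simp
  · rintro ⟨i, j⟩ h
    rcases i with _ | i <;> rcases j with _ | j <;> simp at h ⊢

theorem qPoch_zero_left (q : ℂ) : qPoch 0 q = 1 := by simp [qPoch]

theorem qPoch_zero_right (x : ℂ) : qPoch x 0 = 1 - x := by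
  rw [qPoch_eq_mul (by simp), zero_mul, qPoch_zero_left, mul_one]

theorem qPoch_eq_zero (hq : ‖q‖ < 1) (h : qPoch x q = 0) : ∃ j : ℕ, x * q ^ j = 1 := by
  rw [← pqPoch_zero_right] at h
  obtain ⟨i, j, h⟩ := pqPoch_eq_zero hq (by simp) h
  rcases j with _ | j
  · exact ⟨i, by simpa using h⟩
  · simp at h

theorem qPoch_of_eq_one {j : ℕ} (h : x * q ^ j = 1) : qPoch x q = 0 :=
  tprod_of_exists_eq_zero ⟨j, by rw [h, sub_self]⟩

theorem qPoch_ne_zero_of_pqPoch (hp : ‖p‖ < 1) (hq : ‖q‖ < 1) (h : pqPoch x p q ≠ 0) :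
    qPoch x p ≠ 0 ∧ qPoch x q ≠ 0 :=
  ⟨left_ne_zero_of_mul (pqPoch_eq_mul' hp hq x ▸ h),
    left_ne_zero_of_mul (pqPoch_eq_mul hp hq x ▸ h)⟩

/-- The uniformity is joint in x and p, on a region with p = 0 in its interior when ρ > 0; this
makes the limit p → 0 a matter of continuity. -/
theorem tendstoLocallyUniformlyOn_pqPoch (hq : ‖q‖ < 1) {ρ : ℝ} (hρ0 : 0 ≤ ρ) (hρ : ρ < 1)
    (R : ℝ) : TendstoLocallyUniformlyOn
      (fun (s : Finset (ℕ × ℕ)) (v : ℂ × ℂ) => ∏ k ∈ s, (1 + -(v.1 * v.2 ^ k.1 * q ^ k.2)))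
      (fun v => pqPoch v.1 v.2 q) atTop (Metric.ball 0 R ×ˢ Metric.ball 0 ρ) := by
  have := Summable.hasProdLocallyUniformlyOn_one_add
    (f := fun (k : ℕ × ℕ) (v : ℂ × ℂ) => -(v.1 * v.2 ^ k.1 * q ^ k.2))
    (K := Metric.ball 0 R ×ˢ Metric.ball 0 ρ) (Metric.isOpen_ball.prod Metric.isOpen_ball)
    (summable_geometric_prod hρ0 hρ (norm_nonneg q) hq R) (Eventually.of_forall ?_) ?_
  · simp only [pqPoch, sub_eq_add_neg]
    exact this
  · rintro k v ⟨h1, h2⟩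
    rw [mem_ball_zero_iff] at h1 h2
    rw [norm_neg, norm_mul, norm_mul, norm_pow, norm_pow, mul_assoc]
    have hR := (norm_nonneg _).trans h1.le
    gcongr
  · intro k
    fun_prop

theorem continuousAt_pqPoch (hq : ‖q‖ < 1) (x : ℂ) (hp : ‖p‖ < 1) :
    ContinuousAt (fun v : ℂ × ℂ => pqPoch v.1 v.2 q) (x, p) := by
  obtain ⟨ρ, h1, h2⟩ := exists_between hp
  have h := (tendstoLocallyUniformlyOn_pqPoch hq ((norm_nonneg p).trans h1.le) h2
    (‖x‖ + 1)).continuousOn (Eventually.frequently (Eventually.of_forall fun s => by fun_prop))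
  refine h.continuousAt (prod_mem_nhds (Metric.isOpen_ball.mem_nhds ?_)
    (Metric.isOpen_ball.mem_nhds ?_))
  · simp
  · simpa using h1

theorem continuousAt_qPoch (x : ℂ) (hp : ‖p‖ < 1) :
    ContinuousAt (fun v : ℂ × ℂ => qPoch v.1 v.2) (x, p) := by
  simpa only [pqPoch_zero_right] using continuousAt_pqPoch (q := 0) (by simp) x hp

theorem differentiable_pqPoch (hp : ‖p‖ < 1) (hq : ‖q‖ < 1) :
    Differentiable ℂ fun x => pqPoch x p q := by
  intro x
  obtain ⟨ρ, h1, h2⟩ := exists_between hp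
  have h := (tendstoLocallyUniformlyOn_pqPoch hq ((norm_nonneg p).trans h1.le) h2
    (‖x‖ + 1)).comp (fun x : ℂ => (x, p)) (t := Metric.ball 0 (‖x‖ + 1))
    (fun y hy => ⟨hy, by simpa using h1⟩) (by fun_prop)
  refine (h.differentiableOn (Eventually.of_forall fun s => ?_) Metric.isOpen_ball).differentiableAt
    (Metric.isOpen_ball.mem_nhds (by simp))
  simp only [Function.comp_def]
  fun_prop

theorem differentiable_qPoch (hp : ‖p‖ < 1) : Differentiable ℂ fun x => qPoch x p := by
  simpa only [pqPoch_zero_right] using differentiable_pqPoch (q := 0) hp (by simp)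

/-! ### Functional equations -/

theorem theta_div (hp0 : p ≠ 0) (x : ℂ) : theta (p / x) p = theta x p := by
  rw [theta, theta, div_div_cancel₀ hp0, mul_comm]

theorem theta_mul (hp0 : p ≠ 0) (hp : ‖p‖ < 1) (hx : x ≠ 0) :
    theta (p * x) p = -x⁻¹ * theta x p := by
  have h1 := qPoch_eq_mul hp x
  have h2 := qPoch_eq_mul hp x⁻¹
  rw [theta, theta, h1, show p / (p * x) = x⁻¹ by field_simp, h2, ← div_eq_mul_inv]
  field_simp
  ring

theorem theta_inv (hp0 : p ≠ 0) (hp : ‖p‖ < 1) (hx : x ≠ 0) :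
    theta x⁻¹ p = -x⁻¹ * theta x p := by
  rw [← theta_mul hp0 hp hx, ← theta_div hp0 (p * x)]
  congr 1
  field_simp

theorem theta_one (p : ℂ) : theta 1 p = 0 := by
  rw [theta, qPoch_of_eq_one (j := 0) (by simp), zero_mul]

theorem theta_eq_zero (hp0 : p ≠ 0) (hp : ‖p‖ < 1) (hx : x ≠ 0) (h : theta x p = 0) :
    ∃ n : ℤ, x = p ^ n := by
  rcases mul_eq_zero.1 h with h | h
  · obtain ⟨j, h⟩ := qPoch_eq_zero hp h
    refine ⟨-j, ?_⟩
    rw [zpow_neg, zpow_natCast]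
    exact eq_inv_of_mul_eq_one_left h
  · obtain ⟨j, h⟩ := qPoch_eq_zero hp h
    refine ⟨j + 1, ?_⟩
    rw [zpow_add_one₀ hp0, zpow_natCast]
    field_simp at h
    rw [← h]
    ring

theorem differentiableAt_theta (hp : ‖p‖ < 1) (hx : x ≠ 0) :
    DifferentiableAt ℂ (fun x => theta x p) x :=
  (differentiable_qPoch hp x).mul ((differentiable_qPoch hp (p / x)).comp x
    ((differentiableAt_const p).div differentiableAt_id hx))

theorem ellGamma_mul_right (hp : ‖p‖ < 1) (hq : ‖q‖ < 1) (hq0 : q ≠ 0)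
    (h : pqPoch x p q ≠ 0) : ellGamma (q * x) p q = theta x p * ellGamma x p q := by
  have h1 := (qPoch_ne_zero_of_pqPoch hp hq h).1
  have h2 := pqPoch_eq_mul' hp hq x
  have h3 : pqPoch (q * x) p q ≠ 0 := right_ne_zero_of_mul (h2 ▸ h)
  have h4 := pqPoch_eq_mul' hp hq (p / x)
  rw [ellGamma, ellGamma, theta, h2, show p * q / (q * x) = p / x by field_simp, h4,
    show q * (p / x) = p * q / x by ring]
  field_simp

theorem ellGamma_comm (x p q : ℂ) : ellGamma x p q = ellGamma x q p := by
  rw [ellGamma, ellGamma, pqPoch_comm, pqPoch_comm x, mul_comm p q]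

theorem ellGamma_mul_left (hp : ‖p‖ < 1) (hq : ‖q‖ < 1) (hp0 : p ≠ 0)
    (h : pqPoch x p q ≠ 0) : ellGamma (p * x) p q = theta x q * ellGamma x p q := by
  rw [ellGamma_comm, ellGamma_mul_right hq hp hp0 (by rwa [pqPoch_comm]), ellGamma_comm]

/-- After one p-product and one q-product are split off from each denominator, what is left cancels
the numerator of the other gamma function. This turns 1/Γ(z^{±2}) into theta functions. -/
theorem ellGamma_mul_inv (hp : ‖p‖ < 1) (hq : ‖q‖ < 1)
    (h1 : pqPoch x p q ≠ 0) (h2 : pqPoch x⁻¹ p q ≠ 0) :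
    1 / (ellGamma x p q * ellGamma x⁻¹ p q) = theta x q * theta x⁻¹ p := by
  have e1 := pqPoch_eq_mul hp hq x
  have e2 := pqPoch_eq_mul' hp hq (p * x)
  have e3 := pqPoch_eq_mul' hp hq x⁻¹
  have e4 := pqPoch_eq_mul hp hq (q * x⁻¹)
  rw [e2] at e1
  rw [e4] at e3
  have n1 : pqPoch (q * (p * x)) p q ≠ 0 := fun h => h1 (by rw [e1, h]; ring)
  have n2 : pqPoch (p * (q * x⁻¹)) p q ≠ 0 := fun h => h2 (by rw [e3, h]; ring)
  rw [ellGamma, ellGamma, theta, theta, div_inv_eq_mul, div_inv_eq_mul,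
    show p * q / x = p * (q * x⁻¹) by ring, show p * q * x = q * (p * x) by ring, e1, e3,
    div_eq_mul_inv q x]
  generalize pqPoch (q * (p * x)) p q = A at *
  generalize pqPoch (p * (q * x⁻¹)) p q = B at *
  field_simp

end

section

/-! ### The three-term relation for theta functions -/

theorem frequently_notMem_of_countable {E : Set ℂ} (hE : E.Countable) (x : ℂ) :
    ∃ᶠ y in 𝓝 x, y ∉ E :=
  mem_closure_iff_frequently.1 (hE.dense_compl ℂ x)

theorem eq_of_eq_off_countable {f g : ℂ → ℂ} {x : ℂ} (hf : ContinuousAt f x)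
    (hg : ContinuousAt g x) {E : Set ℂ} (hE : E.Countable)
    (h : ∀ᶠ y in 𝓝 x, y ∉ E → f y = g y) : f x = g x := by
  by_contra hne
  have h1 : ∀ᶠ y in 𝓝 x, f y ≠ g y := (hf.prodMk hg).eventually
    ((isOpen_ne_fun continuous_fst continuous_snd).mem_nhds hne)
  obtain ⟨y, hy, h1, h2⟩ := ((frequently_notMem_of_countable hE x).and_eventually (h1.and h)).exists
  exact h1 (h2 hy)

variable {q : ℂ}

theorem hasDerivAt_theta_one (hq : ‖q‖ < 1) :
    HasDerivAt (fun x => theta x q) (-(qPoch q q * qPoch q q)) 1 := by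
  have h : (fun x => theta x q) = fun x => (1 - x) * (qPoch (q * x) q * qPoch (q / x) q) := by
    funext x
    rw [theta, qPoch_eq_mul hq x, mul_assoc]
  rw [h]
  have hu : DifferentiableAt ℂ (fun x => qPoch (q * x) q * qPoch (q / x) q) 1 :=
    ((differentiable_qPoch hq _).comp 1 (differentiableAt_id.const_mul q)).mul
      ((differentiable_qPoch hq _).comp 1
        ((differentiableAt_const q).div differentiableAt_id one_ne_zero))
  exact (HasDerivAt.fun_mul (c := fun x => 1 - x) ((hasDerivAt_id (1 : ℂ)).const_sub 1)
    hu.hasDerivAt).congr_deriv (by simp)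

theorem qPoch_self_ne_zero (hq : ‖q‖ < 1) : qPoch q q ≠ 0 := by
  intro h
  obtain ⟨j, h⟩ := qPoch_eq_zero hq h
  have h1 : ‖q‖ ^ (j + 1) = 1 := by rw [← norm_pow, pow_succ', h, norm_one]
  exact (pow_lt_one₀ (norm_nonneg q) hq (Nat.succ_ne_zero j)).ne h1

/-- The relation θ(qx) = −θ(x)/x carries simple zeros at x to simple zeros at qx and back; at x = 1
the derivative is −(q;q)². -/
theorem theta_zpow (hq0 : q ≠ 0) (hq : ‖q‖ < 1) (n : ℤ) :
    theta (q ^ n) q = 0 ∧ deriv (fun x => theta x q) (q ^ n) ≠ 0 := by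
  have step : ∀ x : ℂ, x ≠ 0 → ((theta x q = 0 ∧ deriv (fun x => theta x q) x ≠ 0) ↔
      (theta (q * x) q = 0 ∧ deriv (fun x => theta x q) (q * x) ≠ 0)) := by
    intro x hx
    have hz : theta x q = 0 ↔ theta (q * x) q = 0 := by
      rw [theta_mul hq0 hq hx, mul_eq_zero, or_iff_right (by simpa using hx)]
    rw [← hz]
    refine and_congr_right fun h0 => not_congr ?_
    have h1 : HasDerivAt (fun y => theta (q * y) q) (deriv (fun x => theta x q) (q * x) * q) x := by
      have := (differentiableAt_theta hq (mul_ne_zero hq0 hx)).hasDerivAt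
      exact this.comp x (by simpa using (hasDerivAt_id x).const_mul q)
    have h2 : HasDerivAt (fun y => -y⁻¹ * theta y q)
        (-(-(x ^ 2)⁻¹) * theta x q + -x⁻¹ * deriv (fun x => theta x q) x) x :=
      (hasDerivAt_inv hx).neg.mul (differentiableAt_theta hq hx).hasDerivAt
    have h3 := h1.unique (h2.congr_of_eventuallyEq (by
      filter_upwards [isOpen_ne.mem_nhds hx] with y hy using theta_mul hq0 hq hy))
    rw [h0, mul_zero, zero_add] at h3
    constructor
    · intro h
      rw [h, mul_zero] at h3
      exact (mul_eq_zero.1 h3).resolve_right hq0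
    · intro h
      rw [h, zero_mul] at h3
      exact (mul_eq_zero.1 h3.symm).resolve_left (by simpa using hx)
  induction n using Int.induction_on with
  | zero =>
    rw [zpow_zero, (hasDerivAt_theta_one hq).deriv]
    exact ⟨theta_one q, by simpa using qPoch_self_ne_zero hq⟩
  | succ n ih =>
    rw [add_comm, zpow_one_add₀ hq0]
    exact (step _ (zpow_ne_zero _ hq0)).1 ih
  | pred n ih =>
    refine (step _ (zpow_ne_zero _ hq0)).2 ?_
    rwa [← zpow_one_add₀ hq0, add_sub_cancel]

/-- The zeros of θ are simple, so G/θ has removable singularities. The value there is given by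
l'Hôpital's rule, and near them the quotient is one of divided differences. -/
theorem exists_eq_theta_mul_aux (hq0 : q ≠ 0) (hq : ‖q‖ < 1) {G : ℂ → ℂ}
    (hG : ∀ x, x ≠ 0 → DifferentiableAt ℂ G x) (hG0 : ∀ n : ℤ, G (q ^ n) = 0) :
    ∃ Q : ℂ → ℂ, (∀ x, x ≠ 0 → DifferentiableAt ℂ Q x) ∧ ∀ x, x ≠ 0 → G x = theta x q * Q x := by
  set T : ℂ → ℂ := fun x => theta x q with hT
  have hTd : ∀ x, x ≠ 0 → DifferentiableAt ℂ T x := fun x hx => differentiableAt_theta hq hx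
  have hopen : IsOpen ({0}ᶜ : Set ℂ) := isOpen_compl_singleton
  refine ⟨fun x => if T x = 0 then deriv G x / deriv T x else G x / T x, fun x hx => ?_,
    fun x hx => ?_⟩
  · by_cases h : T x = 0
    · obtain ⟨n, hn⟩ := theta_eq_zero hq0 hq hx h
      have hT' : deriv T x ≠ 0 := hn ▸ (theta_zpow hq0 hq n).2
      have hGx : G x = 0 := hn ▸ hG0 n
      have hd : ∀ {H : ℂ → ℂ}, (∀ x, x ≠ 0 → DifferentiableAt ℂ H x) →
          DifferentiableAt ℂ (dslope H x) x := fun hH =>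
        ((differentiableOn_dslope (hopen.mem_nhds hx)).2 fun y hy =>
          (hH y hy).differentiableWithinAt).differentiableAt (hopen.mem_nhds hx)
      have hne : dslope T x x ≠ 0 := by rwa [dslope_same]
      refine ((hd hG).div (hd hTd) hne).congr_of_eventuallyEq ?_
      filter_upwards [(hd hTd).continuousAt.eventually_ne hne] with y hy
      simp only [Pi.div_apply]
      rcases eq_or_ne y x with rfl | hyx
      · rw [if_pos h, dslope_same, dslope_same]
      · have hsub := sub_ne_zero.2 hyx
        have e1 : T y = (y - x) * dslope T x y := by
          rw [← smul_eq_mul, sub_smul_dslope, h, sub_zero]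
        have e2 : G y = (y - x) * dslope G x y := by
          rw [← smul_eq_mul, sub_smul_dslope, hGx, sub_zero]
        rw [if_neg (by rw [e1]; exact mul_ne_zero hsub hy), e1, e2, mul_div_mul_left _ _ hsub]
    · refine ((hG x hx).div (hTd x hx) h).congr_of_eventuallyEq ?_
      filter_upwards [(hTd x hx).continuousAt.eventually_ne h] with y hy
      simp only [Pi.div_apply, if_neg hy]
  · by_cases h : T x = 0
    · obtain ⟨n, hn⟩ := theta_eq_zero hq0 hq hx h
      change G x = T x * _
      rw [h, zero_mul, hn, hG0]
    · simp only [if_neg h]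
      rw [mul_div_cancel₀]
      exact h

/-- A holomorphic function on the punctured plane that vanishes at the zeros of `θ(cx;q)` is
divisible by `θ(cx;q)`. -/
theorem exists_eq_theta_mul (hq0 : q ≠ 0) (hq : ‖q‖ < 1) {G : ℂ → ℂ} {c : ℂ} (hc : c ≠ 0)
    (hG : ∀ x, x ≠ 0 → DifferentiableAt ℂ G x) (hG0 : ∀ n : ℤ, G (q ^ n * c⁻¹) = 0) :
    ∃ Q : ℂ → ℂ, (∀ x, x ≠ 0 → DifferentiableAt ℂ Q x) ∧
      ∀ x, x ≠ 0 → G x = theta (c * x) q * Q x := by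
  obtain ⟨Q, hQ, h⟩ := exists_eq_theta_mul_aux hq0 hq (G := fun x => G (x * c⁻¹))
    (fun x hx => (hG _ (mul_ne_zero hx (inv_ne_zero hc))).comp x (differentiableAt_id.mul_const _))
    hG0
  refine ⟨fun x => Q (c * x), fun x hx => (hQ _ (mul_ne_zero hc hx)).comp x
    (differentiableAt_id.const_mul c), fun x hx => ?_⟩
  rw [← h _ (mul_ne_zero hc hx)]
  congr 1
  field_simp

/-- A holomorphic elliptic function is constant. -/
theorem eq_of_periodic (hq0 : q ≠ 0) (hq : ‖q‖ < 1) {Q : ℂ → ℂ}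
    (hQ : ∀ x, x ≠ 0 → DifferentiableAt ℂ Q x) (hper : ∀ x, x ≠ 0 → Q (q * x) = Q x)
    {x y : ℂ} (hx : x ≠ 0) (hy : y ≠ 0) : Q x = Q y := by
  have hperz : ∀ (n : ℤ) (x : ℂ), x ≠ 0 → Q (q ^ n * x) = Q x := by
    intro n
    induction n using Int.induction_on with
    | zero => simp
    | succ n ih =>
      intro x hx
      rw [add_comm, zpow_one_add₀ hq0, mul_assoc,
        hper _ (mul_ne_zero (zpow_ne_zero _ hq0) hx), ih x hx]
    | pred n ih =>
      intro x hx
      rw [← hper _ (mul_ne_zero (zpow_ne_zero _ hq0) hx), ← mul_assoc, ← zpow_one_add₀ hq0,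
        add_sub_cancel, ih x hx]
  have hK : IsCompact {z : ℂ | ‖q‖ ≤ ‖z‖ ∧ ‖z‖ ≤ 1} := by
    refine (isCompact_closedBall (0 : ℂ) 1).of_isClosed_subset ?_ fun z hz => by simpa using hz.2
    exact (isClosed_le continuous_const continuous_norm).inter
      (isClosed_le continuous_norm continuous_const)
  have hq0' : 0 < ‖q‖ := norm_pos_iff.2 hq0
  obtain ⟨M, hM⟩ := hK.exists_bound_of_continuousOn (f := Q) fun z hz =>
    (hQ z (norm_pos_iff.1 (hq0'.trans_le hz.1))).continuousAt.continuousWithinAt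
  have hbd : ∀ z : ℂ, z ≠ 0 → ‖Q z‖ ≤ M := by
    intro z hz
    -- From |q|^{-n} ≤ |z| < |q|^{-(n+1)}, the factor q^{n+1} moves z into the compact annulus.
    obtain ⟨n, h1, h2⟩ := exists_mem_Ico_zpow (norm_pos_iff.2 hz) ((one_lt_inv₀ hq0').2 hq)
    rw [inv_zpow, inv_le_iff_one_le_mul₀ (zpow_pos hq0' n)] at h1
    rw [inv_zpow, lt_inv_comm₀ (norm_pos_iff.2 hz) (zpow_pos hq0' _)] at h2
    rw [← hperz (n + 1) z hz]
    have e : ‖q ^ (n + 1) * z‖ = ‖q‖ ^ (n + 1) * ‖z‖ := by rw [norm_mul, norm_zpow]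
    refine hM _ ⟨?_, ?_⟩
    · rw [e, zpow_add_one₀ hq0'.ne']
      nlinarith
    · rw [e]
      calc ‖q‖ ^ (n + 1) * ‖z‖ ≤ ‖z‖⁻¹ * ‖z‖ := by gcongr
        _ = 1 := inv_mul_cancel₀ (norm_ne_zero_iff.2 hz)
  -- In the logarithmic coordinate Q is a bounded entire function, so Liouville's theorem applies.
  have hent : Differentiable ℂ fun u => Q (exp u) := fun u =>
    (hQ _ (exp_ne_zero u)).comp u differentiable_exp.differentiableAt
  have := hent.apply_eq_apply_of_bounded
    (isBounded_iff_forall_norm_le.2 ⟨M, by rintro _ ⟨u, rfl⟩; exact hbd _ (exp_ne_zero u)⟩)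
    (log x) (log y)
  simpa [exp_log hx, exp_log hy] using this

theorem countable_theta_eq_zero (hq0 : q ≠ 0) (hq : ‖q‖ < 1) {c : ℂ} (hc : c ≠ 0) :
    {x : ℂ | theta (c * x) q = 0}.Countable := by
  refine ((countable_range fun n : ℤ => c⁻¹ * q ^ n).insert 0).mono fun x hx => ?_
  rcases eq_or_ne x 0 with rfl | hx0
  · exact mem_insert _ _
  · obtain ⟨n, hn⟩ := theta_eq_zero hq0 hq (mul_ne_zero hc hx0) hx
    refine Or.inr ⟨n, ?_⟩
    simp only [← hn]
    field_simp

/-- As a function of W, the difference D of the two sides satisfies D(qW) = D(W)/(ABW²), which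
allows only two zeros modulo q^ℤ unless D = 0. But D vanishes at z, 1/z and z/(AB), and the theta
hypotheses say that these are distinct modulo q^ℤ. Concretely, D divided by the theta functions
vanishing at 1/z and z/(AB) is q-periodic and holomorphic, hence constant, and it is 0 at z. -/
theorem theta_three_term (hq0 : q ≠ 0) (hq : ‖q‖ < 1) {A B z W : ℂ} (hA : A ≠ 0) (hB : B ≠ 0)
    (hz : z ≠ 0) (hW : W ≠ 0) (hAB : theta (A * B) q ≠ 0) (hzz : theta (z ^ 2) q ≠ 0)
    (hzAB : theta (z ^ 2 / (A * B)) q ≠ 0) :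
    theta (z ^ 2) q * theta (A * B) q * theta (A * W) q * theta (B * W) q =
      theta (A * z) q * theta (B * z) q * theta (W * z) q * theta (q * z / (A * B * W)) q -
      z ^ 2 * (theta (A * z⁻¹) q * theta (B * z⁻¹) q * theta (W * z⁻¹) q *
        theta (q * z⁻¹ / (A * B * W)) q) := by
  have hAB0 := mul_ne_zero hA hB
  have hdiv : ∀ y, theta (q / y) q = theta y q := theta_div hq0
  have hinv : ∀ y, y ≠ 0 → theta y⁻¹ q = -y⁻¹ * theta y q := fun y hy => theta_inv hq0 hq hy
  have hmul : ∀ y, y ≠ 0 → theta (q * y) q = -y⁻¹ * theta y q := fun y hy => theta_mul hq0 hq hy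
  have hd : ∀ c, c ≠ 0 → ∀ x, x ≠ 0 → DifferentiableAt ℂ (fun x => theta (c * x) q) x :=
    fun c hc x hx => (differentiableAt_theta hq (mul_ne_zero hc hx)).comp x
      (differentiableAt_id.const_mul c)
  set D : ℂ → ℂ := fun W => theta (z ^ 2) q * theta (A * B) q * theta (A * W) q * theta (B * W) q -
      theta (A * z) q * theta (B * z) q * theta (z * W) q * theta (A * B / z * W) q +
      z ^ 2 * (theta (A * z⁻¹) q * theta (B * z⁻¹) q * theta (z⁻¹ * W) q *
        theta (A * B * z * W) q) with hD
  have hz' := inv_ne_zero hz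
  have hABz : A * B / z ≠ 0 := div_ne_zero hAB0 hz
  have hABz' : A * B * z ≠ 0 := mul_ne_zero hAB0 hz
  have hDd : ∀ x, x ≠ 0 → DifferentiableAt ℂ D x := fun x hx =>
    ((((hd A hA x hx).const_mul _).mul (hd B hB x hx)).sub
      (((hd z hz x hx).const_mul _).mul (hd _ hABz x hx))).add
      ((((hd _ hz' x hx).const_mul _).mul (hd _ hABz' x hx)).const_mul _)
  have hDq : ∀ x, x ≠ 0 → D (q * x) = (A * B * x ^ 2)⁻¹ * D x := by
    intro x hx
    have e : ∀ c : ℂ, c ≠ 0 → theta (c * (q * x)) q = -(c * x)⁻¹ * theta (c * x) q := fun c hc => by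
      rw [mul_left_comm, hmul _ (mul_ne_zero hc hx)]
    simp only [hD]
    rw [e A hA, e B hB, e z hz, e _ hABz, e _ hz', e _ hABz']
    field_simp
  have hD0 : ∀ x, x ≠ 0 → D x = 0 → ∀ n : ℤ, D (q ^ n * x) = 0 := by
    intro x hx h0 n
    induction n using Int.induction_on with
    | zero => simpa using h0
    | succ n ih =>
      rw [add_comm, zpow_one_add₀ hq0, mul_assoc,
        hDq _ (mul_ne_zero (zpow_ne_zero _ hq0) hx), ih, mul_zero]
    | pred n ih =>
      have hne := mul_ne_zero (zpow_ne_zero (-(n : ℤ) - 1) hq0) hx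
      have := hDq _ hne
      rw [← mul_assoc, ← zpow_one_add₀ hq0, add_sub_cancel, ih] at this
      refine (mul_eq_zero.1 this.symm).resolve_left ?_
      exact inv_ne_zero (mul_ne_zero hAB0 (pow_ne_zero 2 hne))
  have hDz : D z = 0 := by
    simp only [hD]
    rw [inv_mul_cancel₀ hz, theta_one, div_mul_cancel₀ _ hz, ← pow_two]
    ring
  have hDz' : D z⁻¹ = 0 := by
    simp only [hD]
    rw [mul_inv_cancel₀ hz, theta_one, show z⁻¹ * z⁻¹ = (z ^ 2)⁻¹ by rw [pow_two, mul_inv],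
      hinv _ (pow_ne_zero 2 hz), mul_inv_cancel_right₀ hz]
    field_simp
    ring
  have hDz2 : D (z / (A * B)) = 0 := by
    simp only [hD]
    rw [show A * B / z * (z / (A * B)) = 1 by field_simp, theta_one,
      show z⁻¹ * (z / (A * B)) = (A * B)⁻¹ by field_simp, hinv _ hAB0,
      show A * B * z * (z / (A * B)) = z ^ 2 by field_simp,
      show A * (z / (A * B)) = (B * z⁻¹)⁻¹ by field_simp,
      show B * (z / (A * B)) = (A * z⁻¹)⁻¹ by field_simp,
      hinv _ (mul_ne_zero hA hz'), hinv _ (mul_ne_zero hB hz')]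
    field_simp
    ring
  obtain ⟨Q₁, hQ₁, hDQ₁⟩ := exists_eq_theta_mul hq0 hq hz hDd fun n => hD0 _ hz' hDz' n
  obtain ⟨Q₂, hQ₂, hQ₁₂⟩ := exists_eq_theta_mul hq0 hq hABz hQ₁ fun n => by
    have hne : q ^ n * (A * B / z)⁻¹ ≠ 0 := mul_ne_zero (zpow_ne_zero _ hq0) (inv_ne_zero hABz)
    have h1 := hDQ₁ _ hne
    have h2 := hD0 _ (div_ne_zero hz hAB0) hDz2 n
    rw [inv_div, h2] at h1
    rw [inv_div]
    -- If the first divisor θ(zx) vanished here too, then z²/(AB) would lie in q^ℤ.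
    refine (mul_eq_zero.1 h1.symm).resolve_left fun h3 => hzAB ?_
    obtain ⟨m, hm⟩ := theta_eq_zero hq0 hq (by rw [inv_div] at hne; exact mul_ne_zero hz hne) h3
    rw [show z ^ 2 / (A * B) = q ^ (m - n) by
      rw [zpow_sub₀ hq0, ← hm]
      have := zpow_ne_zero n hq0
      field_simp]
    exact (theta_zpow hq0 hq _).1
  have hDN : ∀ x, x ≠ 0 → D x = theta (z * x) q * theta (A * B / z * x) q * Q₂ x := fun x hx => by
    rw [hDQ₁ x hx, hQ₁₂ x hx, mul_assoc]
  have hper : ∀ x, x ≠ 0 → Q₂ (q * x) = Q₂ x := by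
    intro x hx
    refine eq_of_eq_off_countable (f := fun x => Q₂ (q * x))
      ((hQ₂ _ (mul_ne_zero hq0 hx)).continuousAt.comp (f := fun x => q * x)
        (continuous_const_mul q).continuousAt)
      (hQ₂ x hx).continuousAt
      ((countable_theta_eq_zero hq0 hq hz).union (countable_theta_eq_zero hq0 hq hABz)) ?_
    filter_upwards [isOpen_ne.mem_nhds hx] with y hy hyE
    simp only [mem_union, mem_ofPred_eq, not_or] at hyE
    have h1 := hDq y hy
    rw [hDN _ (mul_ne_zero hq0 hy), hDN _ hy, mul_left_comm, hmul _ (mul_ne_zero hz hy),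
      mul_left_comm, hmul _ (mul_ne_zero hABz hy)] at h1
    have hN := mul_ne_zero hyE.1 hyE.2
    have hc : (A * B * y ^ 2)⁻¹ ≠ 0 := inv_ne_zero (mul_ne_zero hAB0 (pow_ne_zero 2 hy))
    refine mul_left_cancel₀ hc (mul_left_cancel₀ hN ?_)
    have e : (A * B * y ^ 2)⁻¹ = (z * y)⁻¹ * (A * B / z * y)⁻¹ := by field_simp
    linear_combination h1 + theta (z * y) q * theta (A * B / z * y) q * Q₂ (q * y) * e
  have hQz : Q₂ z = 0 := by
    have h1 := hDN z hz
    rw [hDz, div_mul_cancel₀ _ hz, ← pow_two] at h1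
    exact (mul_eq_zero.1 h1.symm).resolve_left (mul_ne_zero hzz hAB)
  have hfin : D W = 0 := by
    rw [hDN W hW, eq_of_periodic hq0 hq hQ₂ hper hW hz, hQz, mul_zero]
  rw [← hdiv (q * z / (A * B * W)), ← hdiv (q * z⁻¹ / (A * B * W)),
    show q / (q * z / (A * B * W)) = A * B / z * W by field_simp,
    show q / (q * z⁻¹ / (A * B * W)) = A * B * z * W by field_simp, mul_comm W z, mul_comm W z⁻¹]
  simp only [hD] at hfin
  linear_combination hfin

end

section

/-! ### The lattice of zeros and poles -/

/-- The multiplicative lattice `p^ℤ q^ℤ`, together with `0`. -/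
def nomeLattice (p q : ℂ) : Set ℂ := insert 0 (range fun n : ℤ × ℤ => p ^ n.1 * q ^ n.2)

variable {p q x : ℂ}

theorem countable_nomeLattice (p q : ℂ) : (nomeLattice p q).Countable :=
  (countable_range _).insert 0

theorem ne_zero_of_notMem_nomeLattice (h : x ∉ nomeLattice p q) : x ≠ 0 :=
  fun h0 => h (Or.inl h0)

theorem inv_mem_nomeLattice : x⁻¹ ∈ nomeLattice p q ↔ x ∈ nomeLattice p q := by
  have : ∀ x, x ∈ nomeLattice p q → x⁻¹ ∈ nomeLattice p q := by
    rintro x (rfl | ⟨n, rfl⟩)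
    · exact Or.inl inv_zero
    · exact Or.inr ⟨-n, by simp [mul_comm]⟩
  exact ⟨fun h => inv_inv x ▸ this _ h, this x⟩

theorem div_pow_mem_nomeLattice (hq0 : q ≠ 0) (k : ℕ) :
    x / q ^ k ∈ nomeLattice p q ↔ x ∈ nomeLattice p q := by
  have hk := pow_ne_zero k hq0
  constructor
  · rintro (h | ⟨n, h⟩)
    · exact Or.inl ((div_eq_zero_iff.1 h).resolve_right hk)
    · refine Or.inr ⟨(n.1, n.2 + k), ?_⟩
      simp only [zpow_add₀ hq0, zpow_natCast, ← mul_assoc] at h ⊢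
      rw [h]
      field_simp
  · rintro (rfl | ⟨n, rfl⟩)
    · exact Or.inl (zero_div _)
    · refine Or.inr ⟨(n.1, n.2 - k), ?_⟩
      simp only [zpow_sub₀ hq0, zpow_natCast]
      field_simp

theorem pqPoch_ne_zero (hp : ‖p‖ < 1) (hq : ‖q‖ < 1) (h : x ∉ nomeLattice p q) :
    pqPoch x p q ≠ 0 := by
  intro h0
  obtain ⟨i, j, hij⟩ := pqPoch_eq_zero hp hq h0
  refine h (inv_mem_nomeLattice.1 (Or.inr ⟨(i, j), ?_⟩))
  simp only [zpow_natCast]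
  rw [mul_assoc] at hij
  exact eq_inv_of_mul_eq_one_right hij

theorem theta_ne_zero_left (hp0 : p ≠ 0) (hp : ‖p‖ < 1) (h : x ∉ nomeLattice p q) :
    theta x p ≠ 0 := by
  intro h0
  obtain ⟨n, hn⟩ := theta_eq_zero hp0 hp (ne_zero_of_notMem_nomeLattice h) h0
  exact h (Or.inr ⟨(n, 0), by simp [hn]⟩)

theorem theta_ne_zero_right (hq0 : q ≠ 0) (hq : ‖q‖ < 1) (h : x ∉ nomeLattice p q) :
    theta x q ≠ 0 := by
  intro h0
  obtain ⟨n, hn⟩ := theta_eq_zero hq0 hq (ne_zero_of_notMem_nomeLattice h) h0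
  exact h (Or.inr ⟨(0, n), by simp [hn]⟩)

/-! ### Shifting the arguments of theta and gamma functions -/

/-- By θ(p/x) = θ(x), the factor that clears poles of f is exactly the quotient of Γ(T/z) by Γ(T
q^{-m}/z) in `ellGamma_eq_prod_theta`. -/
theorem thetaFin_div (hp0 : p ≠ 0) (hq0 : q ≠ 0) {T z : ℂ} (hT : T ≠ 0) (hz : z ≠ 0) (m : ℕ) :
    thetaFin (p * q * z / T) q p m = ∏ k ∈ Finset.range m, theta (T * z⁻¹ / q ^ (k + 1)) p := by
  refine Finset.prod_congr rfl fun k _ => ?_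
  rw [← theta_div hp0 (T * z⁻¹ / q ^ (k + 1))]
  congr 1
  rw [pow_succ']
  field_simp

theorem ellGamma_eq_prod_theta (hp : ‖p‖ < 1) (hq0 : q ≠ 0) (hq : ‖q‖ < 1) (m : ℕ)
    (h : pqPoch (x / q ^ m) p q ≠ 0) : ellGamma x p q =
      (∏ k ∈ Finset.range m, theta (x / q ^ (k + 1)) p) * ellGamma (x / q ^ m) p q := by
  induction m with
  | zero => simp
  | succ m ih =>
    have e : x / q ^ m = q * (x / q ^ (m + 1)) := by
      rw [pow_succ]
      field_simp
    have h' : pqPoch (x / q ^ m) p q ≠ 0 := by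
      rw [e]
      exact right_ne_zero_of_mul (pqPoch_eq_mul' hp hq _ ▸ h)
    rw [ih h', e, ellGamma_mul_right hp hq hq0 h, Finset.prod_range_succ, mul_assoc]

/-- A shift of the argument of θ by p costs only a monomial, so Γ(pTz) absorbs the poles of f as
well as Γ(Tz) does. -/
theorem exists_prod_theta_mul (hp0 : p ≠ 0) (hp : ‖p‖ < 1) (hq0 : q ≠ 0) {ε : ℂ}
    (hε : ε = 1 ∨ ε = p) (m : ℕ) : ∃ M : ℂ → ℂ, (∀ x, x ≠ 0 → DifferentiableAt ℂ M x) ∧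
      ∀ x, x ≠ 0 → ∏ k ∈ Finset.range m, theta (ε * x / q ^ (k + 1)) p =
        M x * ∏ k ∈ Finset.range m, theta (x / q ^ (k + 1)) p := by
  rcases hε with rfl | rfl
  · exact ⟨fun _ => 1, fun x _ => differentiableAt_const _, fun x _ => by simp⟩
  · have hne : ∀ (k : ℕ) {x : ℂ}, x ≠ 0 → x / q ^ (k + 1) ≠ 0 := fun k x hx =>
      div_ne_zero hx (pow_ne_zero _ hq0)
    refine ⟨fun x => ∏ k ∈ Finset.range m, -(x / q ^ (k + 1))⁻¹, fun x hx => ?_, fun x hx => ?_⟩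
    · refine DifferentiableAt.fun_finsetProd fun k _ => ?_
      have h : DifferentiableAt ℂ (fun x => x / q ^ (k + 1)) x := differentiableAt_id.div_const _
      exact (h.fun_inv (hne k hx)).fun_neg
    · rw [← Finset.prod_mul_distrib]
      refine Finset.prod_congr rfl fun k _ => ?_
      rw [mul_div_assoc, theta_mul hp0 hp (hne k hx)]

theorem differentiableAt_ellGamma (hp : ‖p‖ < 1) (hq : ‖q‖ < 1) (hx : x ≠ 0)
    (h : pqPoch x p q ≠ 0) : DifferentiableAt ℂ (fun x => ellGamma x p q) x :=
  ((differentiable_pqPoch hp hq _).comp x ((differentiableAt_const (p * q)).div differentiableAt_id hx)).div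
    (differentiable_pqPoch hp hq x) h

/-! ### The regularised integrand at the elliptic level -/

/-- The number of steps by which the parameter with index `r` is shifted. -/
def shiftOrder (mf mg : ℕ) (r : Fin 6) : ℕ := if r = 4 then mf else if r = 5 then mg else 0

theorem shifted_eq (q : ℂ) (mf mg : ℕ) (T : Fin 6 → ℂ) (r : Fin 6) :
    shifted q mf mg T r = T r / q ^ shiftOrder mf mg r := by
  unfold shifted shiftOrder
  split_ifs with h4 h5
  · rw [h4]
  · rw [h5]
  · simp

/-- The domain on which the regularised integrand is holomorphic. -/
def regularDomain (τ ε : Fin 6 → ℂ) (p q : ℂ) : Set ℂ :=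
  {z | z ≠ 0 ∧ ∀ r, pqPoch (ε r * τ r * z) p q ≠ 0 ∧ pqPoch (τ r * z⁻¹) p q ≠ 0}

/-- The weight obtained from the integrand by breaking the symmetry `z ↦ 1/z`. -/
def brokenWeight (T ε : Fin 6 → ℂ) (p q : ℂ) (a b : Fin 6) (W z : ℂ) : ℂ :=
  (∏ r, ellGamma (ε r * T r * z) p q * ellGamma (T r * z⁻¹) p q) * theta ((z ^ 2)⁻¹) p *
    (theta (W * z) q * theta (q * z / (T a * T b * W)) q)

theorem isOpen_regularDomain (hp : ‖p‖ < 1) (hq : ‖q‖ < 1) (τ ε : Fin 6 → ℂ) :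
    IsOpen (regularDomain τ ε p q) := by
  rw [isOpen_iff_mem_nhds]
  rintro z ⟨hz, h⟩
  have hc := (differentiable_pqPoch hp hq).continuous
  have h1 : ∀ r, ∀ᶠ y in 𝓝 z, pqPoch (ε r * τ r * y) p q ≠ 0 := fun r =>
    (hc.comp (continuous_const_mul (ε r * τ r))).continuousAt.eventually_ne (h r).1
  have h2 : ∀ r, ∀ᶠ y in 𝓝 z, pqPoch (τ r * y⁻¹) p q ≠ 0 := fun r =>
    (ContinuousAt.comp (f := fun y => τ r * y⁻¹) hc.continuousAt
      (continuousAt_const.mul (continuousAt_inv₀ hz))).eventually_ne (h r).2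
  filter_upwards [isOpen_ne.mem_nhds hz, eventually_all.2 h1, eventually_all.2 h2] with y h0 h1 h2
  exact ⟨h0, fun r => ⟨h1 r, h2 r⟩⟩

/-- The theta factors that clear the poles of f and g are split off from the gamma functions with
indices 4 and 5; this shifts the parameters, and the rest is holomorphic. The identity with the
actual integrand is restricted to arguments off the lattice, since f and g may have arbitrary values
at removable singularities. -/
theorem exists_regular (hp0 : p ≠ 0) (hp : ‖p‖ < 1) (hq0 : q ≠ 0) (hq : ‖q‖ < 1)
    {T ε : Fin 6 → ℂ} (hT : ∀ r, T r ≠ 0) (hε : ∀ r, ε r = 1 ∨ ε r = p) {f g : ℂ → ℂ} {mf mg : ℕ}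
    (hf : InA (T 4) p q mf f) (hg : InA (T 5) p q mg g) (a b : Fin 6) {W : ℂ} (hW : W ≠ 0) :
    ∃ Ψ : ℂ → ℂ, DifferentiableOn ℂ Ψ (regularDomain (shifted q mf mg T) ε p q) ∧
      ∀ z ∈ regularDomain (shifted q mf mg T) ε p q, (∀ r, T r * z ∉ nomeLattice p q) →
        (∀ r, T r * z⁻¹ ∉ nomeLattice p q) →
        Ψ z = f z * g z * brokenWeight T ε p q a b W z := by
  obtain ⟨hF, hFd, hFe⟩ := hf.holomorphic
  obtain ⟨hG, hGd, hGe⟩ := hg.holomorphic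
  choose M hMd hMe using fun r => exists_prod_theta_mul hp0 hp hq0 (hε r) (shiftOrder mf mg r)
  have hε0 : ∀ r, ε r ≠ 0 := fun r => by rcases hε r with h | h <;> simp [h, hp0]
  have hτ0 : ∀ r, shifted q mf mg T r ≠ 0 := fun r => by
    rw [shifted_eq]; exact div_ne_zero (hT r) (pow_ne_zero _ hq0)
  set τ := shifted q mf mg T with hτ
  refine ⟨fun z => hF z * hG z * (∏ r, M r (T r * z) * (ellGamma (ε r * τ r * z) p q *
      ellGamma (τ r * z⁻¹) p q)) * theta ((z ^ 2)⁻¹) p *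
    (theta (W * z) q * theta (q * z / (T a * T b * W)) q), fun z hz => ?_, fun z hz hz1 hz2 => ?_⟩
  · obtain ⟨hz0, hz⟩ := hz
    have hopen : IsOpen ({0}ᶜ : Set ℂ) := isOpen_compl_singleton
    refine DifferentiableAt.differentiableWithinAt ?_
    have d1 := hFd.differentiableAt (hopen.mem_nhds hz0)
    have d2 := hGd.differentiableAt (hopen.mem_nhds hz0)
    have d3 : DifferentiableAt ℂ (fun z => ∏ r, M r (T r * z) * (ellGamma (ε r * τ r * z) p q *
        ellGamma (τ r * z⁻¹) p q)) z := by
      refine DifferentiableAt.fun_finsetProd fun r _ => ?_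
      refine DifferentiableAt.mul ?_ (DifferentiableAt.mul ?_ ?_)
      · exact (hMd r _ (mul_ne_zero (hT r) hz0)).comp z (differentiableAt_id.const_mul _)
      · exact (differentiableAt_ellGamma hp hq (mul_ne_zero (mul_ne_zero (hε0 r) (hτ0 r)) hz0)
          (hz r).1).comp z (differentiableAt_id.const_mul _)
      · exact (differentiableAt_ellGamma hp hq (mul_ne_zero (hτ0 r) (inv_ne_zero hz0))
          (hz r).2).comp z ((differentiableAt_inv hz0).const_mul _)
    have d0 : DifferentiableAt ℂ (fun z : ℂ => z ^ 2) z := differentiableAt_id.pow 2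
    have d4 : DifferentiableAt ℂ (fun z => theta ((z ^ 2)⁻¹) p) z :=
      DifferentiableAt.comp (g := fun x => theta x p) z
        (differentiableAt_theta hp (inv_ne_zero (pow_ne_zero 2 hz0))) (d0.fun_inv (pow_ne_zero 2 hz0))
    have d5 : DifferentiableAt ℂ (fun z => theta (W * z) q) z :=
      (differentiableAt_theta hq (mul_ne_zero hW hz0)).comp z (differentiableAt_id.const_mul _)
    have d6 : DifferentiableAt ℂ (fun z => theta (q * z / (T a * T b * W)) q) z :=
      DifferentiableAt.comp (g := fun x => theta x q) (f := fun z => q * z / (T a * T b * W)) z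
        (differentiableAt_theta hq (div_ne_zero (mul_ne_zero hq0 hz0)
        (mul_ne_zero (mul_ne_zero (hT a) (hT b)) hW))) ((differentiableAt_id.const_mul _).div_const _)
    exact (((d1.mul d2).mul d3).mul d4).mul (d5.mul d6)
  · obtain ⟨hz0, hz⟩ := hz
    have hΘ : ∀ (r : Fin 6) (m : ℕ), thetaFin (p * q * z / T r) q p m *
        thetaFin (p * q * z⁻¹ / T r) q p m ≠ 0 := fun r m => by
      rw [thetaFin_div hp0 hq0 (hT r) hz0, thetaFin_div hp0 hq0 (hT r) (inv_ne_zero hz0), inv_inv]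
      refine mul_ne_zero (Finset.prod_ne_zero_iff.2 fun k _ => ?_)
        (Finset.prod_ne_zero_iff.2 fun k _ => ?_)
      · exact theta_ne_zero_left hp0 hp ((div_pow_mem_nomeLattice hq0 _).not.2 (hz2 r))
      · exact theta_ne_zero_left hp0 hp ((div_pow_mem_nomeLattice hq0 _).not.2 (hz1 r))
    have hkey : ∀ r, ellGamma (ε r * T r * z) p q * ellGamma (T r * z⁻¹) p q =
        (thetaFin (p * q * z / T r) q p (shiftOrder mf mg r) *
          thetaFin (p * q * z⁻¹ / T r) q p (shiftOrder mf mg r)) *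
        (M r (T r * z) * (ellGamma (ε r * τ r * z) p q * ellGamma (τ r * z⁻¹) p q)) := by
      intro r
      have e1 : ε r * τ r * z = ε r * (T r * z) / q ^ shiftOrder mf mg r := by
        rw [hτ, shifted_eq]; ring
      have e2 : τ r * z⁻¹ = T r * z⁻¹ / q ^ shiftOrder mf mg r := by
        rw [hτ, shifted_eq]; ring
      rw [thetaFin_div hp0 hq0 (hT r) hz0, thetaFin_div hp0 hq0 (hT r) (inv_ne_zero hz0), inv_inv,
        mul_assoc (ε r), ellGamma_eq_prod_theta hp hq0 hq (x := ε r * (T r * z))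
          (shiftOrder mf mg r) (e1 ▸ (hz r).1),
        ellGamma_eq_prod_theta hp hq0 hq (x := T r * z⁻¹) (shiftOrder mf mg r) (e2 ▸ (hz r).2),
        ← e1, ← e2, hMe r _ (mul_ne_zero (hT r) hz0)]
      ring
    have hprod : (∏ r, thetaFin (p * q * z / T r) q p (shiftOrder mf mg r) *
          thetaFin (p * q * z⁻¹ / T r) q p (shiftOrder mf mg r)) =
        (thetaFin (p * q * z / T 4) q p mf * thetaFin (p * q * z⁻¹ / T 4) q p mf) *
        (thetaFin (p * q * z / T 5) q p mg * thetaFin (p * q * z⁻¹ / T 5) q p mg) := by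
      simp [Fin.prod_univ_six, shiftOrder, thetaFin, show (0 : Fin 6) ≠ 4 by decide,
        show (0 : Fin 6) ≠ 5 by decide, show (1 : Fin 6) ≠ 4 by decide,
        show (1 : Fin 6) ≠ 5 by decide, show (2 : Fin 6) ≠ 4 by decide,
        show (2 : Fin 6) ≠ 5 by decide, show (3 : Fin 6) ≠ 4 by decide,
        show (3 : Fin 6) ≠ 5 by decide, show (5 : Fin 6) ≠ 4 by decide]
    rw [brokenWeight, Finset.prod_congr rfl fun r _ => hkey r, Finset.prod_mul_distrib, hprod]
    simp only []
    rw [hFe z hz0 (hΘ 4 mf), hGe z hz0 (hΘ 5 mg)]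
    ring

end

section

/-! ### Symmetrisation of the elliptic integral -/

/-- The winding number is constant near 0, where the inner points accumulate. -/
theorem Chain.Separates.winding_zero {C : Chain} {Inn Out : Set ℂ} (h : C.Separates Inn Out)
    (hacc : ∀ ε > 0, ∃ x ∈ Inn, ‖x‖ < ε) : C.winding 0 = 1 := by
  obtain ⟨δ, hδ, hb⟩ := Chain.exists_ball_winding_eq h.zero_notMem
  obtain ⟨x, hx, hxδ⟩ := hacc δ hδ
  rw [← h.winding_inner x hx, (hb x (by simpa using hxδ)).2]

theorem Chain.Separates.disjoint {C : Chain} {Inn Out : Set ℂ} (h : C.Separates Inn Out) :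
    Disjoint Inn Out :=
  disjoint_left.2 fun x hi ho => by
    have := h.winding_inner x hi
    rw [h.winding_outer x ho] at this
    exact zero_ne_one this

variable {p q : ℂ} {τ ε : Fin 6 → ℂ}

theorem tendsto_pow_mul_pow (hp : ‖p‖ < 1) (hq : ‖q‖ < 1) (c : ℂ) :
    Tendsto (fun k : ℕ × ℕ => p ^ k.1 * q ^ k.2 * c) cofinite (𝓝 0) := by
  have h := (summable_geometric_prod (norm_nonneg p) hp (norm_nonneg q) hq ‖c‖).tendsto_cofinite_zero
  refine squeeze_zero_norm (fun k => le_of_eq ?_) h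
  rw [norm_mul, norm_mul, norm_pow, norm_pow, mul_comm]

theorem finite_ellInner (hp : ‖p‖ < 1) (hq : ‖q‖ < 1) (τ : Fin 6 → ℂ) {d : ℝ} (hd : 0 < d) :
    {x ∈ ellInner τ p q | d ≤ ‖x‖}.Finite := by
  have h : ∀ r, {k : ℕ × ℕ | d ≤ ‖p ^ k.1 * q ^ k.2 * τ r‖}.Finite := fun r => by
    have := (tendsto_pow_mul_pow hp hq (τ r)).norm.eventually (gt_mem_nhds (by simpa using hd))
    simpa [Filter.Eventually, mem_cofinite, compl_ofPred] using this
  refine (finite_iUnion fun r => (h r).image fun k => p ^ k.1 * q ^ k.2 * τ r).subset ?_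
  rintro _ ⟨⟨r, i, j, rfl⟩, hx⟩
  exact mem_iUnion.2 ⟨r, (i, j), hx, rfl⟩

theorem mem_ellOuter_iff {x : ℂ} : x ∈ ellOuter τ p q ↔ x⁻¹ ∈ ellInner τ p q := by
  constructor
  · rintro ⟨r, i, j, rfl⟩
    exact ⟨r, i, j, inv_inv _⟩
  · rintro ⟨r, i, j, h⟩
    exact ⟨r, i, j, by rw [← h, inv_inv]⟩

theorem zero_notMem_ellInner (hp0 : p ≠ 0) (hq0 : q ≠ 0) (hτ : ∀ r, τ r ≠ 0) :
    (0 : ℂ) ∉ ellInner τ p q := by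
  rintro ⟨r, i, j, h⟩
  exact mul_ne_zero (mul_ne_zero (pow_ne_zero i hp0) (pow_ne_zero j hq0)) (hτ r) h.symm

theorem finite_ellOuter (hp0 : p ≠ 0) (hp : ‖p‖ < 1) (hq0 : q ≠ 0) (hq : ‖q‖ < 1)
    (hτ : ∀ r, τ r ≠ 0) (R : ℝ) : {x ∈ ellOuter τ p q | ‖x‖ ≤ R}.Finite := by
  have hR : 0 < (max R 1)⁻¹ := by positivity
  refine ((finite_ellInner hp hq τ hR).image fun x => x⁻¹).subset ?_
  rintro x ⟨hx, hxR⟩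
  rw [mem_ellOuter_iff] at hx
  refine ⟨x⁻¹, ⟨hx, ?_⟩, inv_inv x⟩
  have hx0 : x ≠ 0 := by
    rintro rfl
    rw [inv_zero] at hx
    exact zero_notMem_ellInner hp0 hq0 hτ hx
  rw [norm_inv]
  exact inv_anti₀ (norm_pos_iff.2 hx0) (hxR.trans (le_max_left _ _))

theorem exists_ellInner_norm_lt (hq : ‖q‖ < 1) (τ : Fin 6 → ℂ) :
    ∀ d > 0, ∃ x ∈ ellInner τ p q, ‖x‖ < d := by
  intro d hd
  have h : Tendsto (fun j : ℕ => q ^ j * τ 0) atTop (𝓝 0) := by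
    simpa using (tendsto_pow_atTop_nhds_zero_of_norm_lt_one hq).mul_const (τ 0)
  obtain ⟨j, hj⟩ := (h.norm.eventually (gt_mem_nhds (by simpa using hd))).exists
  exact ⟨_, ⟨0, 0, j, by rw [pow_zero, one_mul]⟩, hj⟩

theorem exists_separates_ell (hp0 : p ≠ 0) (hp : ‖p‖ < 1) (hq0 : q ≠ 0) (hq : ‖q‖ < 1)
    (hτ : ∀ r, τ r ≠ 0) (hdis : Disjoint (ellInner τ p q) (ellOuter τ p q)) :
    ∃ C : Chain, C.Separates (ellInner τ p q) (ellOuter τ p q) ∧ ∀ i s, C.loop i s ≠ 0 := by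
  refine Chain.exists_separates hdis (zero_notMem_ellInner hp0 hq0 hτ) ?_
    (fun d hd => finite_ellInner hp hq τ hd) (finite_ellOuter hp0 hp hq0 hq hτ)
  rw [mem_ellOuter_iff, inv_zero]
  exact zero_notMem_ellInner hp0 hq0 hτ

/-- Inversion exchanges inner and outer points, and, as C winds once around 0, winding number n at
1/x becomes 1 − n at x. -/
theorem Chain.Separates.inversion {C : Chain} (hp0 : p ≠ 0) (hq0 : q ≠ 0) (hq : ‖q‖ < 1)
    (hτ : ∀ r, τ r ≠ 0) (h : C.Separates (ellInner τ p q) (ellOuter τ p q))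
    (hl : ∀ i s, C.loop i s ≠ 0) :
    (C.inversion hl).Separates (ellInner τ p q) (ellOuter τ p q) := by
  have h0 := h.winding_zero (exists_ellInner_norm_lt hq τ)
  have hsupp : ∀ x, x ∈ (C.inversion hl).support → x⁻¹ ∈ C.support := by
    intro x hx
    rw [Chain.support_inversion] at hx
    obtain ⟨y, hy, rfl⟩ := hx
    rwa [inv_inv]
  have hI : ∀ x ∈ ellInner τ p q, x ≠ 0 ∧ x⁻¹ ∉ C.support ∧ C.winding x⁻¹ = 0 := fun x hx => by
    have hx' : x⁻¹ ∈ ellOuter τ p q := by rwa [mem_ellOuter_iff, inv_inv]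
    exact ⟨fun h => zero_notMem_ellInner hp0 hq0 hτ (h ▸ hx),
      disjoint_right.1 h.disjoint_outer hx', h.winding_outer _ hx'⟩
  have hO : ∀ x ∈ ellOuter τ p q, x ≠ 0 ∧ x⁻¹ ∉ C.support ∧ C.winding x⁻¹ = 1 := fun x hx => by
    have hx' := mem_ellOuter_iff.1 hx
    exact ⟨fun h => zero_notMem_ellInner hp0 hq0 hτ (inv_zero (G₀ := ℂ) ▸ h ▸ hx'),
      disjoint_right.1 h.disjoint_inner hx', h.winding_inner _ hx'⟩
  refine ⟨fun hx => ?_, ?_, ?_, fun x hx => ?_, fun x hx => ?_⟩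
  · have := hsupp 0 hx
    rw [inv_zero] at this
    exact h.zero_notMem this
  · exact disjoint_right.2 fun x hx hs => (hI x hx).2.1 (hsupp x hs)
  · exact disjoint_right.2 fun x hx hs => (hO x hx).2.1 (hsupp x hs)
  · rw [C.winding_inversion hl h.zero_notMem (hI x hx).1 (hI x hx).2.1, h0, (hI x hx).2.2, sub_zero]
  · rw [C.winding_inversion hl h.zero_notMem (hO x hx).1 (hO x hx).2.1, h0, (hO x hx).2.2, sub_self]

theorem notMem_regularDomain (hp : ‖p‖ < 1) (hq : ‖q‖ < 1) (hε : ∀ r, ε r = 1 ∨ ε r = p) {z : ℂ}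
    (hz : z ∉ regularDomain τ ε p q) : z = 0 ∨ z ∈ ellInner τ p q ∨ z ∈ ellOuter τ p q := by
  by_contra! hcon
  obtain ⟨h0, hi, ho⟩ := hcon
  refine hz ⟨h0, fun r => ⟨fun h => ?_, fun h => ?_⟩⟩
  · obtain ⟨i, j, hij⟩ := pqPoch_eq_zero hp hq h
    refine ho (mem_ellOuter_iff.2 ?_)
    rcases hε r with hr | hr
    · refine ⟨r, i, j, inv_eq_of_mul_eq_one_right ?_⟩
      rw [← hij, hr]
      ring
    · refine ⟨r, i + 1, j, inv_eq_of_mul_eq_one_right ?_⟩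
      rw [← hij, hr]
      ring
  · obtain ⟨i, j, hij⟩ := pqPoch_eq_zero hp hq h
    refine hi ⟨r, i, j, ?_⟩
    field_simp at hij
    rw [← hij]
    ring

/-- By Γ(pTz) = θ(Tz;q) Γ(Tz) for T = T_a, T_b, the broken weight is the symmetric gamma product
times θ(z⁻²;p) and the first term on the right of the three-term relation. -/
theorem mul_brokenWeight (hp0 : p ≠ 0) (hp : ‖p‖ < 1) (hq : ‖q‖ < 1) {T : Fin 6 → ℂ}
    {a b : Fin 6} (hab : a ≠ b) (hε : ∀ r, ε r = if r = a ∨ r = b then p else 1) {W z : ℂ}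
    (h : ∀ r, T r * z ∉ nomeLattice p q) :
    brokenWeight T ε p q a b W z = (∏ r, ellGamma (T r * z) p q * ellGamma (T r * z⁻¹) p q) *
      theta ((z ^ 2)⁻¹) p * (theta (T a * z) q * theta (T b * z) q * theta (W * z) q *
        theta (q * z / (T a * T b * W)) q) := by
  have e : ∀ r, ellGamma (ε r * T r * z) p q * ellGamma (T r * z⁻¹) p q =
      ((if r = a then theta (T a * z) q else 1) * (if r = b then theta (T b * z) q else 1)) *
      (ellGamma (T r * z) p q * ellGamma (T r * z⁻¹) p q) := by
    intro r
    rw [hε, mul_assoc (ite _ _ _)]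
    have hr := pqPoch_ne_zero hp hq (h r)
    by_cases ha : r = a
    · have hb : r ≠ b := fun h => hab (ha.symm.trans h)
      simp only [ha, true_or, if_true, hab, if_false] at hr ⊢
      rw [ellGamma_mul_left hp hq hp0 hr]
      ring
    · by_cases hb : r = b
      · simp only [hb, or_true, if_true, hab.symm, if_false] at hr ⊢
        rw [ellGamma_mul_left hp hq hp0 hr]
        ring
      · simp [ha, hb]
  rw [brokenWeight, Finset.prod_congr rfl fun r _ => e r, Finset.prod_mul_distrib,
    Finset.prod_mul_distrib]
  simp only [Finset.prod_ite_eq', Finset.mem_univ, if_true]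
  ring

theorem countable_setOf_sq_mem {E : Set ℂ} (hE : E.Countable) (c : ℂ) (hc : c ≠ 0) :
    {z : ℂ | z ^ 2 / c ∈ E}.Countable := by
  have : {z : ℂ | z ^ 2 / c ∈ E} ⊆ ⋃ e ∈ E, {z | z ^ 2 / c = e} := fun z hz => by
    exact mem_biUnion hz rfl
  refine (hE.biUnion fun e _ => ?_).mono this
  by_cases h : ∃ w : ℂ, w ^ 2 / c = e
  · obtain ⟨w, hw⟩ := h
    refine ((countable_singleton (-w)).insert w).mono fun z hz => ?_
    have hz : z ^ 2 / c = e := hz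
    rw [← hw, div_left_inj' hc] at hz
    exact sq_eq_sq_iff_eq_or_eq_neg.1 hz
  · exact (countable_empty).mono fun z hz => h ⟨z, hz⟩

/-- Off a countable set the integrand is c⁻¹ (A(z) + A'(z)), where integrating A' over a contour
amounts to integrating A over the inverted contour. The latter again separates the same points, so
both terms give the same integral. The chain D has to match C only around the singularities of A,
which are fewer than those of the full integrand. -/
theorem integral_eq_broken (hp0 : p ≠ 0) (hp : ‖p‖ < 1) (hq0 : q ≠ 0) (hq : ‖q‖ < 1)
    {T : Fin 6 → ℂ} (hT : ∀ r, T r ≠ 0) {a b : Fin 6} (hab : a ≠ b)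
    (hε : ∀ r, ε r = if r = a ∨ r = b then p else 1) {f g : ℂ → ℂ} {mf mg : ℕ}
    (hf : ∀ z, z ≠ 0 → f z⁻¹ = f z) (hg : ∀ z, z ≠ 0 → g z⁻¹ = g z) {W : ℂ} (hW : W ≠ 0)
    (hab0 : theta (T a * T b) q ≠ 0) (haW : theta (T a * W) q ≠ 0) (hbW : theta (T b * W) q ≠ 0)
    {Ψ : ℂ → ℂ} (hΨ : DifferentiableOn ℂ Ψ (regularDomain (shifted q mf mg T) ε p q))
    (hΨe : ∀ z ∈ regularDomain (shifted q mf mg T) ε p q, (∀ r, T r * z ∉ nomeLattice p q) →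
        (∀ r, T r * z⁻¹ ∉ nomeLattice p q) → Ψ z = f z * g z * brokenWeight T ε p q a b W z)
    {C D : Chain} (hC : C.Separates (ellInner (shifted q mf mg T) p q)
      (ellOuter (shifted q mf mg T) p q))
    (hD : D.support ⊆ regularDomain (shifted q mf mg T) ε p q)
    (hDw : ∀ x ∉ regularDomain (shifted q mf mg T) ε p q, D.winding x = C.winding x) :
    C.integral (fun z => f z * g z *
        ((∏ r, ellGamma (T r * z) p q * ellGamma (T r * z⁻¹) p q) /
          (ellGamma (z ^ 2) p q * ellGamma ((z ^ 2)⁻¹) p q)) / (2 * Real.pi * I * z)) =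
      2 * (theta (T a * T b) q * theta (T a * W) q * theta (T b * W) q)⁻¹ *
        D.integral (fun z => Ψ z / (2 * Real.pi * I * z)) := by
  set τ := shifted q mf mg T with hτ
  have hτ0 : ∀ r, τ r ≠ 0 := fun r => by
    rw [hτ, shifted_eq]; exact div_ne_zero (hT r) (pow_ne_zero _ hq0)
  have hε' : ∀ r, ε r = 1 ∨ ε r = p := fun r => by
    rw [hε]; split_ifs <;> simp
  set c := theta (T a * T b) q * theta (T a * W) q * theta (T b * W) q with hc
  have hc0 : c ≠ 0 := mul_ne_zero (mul_ne_zero hab0 haW) hbW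
  set U := regularDomain τ ε p q with hU
  have hUo : IsOpen U := isOpen_regularDomain hp hq τ ε
  set V : Set ℂ := {z | z ∈ U ∧ z⁻¹ ∈ U} with hV
  have hV0 : ∀ z ∈ V, z ≠ 0 := fun z hz => hz.1.1
  have hVo : IsOpen V := by
    rw [isOpen_iff_mem_nhds]
    intro z hz
    filter_upwards [hUo.mem_nhds hz.1, (continuousAt_inv₀ (hV0 z hz)).preimage_mem_nhds
      (hUo.mem_nhds hz.2)] with y h1 h2 using ⟨h1, h2⟩
  have hVc : ∀ z, z ∉ V → z = 0 ∨ z ∈ ellInner τ p q ∨ z ∈ ellOuter τ p q := by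
    intro z hz
    by_cases h1 : z ∈ U
    · have h2 : z⁻¹ ∉ U := fun h2 => hz ⟨h1, h2⟩
      rcases notMem_regularDomain hp hq hε' h2 with h | h | h
      · exact absurd (inv_eq_zero.1 h) h1.1
      · exact Or.inr (Or.inr (mem_ellOuter_iff.2 h))
      · exact Or.inr (Or.inl (by rwa [mem_ellOuter_iff, inv_inv] at h))
    · exact notMem_regularDomain hp hq hε' h1
  have hsub : ∀ {C' : Chain}, C'.Separates (ellInner τ p q) (ellOuter τ p q) →
      C'.support ⊆ V := by
    intro C' hC' z hz
    by_contra hcon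
    rcases hVc z hcon with rfl | h | h
    · exact hC'.zero_notMem hz
    · exact disjoint_left.1 hC'.disjoint_inner hz h
    · exact disjoint_left.1 hC'.disjoint_outer hz h
  have hwind : ∀ {C' : Chain}, C'.Separates (ellInner τ p q) (ellOuter τ p q) →
      ∀ x, (x = 0 ∨ x ∈ ellInner τ p q ∨ x ∈ ellOuter τ p q) → C'.winding x = C.winding x := by
    rintro C' hC' x (rfl | h | h)
    · rw [hC'.winding_zero (exists_ellInner_norm_lt hq τ),
        hC.winding_zero (exists_ellInner_norm_lt hq τ)]
    · rw [hC'.winding_inner x h, hC.winding_inner x h]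
    · rw [hC'.winding_outer x h, hC.winding_outer x h]
  have hpi : (2 * (Real.pi : ℂ) * I) ≠ 0 := by simp [Real.pi_ne_zero]
  set A : ℂ → ℂ := fun z => Ψ z / (2 * Real.pi * I * z) with hA
  have hAd : DifferentiableOn ℂ A U := hΨ.fun_div (differentiableOn_id.const_mul _)
    fun z hz => mul_ne_zero hpi hz.1
  set A' : ℂ → ℂ := fun z => Ψ z⁻¹ / (2 * Real.pi * I * z) with hA'
  have hA'd : DifferentiableOn ℂ A' V := by
    refine DifferentiableOn.fun_div (DifferentiableOn.fun_comp hΨ (fun z hz => ?_) fun z hz => hz.2)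
      (differentiableOn_id.const_mul _) fun z hz => mul_ne_zero hpi (hV0 z hz)
    exact (differentiableAt_inv (hV0 z hz)).differentiableWithinAt
  have hVU : V ⊆ U := fun z hz => hz.1
  -- Inversion requires curves that avoid 0 for all real parameters, not only on [0,1]; hence C is
  -- exchanged for a chain of circles.
  obtain ⟨C', hC', hl⟩ := exists_separates_ell hp0 hp hq0 hq hτ0 hC.disjoint
  have hsum : C.integral (fun z => A z + A' z) = C'.integral (fun z => A z + A' z) :=
    Chain.integral_eq_of_winding_eq hVo (hsub hC) (hsub hC') ((hAd.mono hVU).fun_add hA'd)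
      fun x hx => (hwind hC' x (hVc x hx)).symm
  have hDeq : ∀ {C' : Chain}, C'.Separates (ellInner τ p q) (ellOuter τ p q) →
      C'.integral A = D.integral A := fun hC' =>
    Chain.integral_eq_of_winding_eq hUo ((hsub hC').trans hVU) hD hAd fun x hx => by
      rw [hwind hC' x (notMem_regularDomain hp hq hε' hx), hDw x hx]
  have hinv : C'.integral A' = (C'.inversion hl).integral A := by
    rw [Chain.integral_inversion]
    refine Chain.integral_congr fun z hz => ?_
    have hz0 := hV0 z (hsub hC' hz)
    simp only [hA, hA']
    field_simp
  have htot : C.integral (fun z => A z + A' z) = 2 * D.integral A := by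
    rw [hsum, Chain.integral_add (hAd.continuousOn.mono ((hsub hC').trans hVU))
      (hA'd.continuousOn.mono (hsub hC')), hinv, hDeq hC', hDeq (hC'.inversion hp0 hq0 hq hτ0 hl)]
    ring
  -- The points where the formula for Ψ, the reflection formula or the three-term relation may fail.
  have hE : ((⋃ r, {z : ℂ | T r * z ∈ nomeLattice p q}) ∪ (⋃ r, {z : ℂ | T r * z⁻¹ ∈ nomeLattice p q}) ∪
      ({z : ℂ | z ^ 2 / 1 ∈ nomeLattice p q} ∪
        {z : ℂ | z ^ 2 / (T a * T b) ∈ nomeLattice p q})).Countable := by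
    have hN := countable_nomeLattice p q
    refine ((countable_iUnion fun r => ?_).union (countable_iUnion fun r => ?_)).union
      ((countable_setOf_sq_mem hN 1 one_ne_zero).union
        (countable_setOf_sq_mem hN _ (mul_ne_zero (hT a) (hT b))))
    · exact hN.preimage (mul_right_injective₀ (hT r))
    · exact hN.preimage ((mul_right_injective₀ (hT r)).comp inv_injective)
  calc _ = C.integral (fun z => c⁻¹ * (A z + A' z)) := by
        refine Chain.integral_congr_of_countable hE fun z hz hzE => ?_
        simp only [mem_union, mem_iUnion, mem_ofPred_eq, not_or, not_exists, div_one] at hzE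
        obtain ⟨⟨h1, h2⟩, h3, h4⟩ := hzE
        have hzV := hsub hC hz
        have hz0 := hV0 z hzV
        have hthree := theta_three_term hq0 hq (hT a) (hT b) hz0 hW hab0
          (theta_ne_zero_right hq0 hq h3) (theta_ne_zero_right hq0 hq h4)
        have hrefl := ellGamma_mul_inv hp hq (pqPoch_ne_zero hp hq h3)
          (pqPoch_ne_zero hp hq (inv_mem_nomeLattice.not.2 h3))
        -- This sign and power make the second term −z² N(1/z) θ(z⁻²;p) the image of the first under
        -- z ↦ 1/z.
        have hth : theta (z ^ 2) p = -(z ^ 2) * theta (z ^ 2)⁻¹ p := by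
          have := theta_inv hp0 hp (inv_ne_zero (pow_ne_zero 2 hz0))
          rwa [inv_inv] at this
        have h1' : ∀ r, T r * z⁻¹⁻¹ ∉ nomeLattice p q := by simpa only [inv_inv] using h1
        simp only [hA, hA']
        rw [hΨe z hzV.1 h1 h2, hΨe z⁻¹ hzV.2 h2 h1', hf z hz0, hg z hz0,
          mul_brokenWeight hp0 hp hq hab hε h1, mul_brokenWeight hp0 hp hq hab hε h2, inv_inv,
          inv_pow, inv_inv, hth, div_eq_mul_one_div (∏ r, _) (ellGamma _ p q * _), hrefl,
          Finset.prod_congr rfl fun r _ => mul_comm (ellGamma (T r * z⁻¹) p q)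
            (ellGamma (T r * z) p q)]
        rw [eq_inv_mul_iff_mul_eq₀ hc0, hc]
        generalize (∏ r, ellGamma (T r * z) p q * ellGamma (T r * z⁻¹) p q) = R
        linear_combination (f z * g z * R * theta (z ^ 2)⁻¹ p / (2 * Real.pi * I * z)) * hthree
    _ = _ := by rw [Chain.integral_const_mul, htot]; ring

end

section

/-! ### Powers of the nome -/

theorem nomePow_zero (l : ℂ) : nomePow 0 l = 1 := by simp [nomePow]

theorem nomePow_one (l : ℂ) : nomePow 1 l = exp l := by simp [nomePow]

theorem nomePow_add (s u : ℝ) (l : ℂ) : nomePow (s + u) l = nomePow s l * nomePow u l := by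
  rw [nomePow, nomePow, nomePow, ← exp_add, ofReal_add, add_mul]

theorem nomePow_neg (s : ℝ) (l : ℂ) : nomePow (-s) l = (nomePow s l)⁻¹ := by
  rw [nomePow, nomePow, ← exp_neg, ofReal_neg, neg_mul]

theorem nomePow_sub (s u : ℝ) (l : ℂ) : nomePow (s - u) l = nomePow s l / nomePow u l := by
  rw [sub_eq_add_neg, nomePow_add, nomePow_neg, div_eq_mul_inv]

theorem nomePow_natCast (i : ℕ) (l : ℂ) : nomePow i l = exp l ^ i := by
  rw [nomePow, ← exp_nat_mul, ofReal_natCast]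

theorem nomePow_ne_zero (s : ℝ) (l : ℂ) : nomePow s l ≠ 0 := exp_ne_zero _

theorem norm_nomePow (s : ℝ) (l : ℂ) : ‖nomePow s l‖ = Real.exp (s * l.re) := by
  rw [nomePow, norm_exp, re_ofReal_mul]

theorem tendsto_re_nomeToZero : Tendsto re nomeToZero atBot := tendsto_comap

theorem tendsto_nomePow {s : ℝ} (hs : 0 < s) : Tendsto (nomePow s) nomeToZero (𝓝 0) := by
  rw [tendsto_zero_iff_norm_tendsto_zero]
  simp only [norm_nomePow]
  exact Real.tendsto_exp_atBot.comp ((tendsto_re_nomeToZero).const_mul_atBot hs)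

theorem tendsto_exp_nomeToZero : Tendsto exp nomeToZero (𝓝 0) := by
  rw [← show nomePow 1 = exp from funext nomePow_one]
  exact tendsto_nomePow one_pos

theorem eventually_norm_exp_lt_one : ∀ᶠ l in nomeToZero, ‖exp l‖ < 1 :=
  tendsto_exp_nomeToZero.norm.eventually (gt_mem_nhds (by simp))

/-- The same p serves for all i and j, because the nonzero exponents s + i are bounded below by the
positive constant c and |q^j| ≤ 1. -/
theorem eventually_norm_mul_nomePow_lt {q : ℂ} (hq : ‖q‖ < 1) (v : ℂ) {s δ : ℝ} (hs : 0 ≤ s)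
    (hδ : 0 < δ) : ∀ᶠ l in nomeToZero, ∀ i j : ℕ, ¬ (i = 0 ∧ s = 0) →
      ‖v * nomePow s l * exp l ^ i * q ^ j‖ < δ := by
  set c : ℝ := if s = 0 then 1 else min s 1 with hc
  have hc0 : 0 < c := by
    rw [hc]
    split_ifs with h
    · exact one_pos
    · exact lt_min (lt_of_le_of_ne hs (Ne.symm h)) one_pos
  have h1 := ((tendsto_nomePow hc0).const_mul v).norm.eventually_lt_const (u := δ)
    (by simpa using hδ)
  filter_upwards [h1, (tendsto_re_nomeToZero).eventually (eventually_le_atBot 0)] with l hl hre i j hij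
  refine lt_of_le_of_lt ?_ hl
  rw [mul_assoc v, ← nomePow_natCast, ← nomePow_add, norm_mul, norm_mul, norm_mul, norm_pow,
    norm_nomePow, norm_nomePow]
  have hle : c ≤ s + i := by
    rw [hc]
    split_ifs with h
    · have : 1 ≤ i := Nat.one_le_iff_ne_zero.2 fun h' => hij ⟨h', h⟩
      have : (1 : ℝ) ≤ i := by exact_mod_cast this
      linarith
    · have := i.cast_nonneg (α := ℝ)
      exact (min_le_left _ _).trans (by linarith)
  have h3 : Real.exp ((s + i) * l.re) ≤ Real.exp (c * l.re) :=
    Real.exp_le_exp.2 (mul_le_mul_of_nonpos_right hle hre)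
  calc ‖v‖ * Real.exp ((s + i) * l.re) * ‖q‖ ^ j ≤ ‖v‖ * Real.exp ((s + i) * l.re) * 1 := by
        gcongr
        exact pow_le_one₀ (norm_nonneg q) hq.le
    _ ≤ ‖v‖ * Real.exp (c * l.re) := by rw [mul_one]; gcongr

/-! ### Limits of the elliptic symbols -/

section Limits

variable {ι : Type*} {L : Filter ι} {l y : ι → ℂ} {y₀ q : ℂ} {s : ℝ}

theorem tendsto_mul_nomePow (hl : Tendsto l L nomeToZero) (hy : Tendsto y L (𝓝 y₀)) (hs : 0 ≤ s) :
    Tendsto (fun i => y i * nomePow s (l i)) L (𝓝 (if s = 0 then y₀ else 0)) := by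
  split_ifs with h
  · simpa only [h, nomePow_zero, mul_one] using hy
  · simpa using hy.mul ((tendsto_nomePow (lt_of_le_of_ne hs (Ne.symm h))).comp hl)

theorem tendsto_pqPoch (hq : ‖q‖ < 1) (hl : Tendsto l L nomeToZero) (hy : Tendsto y L (𝓝 y₀))
    (hs : 0 ≤ s) : Tendsto (fun i => pqPoch (y i * nomePow s (l i)) (exp (l i)) q) L
      (𝓝 (if s = 0 then qPoch y₀ q else 1)) := by
  have h1 := tendsto_mul_nomePow hl hy hs
  have h2 := (continuousAt_pqPoch hq (if s = 0 then y₀ else 0) (p := 0) (by simp)).tendsto.comp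
    (h1.prodMk_nhds (tendsto_exp_nomeToZero.comp hl))
  have e : (if s = 0 then qPoch y₀ q else 1) = pqPoch (if s = 0 then y₀ else 0) 0 q := by
    rw [pqPoch_zero_middle]
    split_ifs <;> simp [qPoch_zero_left]
  rw [e]
  exact h2

theorem tendsto_qPoch_nome (hl : Tendsto l L nomeToZero) (hy : Tendsto y L (𝓝 y₀))
    (hs : 0 ≤ s) : Tendsto (fun i => qPoch (y i * nomePow s (l i)) (exp (l i))) L
      (𝓝 (if s = 0 then 1 - y₀ else 1)) := by
  have h1 := tendsto_mul_nomePow hl hy hs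
  have h2 := (continuousAt_qPoch (if s = 0 then y₀ else 0) (p := 0) (by simp)).tendsto.comp
    (h1.prodMk_nhds (tendsto_exp_nomeToZero.comp hl))
  have e : (if s = 0 then 1 - y₀ else 1) = qPoch (if s = 0 then y₀ else 0) 0 := by
    rw [qPoch_zero_right]
    split_ifs <;> simp
  rw [e]
  exact h2

/-- Numerator and denominator have arguments of order p^{1−s} and p^s; each survives in the limit
only if its exponent is 0. -/
theorem tendsto_ellGamma (hq : ‖q‖ < 1) (hl : Tendsto l L nomeToZero) (hy : Tendsto y L (𝓝 y₀))
    (hy0 : y₀ ≠ 0) (hs : 0 ≤ s) (hs1 : s ≤ 1) (h0 : s = 0 → qPoch y₀ q ≠ 0) :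
    Tendsto (fun i => ellGamma (y i * nomePow s (l i)) (exp (l i)) q) L
      (𝓝 ((if s = 1 then qPoch (q / y₀) q else 1) / (if s = 0 then qPoch y₀ q else 1))) := by
  have h1 := tendsto_pqPoch hq hl ((tendsto_const_nhds (x := q)).div hy hy0) (sub_nonneg.2 hs1)
  have h2 := tendsto_pqPoch hq hl hy hs
  have h3 := h1.div h2 (by split_ifs with h; exacts [h0 h, one_ne_zero])
  simp only [sub_eq_zero, eq_comm (a := (1 : ℝ))] at h3
  refine h3.congr fun i => ?_
  simp only [Pi.div_apply]
  rw [ellGamma, nomePow_sub, nomePow_one]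
  congr 2
  field_simp

/-- Meant for θ(z⁻² p^{−2ζ};p). Its exponent is 1 exactly when ζ = −1/2, which is the source of the
factor 1 − z² in the limiting weight. -/
theorem tendsto_theta_nome (hl : Tendsto l L nomeToZero) (hy : Tendsto y L (𝓝 y₀))
    (hy0 : y₀ ≠ 0) (hs : 0 < s) (hs1 : s ≤ 1) :
    Tendsto (fun i => theta (y i * nomePow s (l i)) (exp (l i))) L
      (𝓝 (if s = 1 then 1 - y₀⁻¹ else 1)) := by
  have h1 := tendsto_qPoch_nome hl (hy.inv₀ hy0) (sub_nonneg.2 hs1)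
  have h2 := tendsto_qPoch_nome hl hy hs.le
  have h3 := h2.mul h1
  simp only [sub_eq_zero, eq_comm (a := (1 : ℝ)), hs.ne', if_false, one_mul] at h3
  refine h3.congr fun i => ?_
  rw [theta, nomePow_sub, nomePow_one]
  congr 2
  field_simp

end Limits

/-! ### The broken weight in the limit -/

/-- The factors `p` by which the arguments with index `a`, `b` are shifted. -/
def nomeShift (a b : Fin 6) (l : ℂ) (r : Fin 6) : ℂ := if r = a ∨ r = b then exp l else 1

/-- The exponent of `p` in the argument `t_r p^{α_r} p^ζ z` (after the shift by `nomeShift`). -/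
def outerExp (α : Fin 6 → ℝ) (ζ : ℝ) (a b r : Fin 6) : ℝ :=
  α r + ζ + if r = a ∨ r = b then 1 else 0

theorem nomeShift_eq (a b : Fin 6) (l : ℂ) (r : Fin 6) : nomeShift a b l r = 1 ∨
    nomeShift a b l r = exp l := by
  unfold nomeShift
  split_ifs <;> simp

theorem nomeShift_mul (α : Fin 6 → ℝ) (ζ : ℝ) (a b r : Fin 6) (l z c : ℂ) :
    nomeShift a b l r * (c * nomePow (α r) l) * (nomePow ζ l * z) =
      c * z * nomePow (outerExp α ζ a b r) l := by
  unfold nomeShift outerExp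
  split_ifs
  · rw [nomePow_add, nomePow_add, nomePow_one]; ring
  · rw [add_zero, nomePow_add]; ring

theorem mul_nomePow_inv (s ζ : ℝ) (l z c : ℂ) :
    c * nomePow s l * (nomePow ζ l * z)⁻¹ = c * z⁻¹ * nomePow (s - ζ) l := by
  rw [nomePow_sub, mul_inv]
  ring

theorem shifted_scaled (q : ℂ) (mf mg : ℕ) (t : Fin 6 → ℂ) (α : Fin 6 → ℝ) (l : ℂ) (r : Fin 6) :
    shifted q mf mg (scaled t α l) r = shifted q mf mg t r * nomePow (α r) l := by
  rw [shifted_eq, shifted_eq, scaled]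
  ring

/-- The conditions on the exponents. -/
structure Exponents (α : Fin 6 → ℝ) (ζ : ℝ) (a b : Fin 6) : Prop where
  lower : -1 / 2 ≤ ζ
  neg : ζ < 0
  ne : a ≠ b
  left : α a = ζ
  right : α b = ζ
  other : ∀ r, r ≠ a → r ≠ b → -ζ ≤ α r ∧ α r ≤ 1 + ζ

/-! ### Ranges of the exponents of the rescaled gamma arguments -/

namespace Exponents

variable {α : Fin 6 → ℝ} {ζ : ℝ} {a b : Fin 6}

/-- For a and b the shift by p turns 2ζ into 1 + 2ζ; for the other indices 0 ≤ α_r + ζ ≤ 1 + 2ζ.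
Strictness at 1 makes the numerators of these gamma factors tend to 1. -/
theorem outerExp_mem (h : Exponents α ζ a b) (r : Fin 6) :
    0 ≤ outerExp α ζ a b r ∧ outerExp α ζ a b r < 1 := by
  have := h.lower; have := h.neg; have := h.left; have := h.right
  unfold outerExp
  split_ifs with hr
  · rcases hr with rfl | rfl <;> constructor <;> linarith
  · rw [not_or] at hr
    obtain ⟨h1, h2⟩ := h.other r hr.1 hr.2
    constructor <;> linarith

theorem innerExp_mem (h : Exponents α ζ a b) (r : Fin 6) : 0 ≤ α r - ζ ∧ α r - ζ ≤ 1 := by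
  have := h.lower; have := h.neg; have := h.left; have := h.right
  by_cases ha : r = a
  · rw [ha]; constructor <;> linarith
  by_cases hb : r = b
  · rw [hb]; constructor <;> linarith
  obtain ⟨h1, h2⟩ := h.other r ha hb
  constructor <;> linarith

theorem outerExp_eq_zero (h : Exponents α ζ a b) (r : Fin 6) :
    outerExp α ζ a b r = 0 ↔ α r = -ζ ∨ (ζ = -1 / 2 ∧ (r = a ∨ r = b)) := by
  have := h.lower; have := h.neg; have := h.left; have := h.right
  unfold outerExp
  split_ifs with hr
  · have hα : α r = ζ := by rcases hr with rfl | rfl <;> assumption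
    simp only [hr, and_true, hα]
    constructor
    · intro h; right; linarith
    · rintro (h | h) <;> linarith
  · simp only [hr, and_false, or_false, add_zero]
    constructor <;> intro h <;> linarith

theorem innerExp_eq_zero (h : Exponents α ζ a b) (r : Fin 6) :
    α r - ζ = 0 ↔ r = a ∨ r = b := by
  have := h.neg
  constructor
  · intro h0
    by_contra! hr
    have := (h.other r hr.1 hr.2).1
    linarith
  · rintro (rfl | rfl)
    · rw [h.left, sub_self]
    · rw [h.right, sub_self]

end Exponents

/-- The part of the plane on which the limiting integrand is holomorphic. -/
def limDomain (q : ℂ) (τ : Fin 6 → ℂ) (α : Fin 6 → ℝ) (ζ : ℝ) (a b : Fin 6) : Set ℂ :=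
  {z | z ≠ 0 ∧ z ∉ limInner q τ a b ∧ z ∉ limOuter q τ α ζ a b}

/-! ### Convergence of the broken weight -/

section Weight

variable {q : ℂ} {τ t : Fin 6 → ℂ} {α : Fin 6 → ℝ} {ζ : ℝ} {a b : Fin 6} {z : ℂ}

theorem qPoch_outer_ne_zero (hq : ‖q‖ < 1) (h : Exponents α ζ a b)
    (hz : z ∈ limDomain q τ α ζ a b) {r : Fin 6} (hr : outerExp α ζ a b r = 0) :
    qPoch (τ r * z) q ≠ 0 := by
  intro h0
  obtain ⟨j, hj⟩ := qPoch_eq_zero hq h0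
  refine hz.2.2 ⟨r, j, (h.outerExp_eq_zero r).1 hr, ?_⟩
  refine eq_inv_of_mul_eq_one_left ?_
  rw [← hj]
  ring

theorem qPoch_inner_ne_zero (hq : ‖q‖ < 1) (h : Exponents α ζ a b)
    (hz : z ∈ limDomain q τ α ζ a b) {r : Fin 6} (hr : α r - ζ = 0) :
    qPoch (τ r * z⁻¹) q ≠ 0 := by
  intro h0
  obtain ⟨j, hj⟩ := qPoch_eq_zero hq h0
  have hz0 := hz.1
  have e : z = τ r * q ^ j := by
    field_simp at hj
    exact hj.symm
  refine hz.2.1 ⟨j, ?_⟩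
  rcases (h.innerExp_eq_zero r).1 hr with rfl | rfl
  · exact Or.inl e
  · exact Or.inr e

theorem eventually_mem_regularDomain (hq : ‖q‖ < 1) (h : Exponents α ζ a b) {mf mg : ℕ}
    (hz : z ∈ limDomain q (shifted q mf mg t) α ζ a b) :
    ∀ᶠ x : ℂ × ℂ in nomeToZero ×ˢ 𝓝 z, nomePow ζ x.1 * x.2 ∈
      regularDomain (shifted q mf mg (scaled t α x.1)) (nomeShift a b x.1) (exp x.1) q := by
  have h1 : Tendsto (Prod.fst : ℂ × ℂ → ℂ) (nomeToZero ×ˢ 𝓝 z) nomeToZero := tendsto_fst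
  have h2 : Tendsto (Prod.snd : ℂ × ℂ → ℂ) (nomeToZero ×ˢ 𝓝 z) (𝓝 z) := tendsto_snd
  have e0 := h2.eventually_ne hz.1
  have e1 : ∀ r, ∀ᶠ x : ℂ × ℂ in nomeToZero ×ˢ 𝓝 z,
      pqPoch (shifted q mf mg t r * x.2 * nomePow (outerExp α ζ a b r) x.1) (exp x.1) q ≠ 0 :=
    fun r => (tendsto_pqPoch hq h1 (h2.const_mul _) (h.outerExp_mem r).1).eventually_ne (by
      split_ifs with h0
      exacts [qPoch_outer_ne_zero hq h hz h0, one_ne_zero])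
  have e2 : ∀ r, ∀ᶠ x : ℂ × ℂ in nomeToZero ×ˢ 𝓝 z,
      pqPoch (shifted q mf mg t r * x.2⁻¹ * nomePow (α r - ζ) x.1) (exp x.1) q ≠ 0 :=
    fun r => (tendsto_pqPoch hq h1 ((h2.inv₀ hz.1).const_mul _) (h.innerExp_mem r).1).eventually_ne
      (by
        split_ifs with h0
        exacts [qPoch_inner_ne_zero hq h hz h0, one_ne_zero])
  filter_upwards [e0, eventually_all.2 e1, eventually_all.2 e2] with x h0 h1 h2
  refine ⟨mul_ne_zero (nomePow_ne_zero _ _) h0, fun r => ?_⟩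
  rw [shifted_scaled, nomeShift_mul, mul_nomePow_inv]
  exact ⟨h1 r, h2 r⟩

/-- The sequence t_r q^k is a tail of the one that starts at the shifted parameter, so shifting only
excludes more points. -/
theorem limDomain_shifted_subset (hq0 : q ≠ 0) (mf mg : ℕ) :
    limDomain q (shifted q mf mg t) α ζ a b ⊆ limDomain q t α ζ a b := by
  have e : ∀ (r : Fin 6) (k : ℕ), t r * q ^ k = shifted q mf mg t r * q ^ (k + shiftOrder mf mg r) := by
    intro r k
    rw [shifted_eq, pow_add]
    field_simp
  rintro z ⟨h0, h1, h2⟩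
  refine ⟨h0, ?_, ?_⟩
  · rintro ⟨k, hk | hk⟩
    · exact h1 ⟨_, Or.inl (hk.trans (e a k))⟩
    · exact h1 ⟨_, Or.inr (hk.trans (e b k))⟩
  · rintro ⟨r, k, hr, hk⟩
    exact h2 ⟨r, _, hr, hk.trans (by rw [e])⟩

theorem prod_outer (h : Exponents α ζ a b) (X : Fin 6 → ℂ) :
    (∏ r, if outerExp α ζ a b r = 0 then X r else 1) =
      (∏ r with α r = -ζ, X r) * if ζ = -1 / 2 then X a * X b else 1 := by
  have e : ∀ r, (if outerExp α ζ a b r = 0 then X r else 1) = (if α r = -ζ then X r else 1) *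
      ((if r = a then (if ζ = -1 / 2 then X a else 1) else 1) *
        (if r = b then (if ζ = -1 / 2 then X b else 1) else 1)) := by
    intro r
    have hn := h.neg
    have hne : ζ ≠ -ζ := by linarith
    simp only [h.outerExp_eq_zero]
    by_cases ha : r = a
    · simp [ha, h.ne, h.left, hne]
    · by_cases hb : r = b
      · simp [hb, h.ne.symm, h.right, hne]
      · simp [ha, hb]
  rw [Finset.prod_congr rfl fun r _ => e r, Finset.prod_mul_distrib, Finset.prod_mul_distrib,
    Finset.prod_filter]
  simp only [Finset.prod_ite_eq', Finset.mem_univ, if_true]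
  split_ifs <;> simp

theorem prod_inner (h : Exponents α ζ a b) (X : Fin 6 → ℂ) :
    (∏ r, if α r - ζ = 0 then X r else 1) = X a * X b := by
  have e : ∀ r, (if α r - ζ = 0 then X r else 1) =
      (if r = a then X a else 1) * (if r = b then X b else 1) := by
    intro r
    simp only [h.innerExp_eq_zero]
    by_cases ha : r = a
    · simp [ha, h.ne]
    · by_cases hb : r = b
      · simp [hb, h.ne.symm]
      · simp [ha, hb]
  rw [Finset.prod_congr rfl fun r _ => e r, Finset.prod_mul_distrib]
  simp only [Finset.prod_ite_eq', Finset.mem_univ, if_true]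

/-- The choice W = w p^{-ζ} frees both theta factors containing W from p, as T_a T_b W = t_a t_b w
p^ζ. The remaining factors converge one by one. -/
theorem tendsto_brokenWeight (hq0 : q ≠ 0) (hq : ‖q‖ < 1) (ht : ∀ r, t r ≠ 0)
    (h : Exponents α ζ a b) {w : ℂ} (hw : w ≠ 0) (haw : theta (t a * w) q ≠ 0)
    (hbw : theta (t b * w) q ≠ 0) (hz : z ∈ limDomain q t α ζ a b) :
    Tendsto (fun x : ℂ × ℂ => brokenWeight (scaled t α x.1) (nomeShift a b x.1) (exp x.1) q a b
        (w * nomePow (-ζ) x.1) (nomePow ζ x.1 * x.2)) (nomeToZero ×ˢ 𝓝 z)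
      (𝓝 (theta (t a * w) q * theta (t b * w) q * limWeight q t α ζ a b w z)) := by
  have h1 : Tendsto (Prod.fst : ℂ × ℂ → ℂ) (nomeToZero ×ˢ 𝓝 z) nomeToZero := tendsto_fst
  have h2 : Tendsto (Prod.snd : ℂ × ℂ → ℂ) (nomeToZero ×ˢ 𝓝 z) (𝓝 z) := tendsto_snd
  have hz0 := hz.1
  have hlow := h.lower
  have hneg := h.neg
  have g1 : ∀ r, Tendsto (fun x : ℂ × ℂ => ellGamma (t r * x.2 * nomePow (outerExp α ζ a b r) x.1)
      (exp x.1) q) (nomeToZero ×ˢ 𝓝 z)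
      (𝓝 (1 / if outerExp α ζ a b r = 0 then qPoch (t r * z) q else 1)) := fun r => by
    have := tendsto_ellGamma hq h1 (h2.const_mul (t r)) (mul_ne_zero (ht r) hz0)
      (h.outerExp_mem r).1 (h.outerExp_mem r).2.le fun hr => qPoch_outer_ne_zero hq h hz hr
    rwa [if_neg (h.outerExp_mem r).2.ne] at this
  have g2 : ∀ r, Tendsto (fun x : ℂ × ℂ => ellGamma (t r * x.2⁻¹ * nomePow (α r - ζ) x.1)
      (exp x.1) q) (nomeToZero ×ˢ 𝓝 z)
      (𝓝 ((if α r - ζ = 1 then qPoch (q / (t r * z⁻¹)) q else 1) /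
        if α r - ζ = 0 then qPoch (t r * z⁻¹) q else 1)) := fun r =>
    tendsto_ellGamma hq h1 ((h2.inv₀ hz0).const_mul (t r)) (mul_ne_zero (ht r) (inv_ne_zero hz0))
      (h.innerExp_mem r).1 (h.innerExp_mem r).2 fun hr => qPoch_inner_ne_zero hq h hz hr
  have g3 := tendsto_theta_nome (s := -2 * ζ) h1 ((h2.pow 2).inv₀ (pow_ne_zero 2 hz0))
    (inv_ne_zero (pow_ne_zero 2 hz0)) (by linarith) (by linarith)
  have g4 : Tendsto (fun x : ℂ × ℂ => theta (w * x.2) q) (nomeToZero ×ˢ 𝓝 z) (𝓝 (theta (w * z) q)) :=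
    (differentiableAt_theta hq (mul_ne_zero hw hz0)).continuousAt.tendsto.comp (h2.const_mul w)
  have hne : q * z / (t a * t b * w) ≠ 0 :=
    div_ne_zero (mul_ne_zero hq0 hz0) (mul_ne_zero (mul_ne_zero (ht a) (ht b)) hw)
  have g5 : Tendsto (fun x : ℂ × ℂ => theta (q * x.2 / (t a * t b * w)) q) (nomeToZero ×ˢ 𝓝 z)
      (𝓝 (theta (q * z / (t a * t b * w)) q)) :=
    (differentiableAt_theta hq hne).continuousAt.tendsto.comp ((h2.const_mul q).div_const _)
  have g := ((tendsto_finsetProd Finset.univ fun r _ => (g1 r).mul (g2 r)).mul g3).mul (g4.mul g5)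
  have hlim : (∏ r, (1 / if outerExp α ζ a b r = 0 then qPoch (t r * z) q else 1) *
      ((if α r - ζ = 1 then qPoch (q / (t r * z⁻¹)) q else 1) /
        if α r - ζ = 0 then qPoch (t r * z⁻¹) q else 1)) *
      (if -2 * ζ = 1 then 1 - ((z ^ 2)⁻¹)⁻¹ else 1) *
      (theta (w * z) q * theta (q * z / (t a * t b * w)) q) =
      theta (t a * w) q * theta (t b * w) q * limWeight q t α ζ a b w z := by
    rw [Finset.prod_mul_distrib, Finset.prod_div_distrib, Finset.prod_div_distrib, prod_outer h,
      prod_inner h, Finset.prod_const_one, ← Finset.prod_filter, limWeight, inv_inv]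
    have e1 : (Finset.univ.filter fun r => α r - ζ = 1) = Finset.univ.filter fun r => α r = 1 + ζ := by
      ext r
      simp [sub_eq_iff_eq_add]
    have e2 : ∀ r, q / (t r * z⁻¹) = q * z / t r := fun r => by
      rw [← div_eq_mul_inv, div_div_eq_mul_div]
    have e3 : -2 * ζ = 1 ↔ ζ = -1 / 2 := ⟨fun h => by linarith, fun h => by linarith⟩
    simp only [e1, e2, e3, div_eq_mul_inv (t _) z]
    generalize theta (t a * w) q = u at *
    generalize theta (t b * w) q = v at *
    generalize (∏ r with α r = -ζ, qPoch (t r * z) q) = P₁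
    generalize (∏ r with α r = 1 + ζ, qPoch (q * z / t r) q) = P₂
    generalize theta (w * z) q * theta (q * z / (t a * t b * w)) q = P₃
    generalize qPoch (t a / z) q * qPoch (t b / z) q = P₄
    generalize qPoch (t a * z) q * qPoch (t b * z) q = P₅
    split_ifs
    · field_simp
    · field_simp
  rw [hlim] at g
  refine g.congr fun x => ?_
  have k1 := nomePow_ne_zero ζ x.1
  have e1 : ∀ r, ellGamma (nomeShift a b x.1 r * scaled t α x.1 r * (nomePow ζ x.1 * x.2)) (exp x.1) q *
      ellGamma (scaled t α x.1 r * (nomePow ζ x.1 * x.2)⁻¹) (exp x.1) q =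
      ellGamma (t r * x.2 * nomePow (outerExp α ζ a b r) x.1) (exp x.1) q *
        ellGamma (t r * x.2⁻¹ * nomePow (α r - ζ) x.1) (exp x.1) q := fun r => by
    rw [scaled, nomeShift_mul, mul_nomePow_inv]
  have e2 : ((nomePow ζ x.1 * x.2) ^ 2)⁻¹ = (x.2 ^ 2)⁻¹ * nomePow (-2 * ζ) x.1 := by
    rw [show -2 * ζ = -ζ + -ζ by ring, nomePow_add, nomePow_neg, mul_pow, mul_inv]
    ring
  have e3 : w * nomePow (-ζ) x.1 * (nomePow ζ x.1 * x.2) = w * x.2 := by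
    rw [nomePow_neg]
    field_simp
  have e4 : q * (nomePow ζ x.1 * x.2) / (scaled t α x.1 a * scaled t α x.1 b *
      (w * nomePow (-ζ) x.1)) = q * x.2 / (t a * t b * w) := by
    have hta := ht a
    have htb := ht b
    rw [scaled, scaled, h.left, h.right, nomePow_neg]
    field_simp
  rw [brokenWeight, Finset.prod_congr rfl fun r _ => e1 r, e2, e3, e4]

end Weight

end

section

/-! ### Passing to the limit in integrals along chains -/

/-- If X left a closed ball around the limit at some point, by continuity it would do so at nearby
points off the countable set, where it equals Y. -/
theorem tendsto_prod_of_eq_off_countable {ι : Type*} {L : Filter ι} {X Y : ι → ℂ → ℂ} {z₀ y₀ : ℂ}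
    (hX : ∀ᶠ x : ι × ℂ in L ×ˢ 𝓝 z₀, ContinuousAt (X x.1) x.2) {E : ι → Set ℂ}
    (hE : ∀ i, (E i).Countable)
    (h : ∀ᶠ x : ι × ℂ in L ×ˢ 𝓝 z₀, x.2 ∉ E x.1 → X x.1 x.2 = Y x.1 x.2)
    (hY : Tendsto (fun x : ι × ℂ => Y x.1 x.2) (L ×ˢ 𝓝 z₀) (𝓝 y₀)) :
    Tendsto (fun x : ι × ℂ => X x.1 x.2) (L ×ˢ 𝓝 z₀) (𝓝 y₀) := by
  rw [Metric.nhds_basis_closedBall.tendsto_right_iff] at hY ⊢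
  intro d hd
  obtain ⟨⟨A, B⟩, ⟨hA, hB⟩, hAB⟩ :=
    ((L.basis_sets.prod (nhds_basis_opens z₀)).eventually_iff).1 (hX.and (h.and (hY d hd)))
  filter_upwards [prod_mem_prod hA (hB.2.mem_nhds hB.1)] with x hx
  by_contra hcon
  have hc := (hAB hx).1
  have h1 : ∀ᶠ y in 𝓝 x.2, X x.1 y ∉ Metric.closedBall y₀ d :=
    hc.eventually (Metric.isClosed_closedBall.isOpen_compl.mem_nhds hcon)
  obtain ⟨y, hyE, hy1, hy2⟩ := ((frequently_notMem_of_countable (hE x.1) x.2).and_eventually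
    (h1.and (hB.2.mem_nhds hx.2))).exists
  obtain ⟨-, h2, h3⟩ := hAB (x := (x.1, y)) ⟨hx.1, hy2⟩
  apply hy1
  rw [h2 hyE]
  exact h3

theorem exists_uniform_bound {ι : Type*} {L : Filter ι} {X : ι → ℂ → ℂ} {K : Set ℂ}
    (hK : IsCompact K)
    (h : ∀ z ∈ K, ∃ M : ℝ, ∀ᶠ x : ι × ℂ in L ×ˢ 𝓝 z, ‖X x.1 x.2‖ ≤ M) :
    ∃ M : ℝ, ∀ᶠ i in L, ∀ z ∈ K, ‖X i z‖ ≤ M := by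
  refine hK.induction_on (p := fun s => ∃ M : ℝ, ∀ᶠ i in L, ∀ z ∈ s, ‖X i z‖ ≤ M) ?_ ?_ ?_ ?_
  · exact ⟨0, by simp⟩
  · rintro s t hst ⟨M, hM⟩
    exact ⟨M, hM.mono fun i hi z hz => hi z (hst hz)⟩
  · rintro s t ⟨M, hM⟩ ⟨M', hM'⟩
    refine ⟨max M M', (hM.and hM').mono fun i hi z hz => ?_⟩
    rcases hz with hz | hz
    · exact (hi.1 z hz).trans (le_max_left _ _)
    · exact (hi.2 z hz).trans (le_max_right _ _)
  · intro z hz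
    obtain ⟨M, hM⟩ := h z hz
    obtain ⟨A, hA, B, hB, hAB⟩ := mem_prod_iff.1 hM
    exact ⟨B, mem_nhdsWithin_of_mem_nhds hB, M, by
      filter_upwards [hA] with i hi y hy using hAB (mk_mem_prod hi hy)⟩

theorem eventually_forall_of_compact {ι : Type*} {L : Filter ι} {K : Set ℂ} (hK : IsCompact K)
    {P : ι → ℂ → Prop} (h : ∀ z ∈ K, ∀ᶠ x : ι × ℂ in L ×ˢ 𝓝 z, P x.1 x.2) :
    ∀ᶠ i in L, ∀ z ∈ K, P i z := by
  have := hK.mem_prod_nhdsSet_of_forall (s := {x : ι × ℂ | P x.1 x.2}) h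
  obtain ⟨A, hA, B, hB, hAB⟩ := mem_prod_iff.1 this
  filter_upwards [hA] with i hi z hz using hAB (mk_mem_prod hi (subset_of_mem_nhdsSet hB hz))

theorem exists_sphere_disjoint {B : Set ℂ} (hB : B.Countable) (z : ℂ) {R : ℝ} (hR : 0 < R) :
    ∃ r, 0 < r ∧ r < R ∧ Disjoint (Metric.sphere z r) B := by
  have h1 : ((fun y => dist y z) '' B).Countable := hB.image _
  have h2 : ¬ (Ioo 0 R).Countable := by
    rw [← Cardinal.le_aleph0_iff_set_countable, Cardinal.mk_Ioo_real hR, not_le]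
    exact Cardinal.aleph0_lt_continuum
  obtain ⟨r, hr, hr'⟩ : ∃ r ∈ Ioo 0 R, r ∉ (fun y => dist y z) '' B := by
    by_contra! hcon
    exact h2 (h1.mono hcon)
  exact ⟨r, hr.1, hr.2, disjoint_left.2 fun y hy hyB => hr' ⟨y, hyB, hy⟩⟩

/-- Convergence may fail on B, which may meet the chain. Around each point there is a small circle
that misses B; convergence bounds X on it and the maximum principle bounds X inside. Compactness of
the support then gives the constant for dominated convergence. -/
theorem Chain.tendsto_integral {D : Chain} {L : Filter ℂ} [L.IsCountablyGenerated] {Ω : Set ℂ}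
    (hΩ : IsOpen Ω) (hD : D.support ⊆ Ω) {X : ℂ → ℂ → ℂ} {Y : ℂ → ℂ} {B : Set ℂ}
    (hB : B.Countable)
    (hX : ∀ z ∈ Ω, ∀ᶠ x : ℂ × ℂ in L ×ˢ 𝓝 z, DifferentiableAt ℂ (X x.1) x.2)
    (hY : ∀ z ∈ Ω, z ∉ B → Tendsto (fun x : ℂ × ℂ => X x.1 x.2) (L ×ˢ 𝓝 z) (𝓝 (Y z))) :
    Tendsto (fun l => D.integral (X l)) L (𝓝 (D.integral Y)) := by
  have hloc : ∀ z ∈ Ω, ∃ M : ℝ, ∀ᶠ x : ℂ × ℂ in L ×ˢ 𝓝 z, ‖X x.1 x.2‖ ≤ M := by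
    intro z hz
    obtain ⟨R, hR, hRΩ⟩ := Metric.isOpen_iff.1 hΩ z hz
    obtain ⟨r, hr, hrR, hdis⟩ := exists_sphere_disjoint hB z hR
    have hcb : Metric.closedBall z r ⊆ Ω := (Metric.closedBall_subset_ball hrR).trans hRΩ
    obtain ⟨M, hM⟩ := exists_uniform_bound (L := L) (X := X) (isCompact_sphere z r) fun y hy => by
      have := hY y (hcb (Metric.sphere_subset_closedBall hy)) (disjoint_left.1 hdis hy)
      exact ⟨‖Y y‖ + 1, (this.norm.eventually_lt_const (lt_add_one _)).mono fun _ h => h.le⟩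
    have hdiff := eventually_forall_of_compact (L := L)
      (P := fun l z => DifferentiableAt ℂ (X l) z) (isCompact_closedBall z r) fun y hy => hX y (hcb hy)
    refine ⟨M, ?_⟩
    filter_upwards [prod_mem_prod (hM.and hdiff) (Metric.ball_mem_nhds z hr)] with x hx
    refine norm_le_of_forall_mem_frontier_norm_le (U := Metric.ball z r) Metric.isBounded_ball
      (DifferentiableOn.diffContOnCl fun y hy => ?_) (fun y hy => ?_) (subset_closure hx.2)
    · rw [closure_ball _ hr.ne'] at hy
      exact (hx.1.2 y hy).differentiableWithinAt
    · rw [frontier_ball _ hr.ne'] at hy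
      exact hx.1.1 y hy
  obtain ⟨M, hM⟩ := exists_uniform_bound (L := L) D.isCompact_support fun z hz => hloc z (hD hz)
  have hcont : ∀ᶠ l in L, ∀ z ∈ D.support, DifferentiableAt ℂ (X l) z :=
    eventually_forall_of_compact D.isCompact_support fun z hz => hX z (hD hz)
  unfold integral
  refine tendsto_finsetSum _ fun i _ => Tendsto.const_mul _ ?_
  refine intervalIntegral.tendsto_integral_filter_of_dominated_convergence
    (fun s => M * ‖deriv (D.loop i) s‖) ?_ ?_ ?_ ?_
  · filter_upwards [hcont] with l hl
    rw [uIoc_of_le zero_le_one]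
    exact (intervalIntegrable (fun z hz => (hl z hz).continuousAt.continuousWithinAt)
      i).1.aestronglyMeasurable
  · filter_upwards [hM] with l hl
    refine Eventually.of_forall fun s hs => ?_
    rw [uIoc_of_le zero_le_one] at hs
    rw [norm_mul]
    exact mul_le_mul_of_nonneg_right (hl _ (D.mem_support i (Ioc_subset_Icc_self hs)))
      (norm_nonneg _)
  · exact (continuous_const.mul (D.continuous_deriv_loop i).norm).intervalIntegrable _ _
  -- Apart from countably many parameters, the curve is off B or has zero derivative.
  · have := (countable_setOf_mem_of_deriv_ne_zero
      ((D.smooth i).differentiable one_ne_zero) hB).ae_notMem volume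
    filter_upwards [this] with s hs hs'
    rw [uIoc_of_le zero_le_one] at hs'
    by_cases h0 : deriv (D.loop i) s = 0
    · simp only [h0, mul_zero]
      exact tendsto_const_nhds
    · have hsΩ := hD (D.mem_support i (Ioc_subset_Icc_self hs'))
      have := hY _ hsΩ fun h => hs ⟨h, h0⟩
      refine Tendsto.mul_const _ (this.comp (f := fun l => (l, D.loop i s)) ?_)
      exact tendsto_id.prodMk tendsto_const_nhds

/-! ### Leading coefficients of expansions -/

namespace NomeSeries

theorem finite_le_val (F : NomeSeries) {s : ℝ} (hs : F.coeff s ≠ 0) : F.val ≤ s := by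
  refine csInf_le ?_ hs
  obtain ⟨m, hm⟩ := (F.finite_le s).bddBelow
  refine ⟨min m s, fun u hu => ?_⟩
  rcases le_total u s with h | h
  · exact (min_le_left _ _).trans (hm ⟨h, hu⟩)
  · exact (min_le_right _ _).trans h

theorem tendsto_partialSum (F : NomeSeries) {N : ℝ} (hN : F.val ≤ N) {z₀ : ℂ}
    (hz : ∀ s, (F.coeff s).denom.eval z₀ ≠ 0) :
    Tendsto (fun x : ℂ × ℂ => nomePow (-F.val) x.1 * F.partialSum N x.1 x.2)
      (nomeToZero ×ˢ 𝓝 z₀) (𝓝 (F.lc z₀)) := by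
  have h1 : Tendsto (Prod.fst : ℂ × ℂ → ℂ) (nomeToZero ×ˢ 𝓝 z₀) nomeToZero := tendsto_fst
  have h2 : Tendsto (Prod.snd : ℂ × ℂ → ℂ) (nomeToZero ×ˢ 𝓝 z₀) (𝓝 z₀) := tendsto_snd
  have hterm : ∀ s ∈ (F.finite_le N).toFinset, Tendsto
      (fun x : ℂ × ℂ => (F.coeff s).eval (RingHom.id ℂ) x.2 * nomePow (s - F.val) x.1)
      (nomeToZero ×ˢ 𝓝 z₀) (𝓝 (if s = F.val then (F.coeff s).eval (RingHom.id ℂ) z₀ else 0)) := by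
    intro s hs
    have hs : s ≤ N ∧ F.coeff s ≠ 0 := by simpa using hs
    have hev : Tendsto (fun x : ℂ × ℂ => (F.coeff s).eval (RingHom.id ℂ) x.2)
        (nomeToZero ×ˢ 𝓝 z₀) (𝓝 ((F.coeff s).eval (RingHom.id ℂ) z₀)) := by
      refine Tendsto.comp (g := fun z => (F.coeff s).eval (RingHom.id ℂ) z) ?_ h2
      exact ((F.coeff s).num.continuous.tendsto z₀).div ((F.coeff s).denom.continuous.tendsto z₀)
        (hz s)
    have := tendsto_mul_nomePow h1 hev (sub_nonneg.2 (F.finite_le_val hs.2))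
    simpa only [sub_eq_zero] using this
  have hsum := tendsto_finsetSum _ hterm
  have e : (∑ s ∈ (F.finite_le N).toFinset,
      if s = F.val then (F.coeff s).eval (RingHom.id ℂ) z₀ else 0) = F.lc z₀ := by
    rw [Finset.sum_ite_eq']
    split_ifs with h
    · rfl
    · have : F.coeff F.val = 0 := by
        by_contra h0
        exact h (by simpa using ⟨hN, h0⟩)
      rw [lc, this, RatFunc.eval_zero]
  rw [e] at hsum
  refine hsum.congr fun x => ?_
  rw [partialSum, Finset.mul_sum]
  refine Finset.sum_congr rfl fun s _ => ?_
  rw [sub_eq_add_neg, nomePow_add]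
  ring

/-- The tail of the series is small uniformly in p and z, and a finite partial sum tends to its
leading coefficient. Joint convergence in p and z off finitely many points is all that is used of
the expansions. -/
theorem ConvergesTo.exists_tendsto {F : NomeSeries} {f : ℂ → ℂ → ℂ} (h : F.ConvergesTo f) :
    ∃ P : Polynomial ℂ, P ≠ 0 ∧ ∀ z₀, z₀ ≠ 0 → P.eval z₀ ≠ 0 →
      Tendsto (fun x : ℂ × ℂ => nomePow (-F.val) x.1 * f x.1 x.2) (nomeToZero ×ˢ 𝓝 z₀)
        (𝓝 (F.lc z₀)) := by
  obtain ⟨P, hP0, hden, hconv⟩ := h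
  refine ⟨P, hP0, fun z₀ hz0 hPz => ?_⟩
  have hopen : IsOpen {z : ℂ | z ≠ 0 ∧ P.eval z ≠ 0} :=
    isOpen_ne.inter (isOpen_ne_fun P.continuous continuous_const)
  obtain ⟨r, hr, hrK⟩ := Metric.nhds_basis_closedBall.mem_iff.1 (hopen.mem_nhds ⟨hz0, hPz⟩)
  obtain ⟨M, hM⟩ := hconv _ (isCompact_closedBall z₀ r) hrK
  rw [Metric.tendsto_nhds]
  intro d hd
  obtain ⟨N, hN, hNv⟩ := ((Metric.tendstoUniformlyOn_iff.1 hM (d / 2) (half_pos hd)).and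
    (eventually_ge_atTop F.val)).exists
  have h3 := Metric.tendsto_nhds.1 (F.tendsto_partialSum hNv fun s => hden s z₀ hz0 hPz) (d / 2)
    (half_pos hd)
  have h4 : ∀ᶠ x : ℂ × ℂ in nomeToZero ×ˢ 𝓝 z₀, x ∈ {l : ℂ | l.re ≤ M} ×ˢ Metric.closedBall z₀ r :=
    prod_mem_prod ((tendsto_re_nomeToZero).eventually (eventually_le_atBot M))
      (Metric.closedBall_mem_nhds z₀ hr)
  filter_upwards [h3, h4] with x hx hxK
  have := hN x hxK
  linarith [dist_triangle (nomePow (-F.val) x.1 * f x.1 x.2)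
    (nomePow (-F.val) x.1 * F.partialSum N x.1 x.2) (F.lc z₀)]

end NomeSeries

end

section

/-! ### Contours for the limiting form -/

section Contours

variable {q : ℂ} {τ t : Fin 6 → ℂ} {α : Fin 6 → ℝ} {ζ : ℝ} {a b : Fin 6} {mf mg : ℕ}

theorem shifted_ne_zero (hq0 : q ≠ 0) (ht : ∀ r, t r ≠ 0) (mf mg : ℕ) (r : Fin 6) :
    shifted q mf mg t r ≠ 0 := by
  rw [shifted_eq]
  exact div_ne_zero (ht r) (pow_ne_zero _ hq0)

theorem shifted_mul_ne (hq0 : q ≠ 0) (hgen : ∀ (r s : Fin 6) (n : ℤ), t r * t s ≠ q ^ n)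
    (mf mg : ℕ) (r s : Fin 6) (n : ℤ) : shifted q mf mg t r * shifted q mf mg t s ≠ q ^ n := by
  rw [shifted_eq, shifted_eq]
  intro h
  refine hgen r s (n + shiftOrder mf mg r + shiftOrder mf mg s) ?_
  rw [zpow_add₀ hq0, zpow_add₀ hq0, ← h, zpow_natCast, zpow_natCast]
  field_simp

/-- Putting q for the nome p, with i = 0, lets the finiteness lemmas for the elliptic points apply
to the limiting ones. -/
theorem limInner_subset (q : ℂ) (τ : Fin 6 → ℂ) (a b : Fin 6) :
    limInner q τ a b ⊆ ellInner τ q q := by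
  rintro z ⟨k, rfl | rfl⟩
  · exact ⟨a, 0, k, by ring⟩
  · exact ⟨b, 0, k, by ring⟩

theorem limOuter_subset (q : ℂ) (τ : Fin 6 → ℂ) (α : Fin 6 → ℝ) (ζ : ℝ) (a b : Fin 6) :
    limOuter q τ α ζ a b ⊆ ellOuter τ q q := by
  rintro z ⟨r, k, -, rfl⟩
  exact ⟨r, 0, k, by ring⟩

theorem exists_limInner_norm_lt (hq : ‖q‖ < 1) (τ : Fin 6 → ℂ) (a b : Fin 6) :
    ∀ d > 0, ∃ x ∈ limInner q τ a b, ‖x‖ < d := by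
  intro d hd
  have h : Tendsto (fun j : ℕ => τ a * q ^ j) atTop (𝓝 0) := by
    simpa using (tendsto_pow_atTop_nhds_zero_of_norm_lt_one hq).const_mul (τ a)
  obtain ⟨j, hj⟩ := (h.norm.eventually (gt_mem_nhds (by simpa using hd))).exists
  exact ⟨_, ⟨j, Or.inl rfl⟩, hj⟩

/-- A point both inner and outer would put some product of two parameters in q^ℤ. -/
theorem exists_separates_lim (hq0 : q ≠ 0) (hq : ‖q‖ < 1) (hτ : ∀ r, τ r ≠ 0)
    (hgen : ∀ (r s : Fin 6) (n : ℤ), τ r * τ s ≠ q ^ n) (α : Fin 6 → ℝ) (ζ : ℝ) (a b : Fin 6) :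
    ∃ C : Chain, C.Separates (limInner q τ a b) (limOuter q τ α ζ a b) := by
  have h0 := zero_notMem_ellInner hq0 hq0 hτ
  have key : ∀ (c r : Fin 6) (j k : ℕ), τ c * q ^ j ≠ (τ r * q ^ k)⁻¹ := by
    intro c r j k h
    have hr := hτ r
    refine hgen c r (-(j + k)) ?_
    rw [zpow_neg, zpow_add₀ hq0, zpow_natCast, zpow_natCast]
    have h1 := mul_inv_cancel₀ (mul_ne_zero hr (pow_ne_zero k hq0))
    rw [← h] at h1
    refine eq_inv_of_mul_eq_one_left ?_
    rw [← h1]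
    ring
  have hdis : Disjoint (limInner q τ a b) (limOuter q τ α ζ a b) := by
    refine disjoint_left.2 ?_
    rintro z ⟨j, h1⟩ ⟨r, k, -, h2⟩
    rcases h1 with h1 | h1
    · exact key a r j k (h1.symm.trans h2)
    · exact key b r j k (h1.symm.trans h2)
  obtain ⟨C, hC, -⟩ := Chain.exists_separates (Inn := limInner q τ a b)
    (Out := limOuter q τ α ζ a b) hdis (fun h => h0 (limInner_subset _ _ _ _ h))
    (fun h => h0 (by simpa using mem_ellOuter_iff.1 (limOuter_subset _ _ _ _ _ _ h)))
    (fun d hd => (finite_ellInner hq hq τ hd).subset fun x hx => ⟨limInner_subset _ _ _ _ hx.1, hx.2⟩)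
    (fun R => (finite_ellOuter hq0 hq hq0 hq hτ R).subset
      fun x hx => ⟨limOuter_subset _ _ _ _ _ _ hx.1, hx.2⟩)
  exact ⟨C, hC⟩

theorem isOpen_limDomain (hq0 : q ≠ 0) (hq : ‖q‖ < 1) (hτ : ∀ r, τ r ≠ 0) :
    IsOpen (limDomain q τ α ζ a b) := by
  rw [isOpen_iff_mem_nhds]
  rintro z ⟨hz0, hzi, hzo⟩
  have hzn := norm_pos_iff.2 hz0
  set S₁ := {x ∈ limInner q τ a b | ‖z‖ / 2 ≤ ‖x‖} with hS₁
  set S₂ := {x ∈ limOuter q τ α ζ a b | ‖x‖ ≤ ‖z‖ + 1} with hS₂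
  have h1 : S₁.Finite := (finite_ellInner hq hq τ (half_pos hzn)).subset
    fun x hx => ⟨limInner_subset _ _ _ _ hx.1, hx.2⟩
  have h2 : S₂.Finite := (finite_ellOuter hq0 hq hq0 hq hτ (‖z‖ + 1)).subset
    fun x hx => ⟨limOuter_subset _ _ _ _ _ _ hx.1, hx.2⟩
  filter_upwards [h1.isClosed.isOpen_compl.mem_nhds fun h => hzi h.1,
    h2.isClosed.isOpen_compl.mem_nhds fun h => hzo h.1,
    continuous_norm.continuousAt.eventually (lt_mem_nhds (half_lt_self hzn)),
    continuous_norm.continuousAt.eventually (gt_mem_nhds (lt_add_one ‖z‖))] with y g1 g2 g3 g4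
  refine ⟨?_, fun h => g1 ⟨h, le_of_lt g3⟩, fun h => g2 ⟨h, le_of_lt g4⟩⟩
  rintro rfl
  rw [norm_zero] at g3
  linarith

theorem Chain.Separates.support_subset_limDomain {D : Chain}
    (hD : D.Separates (limInner q τ a b) (limOuter q τ α ζ a b)) :
    D.support ⊆ limDomain q τ α ζ a b := fun _ hz =>
  ⟨fun h => hD.zero_notMem (h ▸ hz), disjoint_left.1 hD.disjoint_inner hz,
    disjoint_left.1 hD.disjoint_outer hz⟩

/-! ### Comparison of the contours -/

theorem eventually_dilate_support_subset (hq : ‖q‖ < 1) (h : Exponents α ζ a b) {D : Chain}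
    (hD : D.Separates (limInner q (shifted q mf mg t) a b)
      (limOuter q (shifted q mf mg t) α ζ a b)) :
    ∀ᶠ l in nomeToZero, (D.dilate (nomePow ζ l)).support ⊆
      regularDomain (shifted q mf mg (scaled t α l)) (nomeShift a b l) (exp l) q := by
  filter_upwards [eventually_forall_of_compact (L := nomeToZero) (P := fun l z => nomePow ζ l * z ∈
      regularDomain (shifted q mf mg (scaled t α l)) (nomeShift a b l) (exp l) q)
    D.isCompact_support fun z hz => eventually_mem_regularDomain hq h
      (hD.support_subset_limDomain hz)] with l hl
  rw [Chain.support_dilate]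
  rintro _ ⟨z, hz, rfl⟩
  exact hl z hz

/-- Divided by p^ζ, the nonzero singularities of the broken integrand are points τ_r p^e q^j (inner)
or reciprocals of such points (outer) with e ≥ 0. For e = 0 they are points that D separates by
assumption. For e > 0 the inner ones lie in a disc about 0 where D winds once, and the outer ones
lie beyond D; the estimates are uniform in j and e. -/
theorem eventually_dilate_winding_eq (hq : ‖q‖ < 1) (h : Exponents α ζ a b) {D : Chain}
    (hD : D.Separates (limInner q (shifted q mf mg t) a b)
      (limOuter q (shifted q mf mg t) α ζ a b)) :
    ∀ᶠ l in nomeToZero, ∀ C : Chain,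
      C.Separates (scaledInner q mf mg t α l) (scaledOuter q mf mg t α l) →
      ∀ x ∉ regularDomain (shifted q mf mg (scaled t α l)) (nomeShift a b l) (exp l) q,
        (D.dilate (nomePow ζ l)).winding x = C.winding x := by
  obtain ⟨δ, hδ, hδD⟩ := Chain.exists_ball_winding_eq hD.zero_notMem
  obtain ⟨R, hR, -, hRD⟩ := D.exists_winding_eq_zero
  set τ := shifted q mf mg t with hτ
  have hD0 : D.winding 0 = 1 := hD.winding_zero (exists_limInner_norm_lt hq τ a b)
  have e1 := fun r => eventually_norm_mul_nomePow_lt hq (τ r) (h.innerExp_mem r).1 hδ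
  have e2 := fun r => eventually_norm_mul_nomePow_lt hq (τ r) (h.outerExp_mem r).1 (inv_pos.2 hR)
  filter_upwards [eventually_all.2 e1, eventually_all.2 e2, eventually_norm_exp_lt_one]
    with l h1 h2 hp C hC x hx
  have hc := nomePow_ne_zero ζ l
  obtain ⟨y, rfl⟩ : ∃ y, x = nomePow ζ l * y := ⟨x / nomePow ζ l, by field_simp⟩
  rw [Chain.winding_dilate hc]
  by_cases hy : y = 0
  · rw [hy, mul_zero, hD0]
    exact (hC.winding_zero (exists_ellInner_norm_lt hq _)).symm
  have hx' : ∃ r, pqPoch (nomeShift a b l r * shifted q mf mg (scaled t α l) r *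
      (nomePow ζ l * y)) (exp l) q = 0 ∨
      pqPoch (shifted q mf mg (scaled t α l) r * (nomePow ζ l * y)⁻¹) (exp l) q = 0 := by
    by_contra! hcon
    exact hx ⟨mul_ne_zero hc hy, hcon⟩
  obtain ⟨r, hr | hr⟩ := hx'
  · obtain ⟨i, j, hij⟩ := pqPoch_eq_zero hp hq hr
    have hmem : nomePow ζ l * y ∈ scaledOuter q mf mg t α l := by
      refine mem_ellOuter_iff.2 ?_
      rcases eq_or_ne (nomeShift a b l r) 1 with he | he
      · refine ⟨r, i, j, inv_eq_of_mul_eq_one_right ?_⟩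
        rw [← hij, he]
        ring
      · refine ⟨r, i + 1, j, inv_eq_of_mul_eq_one_right ?_⟩
        rw [← hij, (nomeShift_eq a b l r).resolve_left he]
        ring
    rw [hC.winding_outer _ hmem]
    rw [shifted_scaled, nomeShift_mul] at hij
    by_cases h0 : i = 0 ∧ outerExp α ζ a b r = 0
    · refine hD.winding_outer _ ⟨r, j, (h.outerExp_eq_zero r).1 h0.2, ?_⟩
      rw [h0.1, h0.2, nomePow_zero] at hij
      refine eq_inv_of_mul_eq_one_left ?_
      rw [← hij]
      ring
    · refine hRD y ?_
      have h3 := h2 r i j h0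
      have h4 : ‖τ r * nomePow (outerExp α ζ a b r) l * exp l ^ i * q ^ j‖ * ‖y‖ = 1 := by
        rw [← norm_mul, ← norm_one (α := ℂ), ← hij]
        congr 1
        ring
      by_contra! hlt
      have : ‖τ r * nomePow (outerExp α ζ a b r) l * exp l ^ i * q ^ j‖ * ‖y‖ < R⁻¹ * R :=
        mul_lt_mul'' h3 hlt (norm_nonneg _) (norm_nonneg _)
      rw [h4, inv_mul_cancel₀ hR.ne'] at this
      exact lt_irrefl _ this
  · obtain ⟨i, j, hij⟩ := pqPoch_eq_zero hp hq hr
    have hmem : nomePow ζ l * y ∈ scaledInner q mf mg t α l := by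
      refine ⟨r, i, j, ?_⟩
      have := mul_ne_zero hc hy
      field_simp at hij
      rw [← hij]
      ring
    rw [hC.winding_inner _ hmem]
    rw [shifted_scaled, mul_nomePow_inv] at hij
    have hye : y = τ r * nomePow (α r - ζ) l * exp l ^ i * q ^ j := by
      field_simp at hij
      rw [← hij]
    by_cases h0 : i = 0 ∧ α r - ζ = 0
    · refine hD.winding_inner _ ⟨j, ?_⟩
      rw [h0.1, h0.2, nomePow_zero, mul_one, pow_zero, mul_one] at hye
      rcases (h.innerExp_eq_zero r).1 h0.2 with rfl | rfl
      · exact Or.inl hye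
      · exact Or.inr hye
    · have h3 := h1 r i j h0
      rw [← hye] at h3
      rw [(hδD y (by simpa using h3)).2, hD0]

/-! ### Nonresonance -/

theorem countable_setOf_exp_mul_eq {c : ℂ} (hc : c ≠ 0) (v : ℂ) :
    {l : ℂ | exp (c * l) = v}.Countable := by
  refine (countable_range fun n : ℤ => (log v + n * (2 * Real.pi * I)) / c).mono fun l hl => ?_
  have hl : exp (c * l) = v := hl
  have hv : v ≠ 0 := hl ▸ exp_ne_zero _
  rw [← exp_log hv, exp_eq_exp_iff_exists_int] at hl
  obtain ⟨n, hn⟩ := hl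
  exact ⟨n, by simp only [← hn, mul_div_cancel_left₀ _ hc]⟩

/-- A resonance is an equation τ_r τ_s p^e q^m = 1 with e = α_r + α_s + n. Genericity excludes it
for e = 0, and for e ≠ 0 it has countably many solutions log p. -/
theorem countable_compl_nonresonant (hq0 : q ≠ 0) (ht : ∀ r, t r ≠ 0)
    (hgen : ∀ (r s : Fin 6) (n : ℤ), t r * t s ≠ q ^ n) (mf mg : ℕ) (α : Fin 6 → ℝ) :
    (nonresonant q mf mg t α)ᶜ.Countable := by
  set τ := shifted q mf mg t with hτ
  have hc : ∀ x : (Fin 6 × Fin 6) × ℕ × ℕ, {l | τ x.1.1 * τ x.1.2 *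
      nomePow (α x.1.1 + α x.1.2 + x.2.1) l * q ^ x.2.2 = 1}.Countable := by
    rintro ⟨⟨r, s⟩, n, m⟩
    have hr : τ r ≠ 0 := shifted_ne_zero hq0 ht mf mg r
    have hs : τ s ≠ 0 := shifted_ne_zero hq0 ht mf mg s
    by_cases h0 : α r + α s + n = 0
    · convert countable_empty
      refine eq_empty_of_forall_notMem fun l hl => ?_
      simp only [mem_ofPred_eq, h0, nomePow_zero, mul_one] at hl
      refine shifted_mul_ne hq0 hgen mf mg r s (-m) ?_
      rw [zpow_neg, zpow_natCast]
      exact eq_inv_of_mul_eq_one_left hl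
    · refine (countable_setOf_exp_mul_eq (ofReal_ne_zero.2 h0) (τ r * τ s * q ^ m)⁻¹).mono
        fun l hl => ?_
      simp only [mem_ofPred_eq] at hl ⊢
      refine eq_inv_of_mul_eq_one_left ?_
      rw [← hl, nomePow]
      ring
  refine (countable_iUnion hc).mono fun l hl => ?_
  obtain ⟨z, ⟨r, i, j, h1⟩, ⟨s, i', j', h2⟩⟩ := not_disjoint_iff.1 hl
  refine mem_iUnion.2 ⟨⟨⟨r, s⟩, i + i', j + j'⟩, ?_⟩
  have hs : τ s ≠ 0 := shifted_ne_zero hq0 ht mf mg s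
  rw [h1, shifted_scaled, shifted_scaled] at h2
  simp only [mem_ofPred_eq]
  rw [Nat.cast_add, nomePow_add, nomePow_add, nomePow_add, nomePow_natCast, nomePow_natCast]
  have h3 := mul_inv_cancel₀ (mul_ne_zero (mul_ne_zero (pow_ne_zero i' (exp_ne_zero l))
    (pow_ne_zero j' hq0)) (mul_ne_zero hs (nomePow_ne_zero (α s) l)))
  rw [← h2] at h3
  rw [← h3, pow_add]
  ring

theorem frequently_nonresonant (hq0 : q ≠ 0) (ht : ∀ r, t r ≠ 0)
    (hgen : ∀ (r s : Fin 6) (n : ℤ), t r * t s ≠ q ^ n) (mf mg : ℕ) (α : Fin 6 → ℝ) :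
    ∃ᶠ l in nomeToZero, l ∈ nonresonant q mf mg t α := by
  intro hcon
  obtain ⟨A, hA, hsub⟩ := mem_comap.1 hcon
  obtain ⟨M, hM⟩ := mem_atBot_sets.1 hA
  have hopen : IsOpen {l : ℂ | l.re < M} := isOpen_lt continuous_re continuous_const
  have hz : ((M - 1 : ℝ) : ℂ) ∈ {l : ℂ | l.re < M} := by simp
  obtain ⟨l, hl1, hl2⟩ := ((frequently_notMem_of_countable
    (countable_compl_nonresonant hq0 ht hgen mf mg α) _).and_eventually (hopen.mem_nhds hz)).exists
  exact hl1 (hsub (hM _ (le_of_lt hl2)))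

/-- If T_r T_s p^i q^j = 1, a point of the sequence of the shifted T_r is the reciprocal of the
shifted T_s; the powers of q added to j undo both shifts. -/
theorem pqPoch_ne_zero_of_nonresonant (hq0 : q ≠ 0) (hq : ‖q‖ < 1) (ht : ∀ r, t r ≠ 0) {l : ℂ}
    (hl : l ∈ nonresonant q mf mg t α) (hp : ‖exp l‖ < 1) (r s : Fin 6) :
    pqPoch (scaled t α l r * scaled t α l s) (exp l) q ≠ 0 := by
  intro h0
  obtain ⟨i, j, hij⟩ := pqPoch_eq_zero hp hq h0
  have hs : scaled t α l s ≠ 0 := mul_ne_zero (ht s) (nomePow_ne_zero _ _)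
  have hin : exp l ^ i * q ^ (j + shiftOrder mf mg r + shiftOrder mf mg s) *
      shifted q mf mg (scaled t α l) r ∈ scaledInner q mf mg t α l := ⟨r, i, _, rfl⟩
  have hdis : Disjoint (scaledInner q mf mg t α l) (scaledOuter q mf mg t α l) := hl
  refine disjoint_left.1 hdis hin ⟨s, 0, 0, ?_⟩
  rw [shifted_eq, shifted_eq, pow_add, pow_add]
  field_simp
  linear_combination hij

/-- This is the half of θ(T_a T_b;q) not covered by nonresonance; its argument tends to 0 like
p^{−2ζ}. -/
theorem eventually_qPoch_div_ne_zero (hq : ‖q‖ < 1) (h : Exponents α ζ a b) :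
    ∀ᶠ l in nomeToZero, qPoch (q / (scaled t α l a * scaled t α l b)) q ≠ 0 := by
  have hneg := h.neg
  have h1 : Tendsto (fun l => q / (t a * t b) * nomePow (-ζ + -ζ) l) nomeToZero (𝓝 0) := by
    simpa using (tendsto_nomePow (s := -ζ + -ζ) (by linarith)).const_mul (q / (t a * t b))
  have h2 := (differentiable_qPoch hq).continuous.continuousAt.tendsto.comp h1
  rw [qPoch_zero_left] at h2
  filter_upwards [h2.eventually_ne one_ne_zero] with l hl
  rw [Function.comp, nomePow_add, nomePow_neg] at hl
  rw [scaled, scaled, h.left, h.right]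
  convert hl using 2
  have := nomePow_ne_zero ζ l
  field_simp

end Contours

end

section

/-! ### The constant in front of the integral -/

/-- Splitting a factor as v(r,s) v(s,r) turns a product over pairs r < s into one over all ordered
pairs, so that the order of a and b plays no role. -/
theorem prod_Ioi_eq_prod {ι : Type*} [LinearOrder ι] [Fintype ι] [LocallyFiniteOrderTop ι]
    [LocallyFiniteOrderBot ι] {u v : ι → ι → ℂ} (huv : ∀ r s, r ≠ s → u r s = v r s * v s r)
    (hv : ∀ r, v r r = 1) : ∏ r, ∏ s ∈ Finset.Ioi r, u r s = ∏ r, ∏ s, v r s := by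
  have h1 : ∏ r, ∏ s ∈ Finset.Ioi r, u r s = ∏ r, ∏ s ∈ Finset.Ioi r, v r s * v s r :=
    Finset.prod_congr rfl fun r _ => Finset.prod_congr rfl fun s hs =>
      huv r s (Finset.mem_Ioi.1 hs).ne
  rw [h1, Finset.prod_prod_Ioi_mul_eq_prod_prod_off_diag fun s r => v r s]
  refine Finset.prod_congr rfl fun r _ => Finset.prod_subset (Finset.subset_univ _) fun s _ hs => ?_
  simp only [Finset.mem_compl, Finset.mem_singleton, not_not] at hs
  rw [hs, hv]

theorem prod_ite_and_eq {ι : Type*} [DecidableEq ι] [Fintype ι] (b : ι) (Q : ι → Prop)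
    [DecidablePred Q] (X : ι → ℂ) :
    (∏ r, ∏ s, if s = b ∧ Q r then X r else 1) = ∏ r with Q r, X r := by
  rw [Finset.prod_filter]
  refine Finset.prod_congr rfl fun r _ => ?_
  by_cases h : Q r <;> simp [h]

/-- The exponent of `p` in the product `t_r t_s p^{α_r + α_s}` (shifted by `p` for the pair
`a`, `b`). -/
def pairExp (α : Fin 6 → ℝ) (a b r s : Fin 6) : ℝ :=
  α r + α s + if (r = a ∧ s = b) ∨ (r = b ∧ s = a) then 1 else 0

section Prefactor

variable {q : ℂ} {t : Fin 6 → ℂ} {α : Fin 6 → ℝ} {ζ : ℝ} {a b : Fin 6} {mf mg : ℕ}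

/-! ### Ranges of the exponents of the products `t_r t_s` -/

namespace Exponents

/-- In the total 1, the indices a, b contribute 2ζ and the two remaining ones at least −2ζ. -/
theorem add_le_one (h : Exponents α ζ a b) (hsum : ∑ r, α r = 1) {r s : Fin 6} (hrs : r ≠ s)
    (hra : r ≠ a) (hrb : r ≠ b) (hsa : s ≠ a) (hsb : s ≠ b) : α r + α s ≤ 1 := by
  have hab := h.ne
  set A : Finset (Fin 6) := {a, b, r, s} with hA
  have h1 : ∑ i ∈ A, α i = ζ + (ζ + (α r + α s)) := by
    rw [hA, Finset.sum_insert (by simp [hab, hra.symm, hsa.symm]),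
      Finset.sum_insert (by simp [hrb.symm, hsb.symm]), Finset.sum_pair hrs, h.left, h.right]
  have h2 : Aᶜ.card = 2 := by
    have : A.card = 4 := by
      rw [hA, Finset.card_insert_of_notMem (by simp [hab, hra.symm, hsa.symm]),
        Finset.card_insert_of_notMem (by simp [hrb.symm, hsb.symm]), Finset.card_pair hrs]
    rw [Finset.card_compl, this, Fintype.card_fin]
  have h3 := Finset.card_nsmul_le_sum Aᶜ α (-ζ) fun i hi => by
    have hi : i ≠ a ∧ i ≠ b ∧ i ≠ r ∧ i ≠ s := by simpa [hA] using hi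
    exact (h.other i hi.1 hi.2.1).1
  rw [h2] at h3
  have h4 := Finset.sum_add_sum_compl A α
  simp only [nsmul_eq_mul, Nat.cast_ofNat] at h3
  linarith

theorem pairExp_mem (h : Exponents α ζ a b) (hsum : ∑ r, α r = 1) {r s : Fin 6} (hrs : r ≠ s) :
    0 ≤ pairExp α a b r s ∧ pairExp α a b r s ≤ 1 := by
  have h1 := h.lower; have h2 := h.neg; have h3 := h.left; have h4 := h.right; have h5 := h.ne
  unfold pairExp
  split_ifs with hc
  · rcases hc with ⟨rfl, rfl⟩ | ⟨rfl, rfl⟩ <;> constructor <;> linarith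
  · have key : ∀ r s, r ≠ s → (r = a ∨ r = b) → ¬ ((r = a ∧ s = b) ∨ (r = b ∧ s = a)) →
        0 ≤ α r + α s ∧ α r + α s ≤ 1 := by
      intro r s hrs hr hc
      have hα : α r = ζ := by rcases hr with rfl | rfl <;> assumption
      have hsa : s ≠ a := by rintro rfl; rcases hr with rfl | rfl <;> simp_all
      have hsb : s ≠ b := by rintro rfl; rcases hr with rfl | rfl <;> simp_all
      obtain ⟨h6, h7⟩ := h.other s hsa hsb
      constructor <;> linarith
    rw [add_zero]
    by_cases hr : r = a ∨ r = b
    · exact key r s hrs hr hc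
    by_cases hs : s = a ∨ s = b
    · rw [add_comm]
      exact key s r hrs.symm hs (by tauto)
    rw [not_or] at hr hs
    refine ⟨?_, h.add_le_one hsum hrs hr.1 hr.2 hs.1 hs.2⟩
    linarith [(h.other r hr.1 hr.2).1, (h.other s hs.1 hs.2).1]

theorem pairExp_eq_one (h : Exponents α ζ a b) (r s : Fin 6) :
    pairExp α a b r s = 1 ↔ α r + α s = 1 := by
  have h2 := h.neg; have h3 := h.left; have h4 := h.right
  unfold pairExp
  split_ifs with hc
  · rcases hc with ⟨rfl, rfl⟩ | ⟨rfl, rfl⟩ <;> constructor <;> intro <;> linarith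
  · rw [add_zero]

/-- The exponent vanishes only for a or b paired with an index where α = −ζ, and for {a, b} when ζ =
−1/2. Each such pair is oriented with a or b in second place, and {a, b} as (a, b), in the form
required by `prod_Ioi_eq_prod`. -/
theorem pairExp_ite (h : Exponents α ζ a b) {P : Fin 6 → Fin 6 → ℂ} (hP : ∀ r s, P r s = P s r)
    {r s : Fin 6} (hrs : r ≠ s) : (if pairExp α a b r s = 0 then P r s else 1) =
      ((if s = a ∧ α r = -ζ then P r a else 1) * (if s = b ∧ α r = -ζ then P r b else 1) *
        (if s = b ∧ (r = a ∧ ζ = -1 / 2) then P r b else 1)) *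
      ((if r = a ∧ α s = -ζ then P s a else 1) * (if r = b ∧ α s = -ζ then P s b else 1) *
        (if r = b ∧ (s = a ∧ ζ = -1 / 2) then P s b else 1)) := by
  have h2 := h.neg; have h3 := h.left; have h4 := h.right; have hab := h.ne
  have hne : ζ ≠ -ζ := by linarith
  have e1 : ζ + ζ + 1 = 0 ↔ ζ = -1 / 2 := ⟨fun h => by linarith, fun h => by linarith⟩
  have e2 : ∀ x : ℝ, ζ + x = 0 ↔ x = -ζ := fun x => ⟨fun h => by linarith, fun h => by linarith⟩
  have e3 : ∀ x : ℝ, x + ζ = 0 ↔ x = -ζ := fun x => ⟨fun h => by linarith, fun h => by linarith⟩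
  unfold pairExp
  by_cases hra : r = a
  · subst hra
    by_cases hsb : s = b
    · subst hsb
      simp [h3, h4, hne, hab, hab.symm, e1]
    · simp [h3, hne, hab, hsb, hrs.symm, e2, hP r s]
  by_cases hrb : r = b
  · subst hrb
    by_cases hsa : s = a
    · subst hsa
      simp [h3, h4, hne, hab, hab.symm, e1, hP r s]
    · simp [h4, hne, hra, hsa, hrs.symm, e2, hP r s]
  by_cases hsa : s = a
  · subst hsa
    simp [h3, hra, hrb, hab, e3]
  by_cases hsb : s = b
  · subst hsb
    simp [h4, hra, hrb, hab.symm, e3]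
  have h5 := (h.other r hra hrb).1
  have h6 := (h.other s hsa hsb).1
  have : α r + α s ≠ 0 := by linarith
  simp [hra, hrb, hsa, hsb, this]

theorem prod_pairExp_eq_zero (h : Exponents α ζ a b) {P : Fin 6 → Fin 6 → ℂ}
    (hP : ∀ r s, P r s = P s r) :
    (∏ r, ∏ s ∈ Finset.Ioi r, if pairExp α a b r s = 0 then P r s else 1) =
      (if ζ = -1 / 2 then P a b else 1) * ∏ r with α r = -ζ, P r a * P r b := by
  have h2 := h.neg; have h3 := h.left; have h4 := h.right; have hab := h.ne
  have hne : ζ ≠ -ζ := by linarith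
  rw [prod_Ioi_eq_prod (fun r s hrs => h.pairExp_ite hP hrs)]
  · simp only [Finset.prod_mul_distrib]
    rw [prod_ite_and_eq a, prod_ite_and_eq b, prod_ite_and_eq b, mul_comm]
    congr 1
    split_ifs with hζ
    · simp [hζ, Finset.prod_filter]
    · simp [hζ]
  · intro r
    by_cases hra : r = a
    · subst hra
      simp [h3, hne, hab]
    · by_cases hrb : r = b
      · subst hrb
        simp [h4, hne, hra]
      · simp [hra, hrb]

end Exponents

theorem prod_ite_pair {a b : Fin 6} (hab : a ≠ b) (c : ℂ) :
    (∏ r, ∏ s ∈ Finset.Ioi r, if (r = a ∧ s = b) ∨ (r = b ∧ s = a) then c else 1) = c := by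
  rw [prod_Ioi_eq_prod (v := fun r s => if s = b ∧ r = a then c else 1)]
  · rw [prod_ite_and_eq b fun r => r = a]
    simp [Finset.filter_eq']
  · intro r s hrs
    by_cases h1 : r = a
    · by_cases h2 : s = b <;> simp [h1, h2, hab]
    · by_cases h2 : s = a <;> simp [h1, h2]
  · intro r
    rw [if_neg]
    rintro ⟨h1, h2⟩
    exact hab (h2.symm.trans h1)

theorem qPoch_ne_zero_of_forall_ne (hq : ‖q‖ < 1) {x : ℂ} (hx : ∀ n : ℤ, x ≠ q ^ n) :
    qPoch x q ≠ 0 := by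
  intro h0
  obtain ⟨j, hj⟩ := qPoch_eq_zero hq h0
  refine hx (-j) ?_
  rw [zpow_neg, zpow_natCast]
  exact eq_inv_of_mul_eq_one_left hj

/-- The constant θ(T_a T_b;q) of the three-term relation turns Γ(T_a T_b) into Γ(pT_a T_b). This
repairs the only pair with an exponent outside [0,1]. -/
theorem theta_mul_prod_ellGamma (hq : ‖q‖ < 1) (hab : a ≠ b) {l : ℂ} (hp : ‖exp l‖ < 1)
    (hne : pqPoch (scaled t α l a * scaled t α l b) (exp l) q ≠ 0) :
    theta (scaled t α l a * scaled t α l b) q *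
      ∏ r, ∏ s ∈ Finset.Ioi r, ellGamma (scaled t α l r * scaled t α l s) (exp l) q =
    ∏ r, ∏ s ∈ Finset.Ioi r, ellGamma (t r * t s * nomePow (pairExp α a b r s) l) (exp l) q := by
  rw [← prod_ite_pair hab (theta (scaled t α l a * scaled t α l b) q), ← Finset.prod_mul_distrib]
  refine Finset.prod_congr rfl fun r _ => ?_
  rw [← Finset.prod_mul_distrib]
  refine Finset.prod_congr rfl fun s _ => ?_
  have e : t r * t s * nomePow (α r + α s) l = scaled t α l r * scaled t α l s := by
    rw [nomePow_add, scaled, scaled]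
    ring
  have key := ellGamma_mul_left hp hq (exp_ne_zero l) hne
  unfold pairExp
  split_ifs with hc
  · rw [nomePow_add, nomePow_one, ← mul_assoc, e, mul_comm _ (exp l)]
    rcases hc with ⟨rfl, rfl⟩ | ⟨rfl, rfl⟩
    · exact key.symm
    · rw [mul_comm (scaled t α l r), key]
  · rw [add_zero, one_mul, e]

theorem tendsto_prefactor (hq0 : q ≠ 0) (hq : ‖q‖ < 1) (ht : ∀ r, t r ≠ 0)
    (hgen : ∀ (r s : Fin 6) (n : ℤ), t r * t s ≠ q ^ n) (h : Exponents α ζ a b)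
    (hsum : ∑ r, α r = 1) :
    Tendsto (fun l => qPoch q q * qPoch (exp l) (exp l) / (theta (scaled t α l a * scaled t α l b) q *
      ∏ r, ∏ s ∈ Finset.Ioi r, ellGamma (scaled t α l r * scaled t α l s) (exp l) q))
      (nomeToZero ⊓ 𝓟 (nonresonant q mf mg t α)) (𝓝 (limPrefactor q t α ζ a b)) := by
  have hgen' : ∀ (r s : Fin 6) (n : ℤ), q / (t r * t s) ≠ q ^ n := by
    intro r s n hn
    refine hgen r s (1 - n) ?_
    rw [zpow_sub₀ hq0, ← hn, zpow_one, div_div_cancel₀ hq0]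
  have hpair : ∀ r s, s ∈ Finset.Ioi r → Tendsto
      (fun l => ellGamma (t r * t s * nomePow (pairExp α a b r s) l) (exp l) q) nomeToZero
      (𝓝 ((if α r + α s = 1 then qPoch (q / (t r * t s)) q else 1) /
        (if pairExp α a b r s = 0 then qPoch (t r * t s) q else 1))) := by
    intro r s hs
    have hm := h.pairExp_mem hsum (Finset.mem_Ioi.1 hs).ne
    have := tendsto_ellGamma hq tendsto_id (tendsto_const_nhds (x := t r * t s))
      (mul_ne_zero (ht r) (ht s)) hm.1 hm.2
      fun _ => qPoch_ne_zero_of_forall_ne hq (hgen r s)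
    simpa only [h.pairExp_eq_one, id] using this
  have hden := tendsto_finsetProd Finset.univ fun r _ =>
    tendsto_finsetProd (Finset.Ioi r) fun s hs => hpair r s hs
  have hpp : Tendsto (fun l => qPoch (exp l) (exp l)) nomeToZero (𝓝 1) := by
    have := (continuousAt_qPoch 0 (p := 0) (by simp)).tendsto.comp
      (tendsto_exp_nomeToZero.prodMk_nhds tendsto_exp_nomeToZero)
    rwa [qPoch_zero_left] at this
  have hne : (∏ r, ∏ s ∈ Finset.Ioi r, (if α r + α s = 1 then qPoch (q / (t r * t s)) q else 1) /
        (if pairExp α a b r s = 0 then qPoch (t r * t s) q else 1)) ≠ 0 := by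
    refine Finset.prod_ne_zero_iff.2 fun r _ => Finset.prod_ne_zero_iff.2 fun s _ => ?_
    refine div_ne_zero ?_ ?_ <;> split_ifs
    · exact qPoch_ne_zero_of_forall_ne hq (hgen' r s)
    · exact one_ne_zero
    · exact qPoch_ne_zero_of_forall_ne hq (hgen r s)
    · exact one_ne_zero
  have hall := (hpp.const_mul (qPoch q q)).div hden hne
  have hlim : qPoch q q * 1 / (∏ r, ∏ s ∈ Finset.Ioi r,
      (if α r + α s = 1 then qPoch (q / (t r * t s)) q else 1) /
        (if pairExp α a b r s = 0 then qPoch (t r * t s) q else 1)) = limPrefactor q t α ζ a b := by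
    simp only [Finset.prod_div_distrib]
    rw [h.prod_pairExp_eq_zero (P := fun r s => qPoch (t r * t s) q)
      fun r s => by rw [mul_comm]]
    simp only [← Finset.prod_filter, limPrefactor]
    rw [mul_one, div_div_eq_mul_div, mul_assoc (qPoch q q)]
    congr 1
    refine Finset.prod_congr rfl fun r _ => Finset.prod_congr rfl fun s _ => ?_
    rw [div_eq_mul_inv, mul_inv, mul_assoc]
  rw [← hlim]
  refine (hall.mono_left inf_le_left).congr' ?_
  filter_upwards [mem_inf_of_left eventually_norm_exp_lt_one, mem_inf_of_right (mem_principal_self _)]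
    with l hp hl
  simp only [Pi.div_apply]
  rw [theta_mul_prod_ellGamma hq h.ne hp (pqPoch_ne_zero_of_nonresonant hq0 hq ht hl hp a b)]

end Prefactor

end

section

/-! ### The limit of the bilinear form -/

instance : nomeToZero.IsCountablyGenerated := by
  unfold nomeToZero
  infer_instance

section Limit

variable {q : ℂ} {t : Fin 6 → ℂ} {α : Fin 6 → ℝ} {ζ : ℝ} {a b : Fin 6} {mf mg : ℕ}

theorem scaled_ne_zero (ht : ∀ r, t r ≠ 0) (α : Fin 6 → ℝ) (l : ℂ) (r : Fin 6) :
    scaled t α l r ≠ 0 :=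
  mul_ne_zero (ht r) (nomePow_ne_zero _ _)

theorem scaled_mul_nomePow_neg {r : Fin 6} (hr : α r = ζ) (w l : ℂ) :
    scaled t α l r * (w * nomePow (-ζ) l) = t r * w := by
  have := nomePow_ne_zero ζ l
  rw [scaled, hr, nomePow_neg]
  field_simp

theorem countable_setOf_mem_nomeLattice {T : Fin 6 → ℂ} (hT : ∀ r, T r ≠ 0) {c : ℂ} (hc : c ≠ 0)
    (p q : ℂ) : {z : ℂ | ∃ r, T r * (c * z) ∈ nomeLattice p q ∨
      T r * (c * z)⁻¹ ∈ nomeLattice p q}.Countable := by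
  have h1 : ∀ r, Function.Injective fun z => T r * (c * z) := fun r =>
    (mul_right_injective₀ (hT r)).comp (mul_right_injective₀ hc)
  have h2 : ∀ r, Function.Injective fun z => T r * (c * z)⁻¹ := fun r =>
    (mul_right_injective₀ (hT r)).comp (inv_injective.comp (mul_right_injective₀ hc))
  refine (countable_iUnion fun r => ((countable_nomeLattice p q).preimage_of_injOn
    (h1 r).injOn).union ((countable_nomeLattice p q).preimage_of_injOn (h2 r).injOn)).mono ?_
  rintro z ⟨r, hr⟩
  exact mem_iUnion.2 ⟨r, hr⟩

theorem countable_setOf_eval_eq_zero {P : Polynomial ℂ} (hP : P ≠ 0) :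
    {z : ℂ | P.eval z = 0}.Countable :=
  (P.finite_setOfPred_isRoot hP).countable

/-- For small nonresonant p the form is a convergent constant times the integral of X over the fixed
chain D, and X converges off finitely many points. -/
theorem tendsto_ellForm (hq0 : q ≠ 0) (hq : ‖q‖ < 1) (ht : ∀ r, t r ≠ 0)
    (hgen : ∀ (r s : Fin 6) (n : ℤ), t r * t s ≠ q ^ n) (h : Exponents α ζ a b)
    (hsum : ∑ r, α r = 1) {f g : ℂ → ℂ → ℂ}
    (hf : ∀ᶠ l in nomeToZero, InA (scaled t α l 4) (exp l) q mf (f l))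
    (hg : ∀ᶠ l in nomeToZero, InA (scaled t α l 5) (exp l) q mg (g l)) {F G : NomeSeries}
    (hF : F.ConvergesTo fun l z => f l (nomePow ζ l * z))
    (hG : G.ConvergesTo fun l z => g l (nomePow ζ l * z)) {w : ℂ} (hw : w ≠ 0)
    (haw : theta (t a * w) q ≠ 0) (hbw : theta (t b * w) q ≠ 0) {D : Chain}
    (hD : D.Separates (limInner q (shifted q mf mg t) a b)
      (limOuter q (shifted q mf mg t) α ζ a b)) {C : ℂ → Chain}
    (hC : ∀ᶠ l in nomeToZero ⊓ 𝓟 (nonresonant q mf mg t α),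
      (C l).Separates (scaledInner q mf mg t α l) (scaledOuter q mf mg t α l)) :
    Tendsto (fun l => nomePow (-F.val - G.val) l *
        ellForm (scaled t α l) (exp l) q (f l) (g l) (C l))
      (nomeToZero ⊓ 𝓟 (nonresonant q mf mg t α)) (𝓝 (limForm q t α ζ a b w F.lc G.lc D)) := by
  set L := nomeToZero ⊓ 𝓟 (nonresonant q mf mg t α) with hL
  have hLle : L ≤ nomeToZero := inf_le_left
  have hT := scaled_ne_zero ht α
  have hW : ∀ l, w * nomePow (-ζ) l ≠ 0 := fun l => mul_ne_zero hw (nomePow_ne_zero _ _)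
  -- The regularised integrand is chosen for every l at once, with content only where the
  -- assumptions on p, f and g hold.
  have hex : ∀ l, ∃ Ψ : ℂ → ℂ, ‖exp l‖ < 1 → InA (scaled t α l 4) (exp l) q mf (f l) →
      InA (scaled t α l 5) (exp l) q mg (g l) →
      DifferentiableOn ℂ Ψ
        (regularDomain (shifted q mf mg (scaled t α l)) (nomeShift a b l) (exp l) q) ∧
      ∀ z ∈ regularDomain (shifted q mf mg (scaled t α l)) (nomeShift a b l) (exp l) q,
        (∀ r, scaled t α l r * z ∉ nomeLattice (exp l) q) →
        (∀ r, scaled t α l r * z⁻¹ ∉ nomeLattice (exp l) q) →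
        Ψ z = f l z * g l z * brokenWeight (scaled t α l) (nomeShift a b l) (exp l) q a b
          (w * nomePow (-ζ) l) z := by
    intro l
    by_cases hl : ‖exp l‖ < 1 ∧ InA (scaled t α l 4) (exp l) q mf (f l) ∧
        InA (scaled t α l 5) (exp l) q mg (g l)
    · obtain ⟨Ψ, hΨ⟩ := exists_regular (exp_ne_zero l) hl.1 hq0 hq (hT l) (nomeShift_eq a b l)
        hl.2.1 hl.2.2 a b (hW l)
      exact ⟨Ψ, fun _ _ _ => hΨ⟩
    · exact ⟨0, fun h1 h2 h3 => (hl ⟨h1, h2, h3⟩).elim⟩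
  choose Ψ hΨ using hex
  have hgood : ∀ᶠ l in nomeToZero, ‖exp l‖ < 1 ∧ InA (scaled t α l 4) (exp l) q mf (f l) ∧
      InA (scaled t α l 5) (exp l) q mg (g l) := eventually_norm_exp_lt_one.and (hf.and hg)
  set X : ℂ → ℂ → ℂ := fun l z =>
    nomePow (-F.val - G.val) l * (Ψ l (nomePow ζ l * z) / (2 * Real.pi * I * z)) with hX
  set c := theta (t a * w) q * theta (t b * w) q with hc
  have hc0 : c ≠ 0 := mul_ne_zero haw hbw
  obtain ⟨P₁, hP₁, hF'⟩ := hF.exists_tendsto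
  obtain ⟨P₂, hP₂, hG'⟩ := hG.exists_tendsto
  have hΩ : IsOpen (limDomain q (shifted q mf mg t) α ζ a b) :=
    isOpen_limDomain hq0 hq (shifted_ne_zero hq0 ht mf mg)
  have hdiff : ∀ z ∈ limDomain q (shifted q mf mg t) α ζ a b,
      ∀ᶠ x : ℂ × ℂ in nomeToZero ×ˢ 𝓝 z, DifferentiableAt ℂ (X x.1) x.2 := by
    intro z hz
    filter_upwards [eventually_mem_regularDomain hq h hz, tendsto_fst.eventually hgood,
      tendsto_snd.eventually (eventually_ne_nhds hz.1)] with x h1 h2 h3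
    have h4 := ((hΨ x.1 h2.1 h2.2.1 h2.2.2).1).differentiableAt
      ((isOpen_regularDomain h2.1 hq _ _).mem_nhds h1)
    have h5 : DifferentiableAt ℂ (fun z => Ψ x.1 (nomePow ζ x.1 * z)) x.2 :=
      h4.comp x.2 (differentiableAt_id.const_mul _)
    exact (h5.div (differentiableAt_id.const_mul _) (mul_ne_zero two_pi_I_ne_zero h3)).const_mul _
  have hpt : ∀ z ∈ limDomain q (shifted q mf mg t) α ζ a b,
      z ∉ {z | P₁.eval z = 0} ∪ {z | P₂.eval z = 0} →
      Tendsto (fun x : ℂ × ℂ => X x.1 x.2) (nomeToZero ×ˢ 𝓝 z)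
        (𝓝 (c * (F.lc z * G.lc z * limWeight q t α ζ a b w z / (2 * Real.pi * I * z)))) := by
    intro z hz hzB
    rw [mem_union, not_or] at hzB
    have h2 : Tendsto (Prod.snd : ℂ × ℂ → ℂ) (nomeToZero ×ˢ 𝓝 z) (𝓝 z) := tendsto_snd
    -- Ψ is known to equal the explicit integrand only off a countable set that varies with p;
    -- continuity of X carries the limit over.
    refine tendsto_prod_of_eq_off_countable (Y := fun l z =>
      (nomePow (-F.val) l * f l (nomePow ζ l * z)) * (nomePow (-G.val) l * g l (nomePow ζ l * z)) *
        brokenWeight (scaled t α l) (nomeShift a b l) (exp l) q a b (w * nomePow (-ζ) l)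
          (nomePow ζ l * z) / (2 * Real.pi * I * z))
      ((hdiff z hz).mono fun x hx => hx.continuousAt)
      (fun l => countable_setOf_mem_nomeLattice (hT l) (nomePow_ne_zero ζ l) (exp l) q) ?_ ?_
    · filter_upwards [eventually_mem_regularDomain hq h hz, tendsto_fst.eventually hgood]
        with x h1 h2 h3
      have h3 : ∀ r, scaled t α x.1 r * (nomePow ζ x.1 * x.2) ∉ nomeLattice (exp x.1) q ∧
          scaled t α x.1 r * (nomePow ζ x.1 * x.2)⁻¹ ∉ nomeLattice (exp x.1) q := by
        intro r
        rw [← not_or]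
        exact fun hr => h3 ⟨r, hr⟩
      simp only [hX]
      rw [(hΨ x.1 h2.1 h2.2.1 h2.2.2).2 _ h1 (fun r => (h3 r).1) (fun r => (h3 r).2),
        sub_eq_add_neg, nomePow_add]
      ring
    · have := (((hF' z hz.1 hzB.1).mul (hG' z hz.1 hzB.2)).mul (tendsto_brokenWeight hq0 hq ht h hw
        haw hbw (limDomain_shifted_subset hq0 mf mg hz))).div (h2.const_mul (2 * Real.pi * I))
        (mul_ne_zero two_pi_I_ne_zero hz.1)
      convert this using 2
      · rfl
      · rw [hc]
        ring
  have hint : Tendsto (fun l => D.integral (X l)) L (𝓝 (D.integral fun z =>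
      c * (F.lc z * G.lc z * limWeight q t α ζ a b w z / (2 * Real.pi * I * z)))) :=
    Chain.tendsto_integral hΩ hD.support_subset_limDomain
      ((countable_setOf_eval_eq_zero hP₁).union (countable_setOf_eval_eq_zero hP₂))
      (fun z hz => (hdiff z hz).filter_mono (Filter.prod_mono_left _ hLle))
      (fun z hz hzB => (hpt z hz hzB).mono_left (Filter.prod_mono_left _ hLle))
  have hall := ((tendsto_prefactor (mf := mf) (mg := mg) hq0 hq ht hgen h hsum).mul_const
    c⁻¹).mul hint
  rw [Chain.integral_const_mul, mul_assoc, inv_mul_cancel_left₀ hc0] at hall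
  refine hall.congr' ?_
  filter_upwards [hLle hgood, hC, mem_inf_of_right (mem_principal_self _),
    hLle (eventually_dilate_support_subset hq h hD), hLle (eventually_dilate_winding_eq hq h hD),
    hLle (eventually_qPoch_div_ne_zero (t := t) hq h)] with l h1 h2 h3 h4 h5 h6
  have hp0 := exp_ne_zero l
  have hκ := nomePow_ne_zero ζ l
  have hab0 : theta (scaled t α l a * scaled t α l b) q ≠ 0 := by
    refine mul_ne_zero (qPoch_ne_zero_of_pqPoch h1.1 hq
      (pqPoch_ne_zero_of_nonresonant hq0 hq ht h3 h1.1 a b)).2 h6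
  have ea := scaled_mul_nomePow_neg (t := t) h.left w l
  have eb := scaled_mul_nomePow_neg (t := t) h.right w l
  -- Here C is exchanged for the dilate of D; the factor 2 gained cancels the 2 in the definition of
  -- the form.
  have key := integral_eq_broken hp0 h1.1 hq0 hq (hT l) h.ne (fun r => rfl) h1.2.1.symmetric
    h1.2.2.symmetric (hW l) hab0 (by rwa [ea]) (by rwa [eb]) (hΨ l h1.1 h1.2.1 h1.2.2).1
    (hΨ l h1.1 h1.2.1 h1.2.2).2 h2 h4 (h5 _ h2)
  have hdil : (D.dilate (nomePow ζ l)).integral (fun z => Ψ l z / (2 * Real.pi * I * z)) =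
      D.integral fun z => Ψ l (nomePow ζ l * z) / (2 * Real.pi * I * z) := by
    rw [Chain.integral_dilate]
    congr 1
    funext z
    rw [← mul_div_assoc, mul_left_comm _ (nomePow ζ l), mul_div_mul_left _ _ hκ]
  rw [ellForm, key, hdil, ea, eb, hX, Chain.integral_const_mul, hc]
  ring

end Limit

end

end EllipticLimit

end

open EllipticLimit in
theorem mainTheorem9
    (q : ℂ) (hq0 : q ≠ 0) (hq1 : ‖q‖ < 1)
    (t : Fin 6 → ℂ) (ht : ∏ r, t r = q)
    (hgen : ∀ (r s : Fin 6) (n : ℤ), t r * t s ≠ q ^ n)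
    (α : Fin 6 → ℝ) (ζ : ℝ) (a b : Fin 6)
    (hζ : -1 / 2 ≤ ζ) (hζ0 : ζ < 0) (hsum : ∑ r, α r = 1)
    (hab : a ≠ b) (ha : α a = ζ) (hb : α b = ζ)
    (hα : ∀ r, r ≠ a → r ≠ b → -ζ ≤ α r ∧ α r ≤ 1 + ζ)
    (f g : ℂ → ℂ → ℂ) (mf mg : ℕ)
    (hf : ∀ᶠ l in nomeToZero, InA (t 4 * nomePow (α 4) l) (Complex.exp l) q mf (f l))
    (hg : ∀ᶠ l in nomeToZero, InA (t 5 * nomePow (α 5) l) (Complex.exp l) q mg (g l))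
    (F G : NomeSeries)
    (hF : F.ConvergesTo (fun l z => f l (nomePow ζ l * z)))
    (hG : G.ConvergesTo (fun l z => g l (nomePow ζ l * z))) :
    -- the contours exist
    (∃ᶠ l in nomeToZero, l ∈ nonresonant q mf mg t α) ∧
    (∀ᶠ l in nomeToZero, l ∈ nonresonant q mf mg t α →
      ∃ C : Chain, C.Separates (scaledInner q mf mg t α l) (scaledOuter q mf mg t α l)) ∧
    (∃ C : Chain, C.Separates (limInner q (shifted q mf mg t) a b)
      (limOuter q (shifted q mf mg t) α ζ a b)) ∧
    -- the limit, for all admissible contours and every auxiliary parameter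
    ∀ (w : ℂ), w ≠ 0 → theta (t a * w) q ≠ 0 → theta (t b * w) q ≠ 0 →
      ∀ D : Chain, D.Separates (limInner q (shifted q mf mg t) a b)
          (limOuter q (shifted q mf mg t) α ζ a b) →
        ∀ C : ℂ → Chain,
          (∀ᶠ l in nomeToZero ⊓ 𝓟 (nonresonant q mf mg t α),
            (C l).Separates (scaledInner q mf mg t α l) (scaledOuter q mf mg t α l)) →
          Tendsto
            (fun l => nomePow (-F.val - G.val) l *
              ellForm (scaled t α l) (Complex.exp l) q (f l) (g l) (C l))
            (nomeToZero ⊓ 𝓟 (nonresonant q mf mg t α))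
            (𝓝 (limForm q t α ζ a b w F.lc G.lc D)) := by
  have ht0 : ∀ r, t r ≠ 0 := fun r =>
    Finset.prod_ne_zero_iff.1 (ht.symm ▸ hq0) r (Finset.mem_univ r)
  have h : Exponents α ζ a b := ⟨hζ, hζ0, hab, ha, hb, hα⟩
  refine ⟨frequently_nonresonant hq0 ht0 hgen mf mg α, ?_,
    exists_separates_lim hq0 hq1 (shifted_ne_zero hq0 ht0 mf mg)
      (shifted_mul_ne hq0 hgen mf mg) α ζ a b,
    fun w hw haw hbw D hD C hC =>
      tendsto_ellForm hq0 hq1 ht0 hgen h hsum hf hg hF hG hw haw hbw hD hC⟩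
  filter_upwards [eventually_norm_exp_lt_one] with l hp hl
  obtain ⟨C, hC, -⟩ := exists_separates_ell (Complex.exp_ne_zero l) hp hq0 hq1
    (shifted_ne_zero hq0 (scaled_ne_zero ht0 α l) mf mg) hl
  exact ⟨C, hC⟩
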